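/- **Theorem 3.1 (Bochner–Martinelli formula).** Let $n\ge 3$, and write points of $\mathbb R^{2n}$ as $x=(x_{Aj})$, $A\in\{0,1\}$, $1\le j\le n$. Let $\mathbb S^{\pm}$ be the spin modules of the complex Clifford algebra with $n$ generators, that is, with $m=\lfloor n/2\rfloor$, $\mathbb S^{+}=\wedge^{\mathrm{even}}\mathbb C^m$ and $\mathbb S^-=\wedge^{\mathrm{odd}}\mathbb C^m$ if $n$ is even, and $\mathbb S^+=\mathbb S^-=\wedge^{\bullet}\mathbb C^m$ if $n$ is odd, with the Hermitian inner products for which the standard bases are orthonormal. Let $\gamma_1,\dots,\gamma_n:\mathbb S^{\pm}\to\mathbb S^{\mp}$ be the Dirac matrices: writing $f_j$ for the exterior product with the $j$-th basis vector of $\mathbb C^m$ and $\bar f_j$ for its adjoint (contraction), $\gamma_{2j-1}=f_j-\bar f_j$, $\gamma_{2j}=-\mathbf i(f_j+\bar f_j)$ for $1\le j\le m$, and, if $n=2m+1$, $\gamma_{n}=-\mathbf i(-1)^{p}$ on $\wedge^p\mathbb C^m$ (so $\gamma_j\gamma_k+\gamma_k\gamma_j=-2\delta_{jk}$ and $\gamma_j^*=-\gamma_j$).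 For an $\mathbb S^+$-valued function $f$ put $$\mathscr D_0 f=\begin{pmatrix}\nabla_0 f\\ \nabla_1 f\end{pmatrix},\qquad \nabla_A=\sum_{j=1}^n\gamma_j\frac{\partial}{\partial x_{Aj}},$$ and let $\mathscr D_0^*$ be the formal adjoint of $\mathscr D_0$. (i) Let $C_{2n}=\dfrac{1}{8(n-1)(n-2)\,\omega_{2n}}$, where $\omega_{2n}=\dfrac{2\pi^n}{(n-1)!}$ is the area of the unit sphere in $\mathbb R^{2n}$. Then $C_{2n}>0$ and $G_0(x)=C_{2n}|x|^{4-2n}$ is a fundamental solution of $\Delta^2$ on $\mathbb R^{2n}$. Let $G_1=\mathrm{diag}(G_0,G_0)$ and $H=\mathscr D_0^*\mathscr D_0\mathscr D_0^*G_1$ (the operators acting on the columns of $G_1$). (ii) For $x\ne0$, $$H(x)=c\left(\sum_{j}\frac{\gamma_jx_{0j}}{|x|^{2n}},\ \sum_{k}\frac{\gamma_kx_{1k}}{|x|^{2n}}\right),\qquad c=-8(n-1)(n-2)C_{2n}.$$ (iii) Let $\Omega\subset\mathbb R^{2n}$ be a bounded open set with $C^2$ boundary, $U\supset\overline\Omega$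 an open set, and $f:U\to\mathbb S^+$ a continuous function of class $W^{1,2}(U)$. Let $(n_{Aj})$ be the unit outer normal vector to $\partial\Omega$, $n_A=\sum_j\gamma_jn_{Aj}$, and let $dS$ be the surface measure on $\partial\Omega$. With weak derivatives in $\mathscr D_0f$, the formula $$f(x)=-\int_{\partial\Omega}H(x-y)\begin{pmatrix}n_0\\n_1\end{pmatrix}f(y)\,dS(y)+\int_{\Omega}H(x-y)\,\mathscr D_0f(y)\,dV(y)$$ holds for every $x\in\Omega$ if the volume integral is read as the principal value $\lim_{\varepsilon\to0^+}\int_{\Omega\setminus\{|x-y|\le\varepsilon\}}$ (the limit exists, and the boundary integral and, for each $\varepsilon>0$, the truncated volume integral converge absolutely). It holds with the volume integral as a Lebesgue integral for every $x\in\Omega$ at which that integral converges absolutely, and this is the case for almost every $x\in\Omega$. -/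

import Mathlib

open MeasureTheory Filter Topology Set
open scoped ContDiff

noncomputable section

namespace DiracTwo

/-! ### Spin modules and Dirac matrices

With `m = n / 2`, the exterior algebra of `W = span (f_1, …, f_m)` has the basis `f_α`, indexed by
the subsets `α` of `{1, …, m}`; the Hermitian inner product makes this basis orthonormal. -/

/-- The basis `f_α` of `𝕊⁺`: all even `α` if `n` is even, all `α` if `n` is odd. -/
abbrev PlusIndex (n : ℕ) : Type := {α : Finset (Fin (n / 2)) // Odd n ∨ Even α.card}

/-- The basis `f_α` of `𝕊⁻`: all odd `α` if `n` is even, all `α` if `n` is odd. -/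
abbrev MinusIndex (n : ℕ) : Type := {α : Finset (Fin (n / 2)) // Odd n ∨ Odd α.card}

/-- The spin module `𝕊⁺`. -/
abbrev SpinorPlus (n : ℕ) : Type := EuclideanSpace ℂ (PlusIndex n)

/-- The spin module `𝕊⁻`. -/
abbrev SpinorMinus (n : ℕ) : Type := EuclideanSpace ℂ (MinusIndex n)

/-- The sign `(-1) ^ #{a ∈ α | a < j}` that comes from moving `f_j` to its place in `f_α`. -/
def wedgeSign {m : ℕ} (j : Fin m) (α : Finset (Fin m)) : ℂ :=
  (-1) ^ (α.filter (fun a => a < j)).card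

/-- The matrix of `f_α ↦ f_j ∧ f_α`. -/
def creation {m : ℕ} (j : Fin m) : Matrix (Finset (Fin m)) (Finset (Fin m)) ℂ :=
  fun β α => if j ∉ α ∧ β = insert j α then wedgeSign j α else 0

/-- The matrix of the contraction `f_α ↦ \bar f_j (f_α)`. -/
def annihilation {m : ℕ} (j : Fin m) : Matrix (Finset (Fin m)) (Finset (Fin m)) ℂ :=
  fun β α => if j ∈ α ∧ β = α.erase j then wedgeSign j α else 0

/-- The matrix of the Clifford generator `e_{k+1}` (`k` counts from `0`) on the exterior algebra:
`e_{2j-1} = f_j - \bar f_j`, `e_{2j} = -i (f_j + \bar f_j)`, and, for `n = 2m+1`,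
`e_{2m+1} = -i f_{m+1}`, where `f_{m+1}` acts as `(-1) ^ #α`. -/
def gammaMatrix (n : ℕ) (k : Fin n) :
    Matrix (Finset (Fin (n / 2))) (Finset (Fin (n / 2))) ℂ :=
  if h : (k : ℕ) / 2 < n / 2 then
    if (k : ℕ) % 2 = 0 then creation ⟨(k : ℕ) / 2, h⟩ - annihilation ⟨(k : ℕ) / 2, h⟩
    else (-Complex.I) • (creation ⟨(k : ℕ) / 2, h⟩ + annihilation ⟨(k : ℕ) / 2, h⟩)
  else Matrix.diagonal (fun α => -Complex.I * (-1) ^ α.card)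

/-- The Dirac matrix `γ_k : 𝕊⁺ → 𝕊⁻`. -/
def gammaPlus (n : ℕ) (k : Fin n) : SpinorPlus n →ₗ[ℂ] SpinorMinus n :=
  Matrix.toEuclideanLin ((gammaMatrix n k).submatrix Subtype.val Subtype.val)

/-- The Dirac matrix `γ_k : 𝕊⁻ → 𝕊⁺`. -/
def gammaMinus (n : ℕ) (k : Fin n) : SpinorMinus n →ₗ[ℂ] SpinorPlus n :=
  Matrix.toEuclideanLin ((gammaMatrix n k).submatrix Subtype.val Subtype.val)

/-! ### The differential operators -/

/-- `ℝ^{2n}` with coordinates `x_{A j}`, `A ∈ {0, 1}`, written `x (A, j)`. -/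
abbrev Space (n : ℕ) : Type := EuclideanSpace ℝ (Fin 2 × Fin n)

/-- The fibre `ℂ² ⊗ 𝕊⁻` of `𝒱₁`, as pairs `(g_0, g_1)` of elements of `𝕊⁻`. -/
abbrev SpinorPair (n : ℕ) : Type := Fin 2 → SpinorMinus n

/-- The partial derivative `∂_{A j} u`, where `i = (A, j)`. -/
def partialDeriv {n : ℕ} {F : Type*} [NormedAddCommGroup F] [NormedSpace ℝ F]
    (i : Fin 2 × Fin n) (u : Space n → F) (x : Space n) : F :=
  fderiv ℝ u x (EuclideanSpace.single i 1)

/-- `(∑_j γ_j d_{0j}, ∑_j γ_j d_{1j})`: the value of `𝒟₀ f` at a point where `f` has the partial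
derivatives `d_{Aj}`. -/
def diracSymbol {n : ℕ} (d : Fin 2 × Fin n → SpinorPlus n) : SpinorPair n :=
  fun A => ∑ j, gammaPlus n j (d (A, j))

/-- `𝒟₀ f = (∇_0 f, ∇_1 f)`, `∇_A = ∑_j γ_j ∂_{Aj}`, for differentiable `f`. -/
def diracD0 {n : ℕ} (f : Space n → SpinorPlus n) : Space n → SpinorPair n :=
  fun x => diracSymbol (fun i => partialDeriv i f x)

/-- The formal adjoint `𝒟₀^* ψ = - ∑_A ∑_j (γ_j)^* ∂_{Aj} ψ_A` of `𝒟₀`, where `(γ_j)^*` is the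
adjoint of `γ_j : 𝕊⁺ → 𝕊⁻` for the Hermitian inner products. -/
def diracD0Star {n : ℕ} (ψ : Space n → SpinorPair n) : Space n → SpinorPlus n :=
  fun x => -∑ A, ∑ j, LinearMap.adjoint (gammaPlus n j) (partialDeriv (A, j) (fun y => ψ y A) x)

/-- `𝒟₀^*` is the formal adjoint of `𝒟₀` for the `L²` inner products. -/
theorem integral_inner_diracD0 {n : ℕ} (φ : Space n → SpinorPlus n) (ψ : Space n → SpinorPair n)
    (hφ : ContDiff ℝ 1 φ) (hφc : HasCompactSupport φ)
    (hψ : ContDiff ℝ 1 ψ) (hψc : HasCompactSupport ψ) :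
    ∫ x, ∑ A, inner ℂ (diracD0 φ x A) (ψ x A) = ∫ x, inner ℂ (φ x) (diracD0Star ψ x) := by
  have hψA : ∀ A, ContDiff ℝ 1 (fun x => ψ x A) := fun A => contDiff_pi.1 hψ A
  have hψAc : ∀ A, HasCompactSupport (fun x => ψ x A) := fun A =>
    hψc.comp_left (g := fun v : SpinorPair n => v A) rfl
  have hdφ : ∀ i, Continuous (partialDeriv i φ) := fun i =>
    (hφ.continuous_fderiv one_ne_zero).clm_apply continuous_const
  have hdψ : ∀ A i, Continuous (partialDeriv i (fun x => ψ x A)) := fun A i =>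
    ((hψA A).continuous_fderiv one_ne_zero).clm_apply continuous_const
  have hγ : ∀ j, Continuous (gammaPlus n j) := fun j => LinearMap.continuous_of_finiteDimensional _
  have hγ' : ∀ j, Continuous (LinearMap.adjoint (gammaPlus n j)) :=
    fun j => LinearMap.continuous_of_finiteDimensional _
  have i1 : ∀ A j, Integrable
      (fun x => inner ℂ (gammaPlus n j (partialDeriv (A, j) φ x)) (ψ x A)) volume := fun A j => by
    refine Continuous.integrable_of_hasCompactSupport
      (((hγ j).comp (hdφ _)).inner (hψA A).continuous) ?_
    exact (hψAc A).mono fun x hx h0 => hx (by simp [show ψ x A = 0 from h0])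
  have i2 : ∀ A j, Integrable (fun x => inner ℂ (φ x) (LinearMap.adjoint (gammaPlus n j)
      (partialDeriv (A, j) (fun y => ψ y A) x))) volume := fun A j => by
    refine Continuous.integrable_of_hasCompactSupport
      (hφ.continuous.inner ((hγ' j).comp (hdψ A _))) ?_
    exact hφc.mono fun x hx h0 => hx (by simp [h0])
  have i3 : ∀ A j, Integrable
      (fun x => inner ℂ (gammaPlus n j (φ x)) (ψ x A)) volume := fun A j => by
    refine Continuous.integrable_of_hasCompactSupport
      (((hγ j).comp hφ.continuous).inner (hψA A).continuous) ?_
    exact (hψAc A).mono fun x hx h0 => hx (by simp [show ψ x A = 0 from h0])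
  have key : ∀ A j, ∫ x, inner ℂ (gammaPlus n j (partialDeriv (A, j) φ x)) (ψ x A) =
      -∫ x, inner ℂ (φ x) (LinearMap.adjoint (gammaPlus n j)
        (partialDeriv (A, j) (fun y => ψ y A) x)) := fun A j => by
    have hd : ∀ x, fderiv ℝ (fun x => inner ℂ (gammaPlus n j (φ x)) (ψ x A)) x
        (EuclideanSpace.single (A, j) 1) =
        inner ℂ (gammaPlus n j (φ x)) (partialDeriv (A, j) (fun y => ψ y A) x) +
        inner ℂ (gammaPlus n j (partialDeriv (A, j) φ x)) (ψ x A) := fun x => by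
      have h1 : HasFDerivAt (fun x => gammaPlus n j (φ x))
          (((gammaPlus n j).toContinuousLinearMap.restrictScalars ℝ).comp (fderiv ℝ φ x)) x :=
        ((gammaPlus n j).toContinuousLinearMap.restrictScalars ℝ).hasFDerivAt.comp x
          (hφ.differentiable one_ne_zero x).hasFDerivAt
      rw [fderiv_inner_apply ℂ h1.differentiableAt ((hψA A).differentiable one_ne_zero x), h1.fderiv]
      rfl
    have i4 : Integrable (fun x => inner ℂ (gammaPlus n j (φ x))
        (partialDeriv (A, j) (fun y => ψ y A) x)) volume := by
      refine (i2 A j).congr (Filter.Eventually.of_forall fun x => ?_)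
      exact LinearMap.adjoint_inner_right _ _ _
    have h0 := integral_smul_fderiv_eq_neg_fderiv_smul_of_integrable (𝕜 := ℝ)
      (μ := (volume : Measure (Space n))) (f := fun _ : Space n => (1 : ℝ))
      (g := fun x => inner ℂ (gammaPlus n j (φ x)) (ψ x A)) (v := EuclideanSpace.single (A, j) 1)
      (by simp) (by simp only [one_smul, hd]; exact i4.add (i1 A j))
      (by simpa only [one_smul] using i3 A j) (fun x _ => differentiableAt_const _)
      (fun x _ => DifferentiableAt.inner ℂ
        (((gammaPlus n j).toContinuousLinearMap.restrictScalars ℝ).differentiableAt.comp x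
          (hφ.differentiable one_ne_zero x)) ((hψA A).differentiable one_ne_zero x))
    simp only [one_smul, hd, fderiv_fun_const, Pi.zero_apply, zero_apply,
      zero_smul, integral_zero, neg_zero] at h0
    rw [integral_add i4 (i1 A j)] at h0
    simp only [LinearMap.adjoint_inner_right]
    exact eq_neg_of_add_eq_zero_right h0
  have hL : (fun x => ∑ A, inner ℂ (diracD0 φ x A) (ψ x A)) = fun x => ∑ A, ∑ j,
      inner ℂ (gammaPlus n j (partialDeriv (A, j) φ x)) (ψ x A) := by
    funext x; simp [diracD0, diracSymbol]
  have hR : (fun x => inner ℂ (φ x) (diracD0Star ψ x)) = fun x => -∑ A, ∑ j,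
      inner ℂ (φ x) (LinearMap.adjoint (gammaPlus n j)
        (partialDeriv (A, j) (fun y => ψ y A) x)) := by
    funext x; simp [diracD0Star, inner_neg_right, inner_sum, -Fin.sum_univ_two]
  rw [hL, hR, integral_neg, integral_finsetSum _ fun A _ => integrable_finsetSum _ fun j _ => i1 A j,
    integral_finsetSum _ fun A _ => integrable_finsetSum _ fun j _ => i2 A j,
    ← Finset.sum_neg_distrib]
  refine Finset.sum_congr rfl fun A _ => ?_
  rw [integral_finsetSum _ fun j _ => i1 A j, integral_finsetSum _ fun j _ => i2 A j,
    ← Finset.sum_neg_distrib]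
  exact Finset.sum_congr rfl fun j _ => key A j

/-! ### The kernel -/

/-- `G` is a fundamental solution of `Δ²` on `ℝ^{2n}`. -/
def IsBiharmonicFundamentalSolution {n : ℕ} (G : Space n → ℝ) : Prop :=
  LocallyIntegrable G volume ∧
    ∀ φ : Space n → ℝ, ContDiff ℝ ∞ φ → HasCompactSupport φ →
      ∫ x, G x * Laplacian.laplacian (Laplacian.laplacian φ) x = φ 0

/-- The area `2 π^n / (n-1)!` of the unit sphere in `ℝ^{2n}`, `n ≥ 1`. -/
def sphereArea (n : ℕ) : ℝ := 2 * Real.pi ^ n / (n - 1).factorial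

/-- The positive constant `C_{2n}` (for `n ≥ 3`) in the fundamental solution of `Δ²`. -/
def biharmonicConst (n : ℕ) : ℝ := 1 / (8 * ((n : ℝ) - 1) * ((n : ℝ) - 2) * sphereArea n)

/-- `G_0(x) = C_{2n} / |x|^{2n-4}`, for `n ≥ 3`. -/
def kernelG0 (n : ℕ) (x : Space n) : ℝ := biharmonicConst n / ‖x‖ ^ (2 * n - 4)

/-- The matrix function `G_1 = diag (G_0, G_0)`, acting on `ℂ² ⊗ 𝕊⁻`. -/
def kernelG1 (n : ℕ) (x : Space n) (v : SpinorPair n) : SpinorPair n :=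
  fun A => kernelG0 n x • v A

/-- `H(x) = (𝒟₀^* 𝒟₀ 𝒟₀^* G_1)(x) : ℂ² ⊗ 𝕊⁻ → 𝕊⁺`; the operators act on `G_1` column by column,
that is, on `y ↦ G_1(y) v` for each constant `v`. -/
def kernelH (n : ℕ) (x : Space n) (v : SpinorPair n) : SpinorPlus n :=
  diracD0Star (diracD0 (diracD0Star (fun y => kernelG1 n y v))) x

/-! ### Domains with `C²` boundary, and the Sobolev space `W^{1,2}` -/

/-- `ρ` is a `C²` defining function of `Ω` on the open neighbourhood `V` of `p`. -/
structure IsLocalDefiningFunction {n : ℕ} (Ω : Set (Space n)) (p : Space n) (V : Set (Space n))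
    (ρ : Space n → ℝ) : Prop where
  isOpen : IsOpen V
  mem : p ∈ V
  contDiffOn : ContDiffOn ℝ 2 ρ V
  gradient_ne_zero : ∀ x ∈ V, gradient ρ x ≠ 0
  inter_eq : Ω ∩ V = {x ∈ V | ρ x < 0}

/-- `Ω` has `C²` boundary. -/
def HasC2Boundary {n : ℕ} (Ω : Set (Space n)) : Prop :=
  ∀ p ∈ frontier Ω, ∃ V ρ, IsLocalDefiningFunction Ω p V ρ

/-- `ν` is the unit outer normal vector of `∂Ω` at `p`. -/
def IsOuterUnitNormal {n : ℕ} (Ω : Set (Space n)) (p ν : Space n) : Prop :=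
  ∃ V ρ, IsLocalDefiningFunction Ω p V ρ ∧ ν = ‖gradient ρ p‖⁻¹ • gradient ρ p

/-- `f` is of class `W^{1,2}(U)`, with the weak partial derivatives `d (A, j) = ∂_{Aj} f`. -/
structure IsW12 {n : ℕ} {F : Type*} [NormedAddCommGroup F] [NormedSpace ℝ F]
    (U : Set (Space n)) (f : Space n → F) (d : Fin 2 × Fin n → Space n → F) : Prop where
  memLp : MemLp f 2 (volume.restrict U)
  memLp_deriv : ∀ i, MemLp (d i) 2 (volume.restrict U)
  weak_deriv : ∀ i, ∀ φ : Space n → ℝ, ContDiff ℝ ∞ φ → HasCompactSupport φ → tsupport φ ⊆ U →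
    ∫ x in U, partialDeriv i φ x • f x = -∫ x in U, φ x • d i x

/-! ### The integrands -/

/-- `H(x - y) (n_0, n_1)ᵀ f(y)`, where `n_A = ∑_j γ_j n_{Aj}` and `ν y` is the normal at `y`. -/
def boundaryIntegrand {n : ℕ} (ν : Space n → Space n) (f : Space n → SpinorPlus n)
    (x y : Space n) : SpinorPlus n :=
  kernelH n (x - y) (fun A => ∑ j, ν y (A, j) • gammaPlus n j (f y))

/-- `H(x - y) 𝒟₀ f(y)`, where `d` are the weak partial derivatives of `f`. -/
def volumeIntegrand {n : ℕ} (d : Fin 2 × Fin n → Space n → SpinorPlus n)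
    (x y : Space n) : SpinorPlus n :=
  kernelH n (x - y) (diracSymbol (fun i => d i y))

end DiracTwo

end

open DiracTwo

namespace DiracTwo

set_option linter.unusedSectionVars false

/-! ### Clifford relations -/

open scoped symmDiff

/-! The kernel. The Clifford relations give `𝒟₀^* 𝒟₀ = -Δ` (`diracD0Star_diracD0`), so away from the
origin `H` is `-Δ` applied to `𝒟₀^* G₁`, a power of `|x|²` times a linear function. Radial calculus
yields the closed form (`kernelH_eq_cliffordMul`), and `C_{2n}` is normalised so that its constant
is `-1/ω_{2n}` (`biharmonicConst_mul`). That `G₀` is a fundamental solution follows by regularising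
`|x|²` to `|x|² + a`: the bilaplacian of the regularised power is an approximate identity
(`bilaplacian_normSq_add_zpow`, `integral_normSq_add_one_zpow`).

The representation formula. The kernel is multiplied by a radial cut-off `χ(|x-y|²)` that vanishes
near `x`, and Green's formula is applied (`setIntegral_smul_cliffordSymbol_add`). Since the
derivative array of a radial field is symmetric and `z |z|^(-2n)` is divergence free, the only term
without derivatives of `f` is the one where `χ` is differentiated. It is an average of `f` against a
nonnegative kernel of mass one (`cutoffPow_euler`, `integral_cutoffKernel`). By continuity the
formula holds up to the oscillation of `f` on a small ball (`norm_setIntegral_cutoff_sub_le`), with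
a bound that survives sharpening `χ` to an indicator. This gives the principal value at every point.
Absolute convergence almost everywhere is the existence of a convolution of two integrable
functions.

The divergence theorem. Near a boundary point `Ω` is the hypograph of a function with small
Lipschitz constant `η` over the tangent hyperplane (`exists_local_hypograph`). The vertical shear
preserves volume, so the normal derivative is integrated exactly. Tangential derivatives, the
variation of the normal and the comparison of Hausdorff measure with Lebesgue measure on the
hyperplane cost errors that are small with `η`, relative to the boundary mass of `|w|`
(`norm_setIntegral_fderiv_sub_boundary_le`). A partition of unity does not increase that mass, so `η
→ 0` gives the exact theorem (`setIntegral_fderiv_eq_boundary`) without an area formula.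
Mollification extends it to continuous Sobolev functions (`setIntegral_smul_weakDeriv_add`). -/

/-- The set by which the Dirac matrix `γ_k` shifts the index of a basis vector. -/
def gammaShift (n : ℕ) (k : Fin n) : Finset (Fin (n / 2)) :=
  if h : (k : ℕ) / 2 < n / 2 then {⟨(k : ℕ) / 2, h⟩} else ∅

/-- The nonzero entry of the row `β` of the Dirac matrix `γ_k`. -/
def gammaCoeff (n : ℕ) (k : Fin n) (β : Finset (Fin (n / 2))) : ℂ :=
  if h : (k : ℕ) / 2 < n / 2 then
    if (k : ℕ) % 2 = 0 then
      wedgeSign ⟨(k : ℕ) / 2, h⟩ β * (if (⟨(k : ℕ) / 2, h⟩ : Fin (n / 2)) ∈ β then 1 else -1)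
    else -Complex.I * wedgeSign ⟨(k : ℕ) / 2, h⟩ β
  else -Complex.I * (-1) ^ β.card

@[simp]
theorem symmDiff_empty {m : ℕ} (β : Finset (Fin m)) : β ∆ ∅ = β := symmDiff_bot β

theorem symmDiff_singleton_of_mem {m : ℕ} {j : Fin m} {β : Finset (Fin m)} (h : j ∈ β) :
    β ∆ {j} = β.erase j := by
  ext a; by_cases haj : a = j <;> simp [Finset.mem_symmDiff, haj, h]

theorem symmDiff_singleton_of_notMem {m : ℕ} {j : Fin m} {β : Finset (Fin m)} (h : j ∉ β) :
    β ∆ {j} = insert j β := by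
  ext a; by_cases haj : a = j <;> simp [Finset.mem_symmDiff, haj, h]

theorem wedgeSign_insert {m : ℕ} {i j : Fin m} {β : Finset (Fin m)} (h : i ∉ β) :
    wedgeSign j (insert i β) = (if i < j then -1 else 1) * wedgeSign j β := by
  unfold wedgeSign
  rw [Finset.filter_insert]
  split_ifs with hij
  · rw [Finset.card_insert_of_notMem (by simp [h]), pow_succ]; ring
  · simp

/-- Toggling `i` changes the number of elements below `j` by one exactly when `i < j`. This is the
source of the anticommutation of generators from different pairs. -/
theorem wedgeSign_symmDiff {m : ℕ} (i j : Fin m) (β : Finset (Fin m)) :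
    wedgeSign j (β ∆ {i}) = (if i < j then -1 else 1) * wedgeSign j β := by
  by_cases h : i ∈ β
  · rw [symmDiff_singleton_of_mem h]
    have := wedgeSign_insert (j := j) (Finset.notMem_erase i β)
    rw [Finset.insert_erase h] at this
    rw [this]
    split_ifs <;> ring
  · rw [symmDiff_singleton_of_notMem h, wedgeSign_insert h]

theorem wedgeSign_mul_self {m : ℕ} (j : Fin m) (β : Finset (Fin m)) :
    wedgeSign j β * wedgeSign j β = 1 := by
  unfold wedgeSign
  rw [← mul_pow]; norm_num

theorem star_wedgeSign {m : ℕ} (j : Fin m) (β : Finset (Fin m)) :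
    (starRingEnd ℂ) (wedgeSign j β) = wedgeSign j β := by
  simp [wedgeSign]

theorem neg_one_pow_card_symmDiff {m : ℕ} (j : Fin m) (β : Finset (Fin m)) :
    (-1 : ℂ) ^ (β ∆ {j}).card = -(-1) ^ β.card := by
  by_cases h : j ∈ β
  · rw [symmDiff_singleton_of_mem h, ← Finset.card_erase_add_one h, pow_succ]; ring
  · rw [symmDiff_singleton_of_notMem h, Finset.card_insert_of_notMem h, pow_succ]; ring

theorem creation_apply {m : ℕ} (j : Fin m) (β α : Finset (Fin m)) :
    creation j β α = if α = β ∆ {j} then (if j ∈ β then wedgeSign j β else 0) else 0 := by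
  unfold creation
  by_cases h : j ∈ β
  · rw [symmDiff_singleton_of_mem h]
    by_cases h' : α = β.erase j
    · subst h'
      have := wedgeSign_symmDiff j j β
      rw [symmDiff_singleton_of_mem h] at this
      simp [h, Finset.insert_erase h, this]
    · rw [if_neg, if_neg h']
      rintro ⟨h1, rfl⟩
      exact h' (Finset.erase_insert h1).symm
  · rw [if_neg]
    · simp [h]
    · rintro ⟨-, rfl⟩
      simp at h

theorem annihilation_apply {m : ℕ} (j : Fin m) (β α : Finset (Fin m)) :
    annihilation j β α = if α = β ∆ {j} then (if j ∈ β then 0 else wedgeSign j β) else 0 := by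
  unfold annihilation
  by_cases h : j ∈ β
  · rw [if_neg]
    · simp [h]
    · rintro ⟨-, rfl⟩
      simp at h
  · rw [symmDiff_singleton_of_notMem h]
    by_cases h' : α = insert j β
    · subst h'
      have := wedgeSign_symmDiff j j β
      rw [symmDiff_singleton_of_notMem h] at this
      simp [h, Finset.erase_insert h, this]
    · rw [if_neg, if_neg h']
      rintro ⟨h1, rfl⟩
      exact h' (Finset.insert_erase h1).symm

/-- The Dirac matrices are monomial: creation and annihilation are the two halves of one toggle.
Products and adjoints reduce to identities between coefficients. -/
theorem gammaMatrix_apply (n : ℕ) (k : Fin n) (β α : Finset (Fin (n / 2))) :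
    gammaMatrix n k β α = if α = β ∆ gammaShift n k then gammaCoeff n k β else 0 := by
  unfold gammaMatrix gammaShift gammaCoeff
  by_cases h : (k : ℕ) / 2 < n / 2
  · simp only [h, dif_pos]
    by_cases h2 : (k : ℕ) % 2 = 0
    · simp only [h2, if_true, Matrix.sub_apply, creation_apply, annihilation_apply]
      split_ifs <;> simp
    · simp only [h2, if_false, Matrix.smul_apply, Matrix.add_apply, creation_apply,
        annihilation_apply]
      split_ifs <;> simp
  · simp only [h, dif_neg, not_false_eq_true]
    rw [Matrix.diagonal_apply]
    by_cases hαβ : β = α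
    · simp [hαβ]
    · rw [if_neg hαβ, if_neg]
      rintro rfl
      exact hαβ (symmDiff_empty β).symm

/-- Within a pair, toggling the common index flips the membership sign; across pairs, exactly one of
the two wedge signs changes; against the unpaired generator, every toggle flips the parity of the
cardinality. -/
theorem gammaCoeff_mul_add {n : ℕ} (k l : Fin n) (hkl : k ≠ l) (β : Finset (Fin (n / 2))) :
    gammaCoeff n k β * gammaCoeff n l (β ∆ gammaShift n k) +
      gammaCoeff n l β * gammaCoeff n k (β ∆ gammaShift n l) = 0 := by
  have hne : (k : ℕ) ≠ l := fun h => hkl (Fin.ext h)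
  have hmem : ∀ {m : ℕ} (i j : Fin m) (β : Finset (Fin m)), i ≠ j → (i ∈ β ∆ {j} ↔ i ∈ β) := by
    intro m i j β hij; simp [Finset.mem_symmDiff, hij]
  unfold gammaShift gammaCoeff
  by_cases hk : (k : ℕ) / 2 < n / 2 <;> by_cases hl : (l : ℕ) / 2 < n / 2
  · simp only [hk, hl, dif_pos, wedgeSign_symmDiff]
    by_cases hj : (k : ℕ) / 2 = l / 2
    · have h2 : ((k : ℕ) % 2 = 0 ∧ ¬ (l : ℕ) % 2 = 0) ∨ (¬ (k : ℕ) % 2 = 0 ∧ (l : ℕ) % 2 = 0) := by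
        omega
      simp only [hj]
      rcases h2 with ⟨h1, h2⟩ | ⟨h1, h2⟩ <;>
      · simp only [h1, h2, if_true, if_false, lt_irrefl, Finset.mem_symmDiff, Finset.mem_singleton]
        split_ifs <;> first | ring1 | simp_all
    · have hne' : (⟨(k : ℕ) / 2, hk⟩ : Fin (n / 2)) ≠ ⟨(l : ℕ) / 2, hl⟩ := by
        simpa [Fin.ext_iff] using hj
      simp only [hmem _ _ β hne', hmem _ _ β hne'.symm]
      rcases lt_or_gt_of_ne hne' with hlt | hlt <;>
      · simp only [hlt, not_lt_of_gt hlt, if_true, if_false]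
        split_ifs <;> ring1
  · simp only [hk, hl, dif_pos, dif_neg, not_false_eq_true, neg_one_pow_card_symmDiff,
      symmDiff_empty]
    split_ifs <;> ring1
  · simp only [hk, hl, dif_pos, dif_neg, not_false_eq_true, neg_one_pow_card_symmDiff,
      symmDiff_empty]
    split_ifs <;> ring1
  -- Only the last index of an odd `n` is unpaired, so two distinct unpaired indices cannot occur.
  · omega

theorem gammaCoeff_mul_self {n : ℕ} (k : Fin n) (β : Finset (Fin (n / 2))) :
    gammaCoeff n k β * gammaCoeff n k (β ∆ gammaShift n k) = -1 := by
  unfold gammaShift gammaCoeff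
  by_cases hk : (k : ℕ) / 2 < n / 2
  · have hs := wedgeSign_mul_self (⟨(k : ℕ) / 2, hk⟩ : Fin (n / 2)) β
    simp only [hk, dif_pos, wedgeSign_symmDiff, lt_irrefl, if_false, Finset.mem_symmDiff,
      Finset.mem_singleton]
    have hI := Complex.I_mul_I
    split_ifs
    any_goals first | linear_combination (-1 : ℂ) * hs | linear_combination hI *
      (wedgeSign (⟨(k : ℕ) / 2, hk⟩ : Fin (n / 2)) β) ^ 2 - hs
    all_goals simp_all
  · simp only [hk, dif_neg, not_false_eq_true, symmDiff_empty]
    have h1 : ((-1 : ℂ) ^ β.card) * (-1) ^ β.card = 1 := by rw [← mul_pow]; norm_num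
    linear_combination Complex.I_mul_I * (((-1 : ℂ) ^ β.card) * (-1) ^ β.card) - h1

theorem star_gammaCoeff {n : ℕ} (k : Fin n) (β : Finset (Fin (n / 2))) :
    (starRingEnd ℂ) (gammaCoeff n k β) = - gammaCoeff n k (β ∆ gammaShift n k) := by
  unfold gammaShift gammaCoeff
  by_cases hk : (k : ℕ) / 2 < n / 2
  · simp only [hk, dif_pos, wedgeSign_symmDiff, lt_irrefl, if_false, Finset.mem_symmDiff,
      Finset.mem_singleton]
    split_ifs <;> simp_all [star_wedgeSign]
  · simp [hk]

/-- For even `n` no index is unpaired, so every shift toggles exactly one element. This makes the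
Dirac matrices exchange even and odd forms; for odd `n` the index types impose no parity. -/
theorem card_symmDiff_gammaShift_parity {n : ℕ} (k : Fin n) (β : Finset (Fin (n / 2)))
    (hn : ¬ Odd n) : (Even (β ∆ gammaShift n k).card ↔ ¬ Even β.card) := by
  have hk : (k : ℕ) / 2 < n / 2 := by
    have := k.2
    rw [Nat.not_odd_iff_even] at hn
    obtain ⟨r, hr⟩ := hn
    omega
  simp only [gammaShift, hk, dif_pos]
  by_cases h : (⟨(k : ℕ) / 2, hk⟩ : Fin (n / 2)) ∈ β
  · rw [symmDiff_singleton_of_mem h, ← Finset.card_erase_add_one h, Nat.even_add_one, not_not]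
  · rw [symmDiff_singleton_of_notMem h, Finset.card_insert_of_notMem h, Nat.even_add_one]

theorem plusIndex_of_minusIndex {n : ℕ} (k : Fin n) (β : MinusIndex n) :
    Odd n ∨ Even (β.1 ∆ gammaShift n k).card := by
  by_cases hn : Odd n
  · exact Or.inl hn
  · right
    rw [card_symmDiff_gammaShift_parity k _ hn, Nat.not_even_iff_odd]
    exact β.2.resolve_left hn

theorem minusIndex_of_plusIndex {n : ℕ} (k : Fin n) (β : PlusIndex n) :
    Odd n ∨ Odd (β.1 ∆ gammaShift n k).card := by
  by_cases hn : Odd n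
  · exact Or.inl hn
  · right
    rw [← Nat.not_even_iff_odd, card_symmDiff_gammaShift_parity k _ hn, not_not]
    exact β.2.resolve_left hn

theorem gammaPlus_apply {n : ℕ} (k : Fin n) (v : SpinorPlus n) (β : MinusIndex n) :
    gammaPlus n k v β =
      gammaCoeff n k β.1 * v ⟨β.1 ∆ gammaShift n k, plusIndex_of_minusIndex k β⟩ := by
  simp only [gammaPlus, Matrix.toLpLin_apply, Matrix.mulVec, dotProduct,
    Matrix.submatrix_apply, gammaMatrix_apply]
  rw [Finset.sum_eq_single ⟨β.1 ∆ gammaShift n k, plusIndex_of_minusIndex k β⟩]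
  · simp
  · intro α _ hα
    rw [if_neg, zero_mul]
    exact fun h => hα (Subtype.ext h)
  · simp

theorem gammaMinus_apply {n : ℕ} (k : Fin n) (v : SpinorMinus n) (β : PlusIndex n) :
    gammaMinus n k v β =
      gammaCoeff n k β.1 * v ⟨β.1 ∆ gammaShift n k, minusIndex_of_plusIndex k β⟩ := by
  simp only [gammaMinus, Matrix.toLpLin_apply, Matrix.mulVec, dotProduct,
    Matrix.submatrix_apply, gammaMatrix_apply]
  rw [Finset.sum_eq_single ⟨β.1 ∆ gammaShift n k, minusIndex_of_plusIndex k β⟩]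
  · simp
  · intro α _ hα
    rw [if_neg, zero_mul]
    exact fun h => hα (Subtype.ext h)
  · simp

/-- The Clifford relation `γ_j γ_k + γ_k γ_j = -2 δ_{jk}` on `𝕊⁺`. -/
theorem gammaMinus_gammaPlus_add {n : ℕ} (j k : Fin n) (v : SpinorPlus n) :
    gammaMinus n j (gammaPlus n k v) + gammaMinus n k (gammaPlus n j v) =
      (if j = k then (-2 : ℝ) else 0) • v := by
  ext β
  simp only [PiLp.add_apply, PiLp.smul_apply, gammaMinus_apply, gammaPlus_apply, symmDiff_assoc]
  by_cases hjk : j = k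
  · subst hjk
    have h := gammaCoeff_mul_self j β.1
    simp only [symmDiff_self, symmDiff_bot, if_true, Complex.real_smul]
    push_cast
    linear_combination 2 * v β * h
  · have h := gammaCoeff_mul_add j k hjk β.1
    simp only [hjk, if_false, zero_smul]
    simp only [symmDiff_comm (gammaShift n k) (gammaShift n j)]
    linear_combination v ⟨β.1 ∆ (gammaShift n j ∆ gammaShift n k), by
      rw [← symmDiff_assoc]
      exact plusIndex_of_minusIndex k ⟨_, minusIndex_of_plusIndex j β⟩⟩ * h

/-- The Dirac matrices are skew-adjoint. -/
theorem adjoint_gammaPlus {n : ℕ} (k : Fin n) :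
    LinearMap.adjoint (gammaPlus n k) = -gammaMinus n k := by
  rw [gammaPlus, gammaMinus, ← Matrix.toEuclideanLin_conjTranspose_eq_adjoint, ← map_neg]
  congr 1
  ext β α
  simp only [Matrix.conjTranspose_apply, Matrix.submatrix_apply, gammaMatrix_apply,
    Matrix.neg_apply]
  by_cases h : α.1 = β.1 ∆ gammaShift n k
  · have h' : β.1 = α.1 ∆ gammaShift n k := by rw [h, symmDiff_assoc]; simp
    rw [if_pos h', if_pos h]
    have := star_gammaCoeff k α.1
    rw [← h'] at this
    exact this
  · rw [if_neg h, if_neg]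
    · simp
    · intro h'; apply h; rw [h', symmDiff_assoc]; simp

/-- Contraction of `γ_j γ_k` with a symmetric array. -/
theorem sum_gammaMinus_gammaPlus_of_symm {n : ℕ} (S : Fin n → Fin n → SpinorPlus n)
    (hS : ∀ j k, S j k = S k j) :
    ∑ j, ∑ k, gammaMinus n j (gammaPlus n k (S j k)) = -∑ j, S j j := by
  have h2 : (2 : ℝ) • ∑ j, ∑ k, gammaMinus n j (gammaPlus n k (S j k)) =
      (2 : ℝ) • -∑ j, S j j := by
    rw [two_smul]
    -- One of the two copies of the sum gets its indices swapped, so that the terms pair up into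
    -- anticommutators.
    nth_rewrite 2 [Finset.sum_comm]
    rw [← Finset.sum_add_distrib]
    simp_rw [← Finset.sum_add_distrib]
    have : ∀ j k, gammaMinus n j (gammaPlus n k (S j k)) + gammaMinus n k (gammaPlus n j (S k j)) =
        if j = k then (-2 : ℝ) • S j j else 0 := by
      intro j k
      rw [← hS j k, gammaMinus_gammaPlus_add]
      split_ifs with h
      · rw [h]
      · simp
    simp_rw [this]
    simp [Finset.smul_sum]
  exact smul_right_injective _ (two_ne_zero) h2

/-! ### Calculus of radial functions, and the explicit form of `H` -/

section Radial

variable {n : ℕ} {F : Type*} [NormedAddCommGroup F] [NormedSpace ℝ F]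

theorem partialDeriv_congr {u v : Space n → F} {x : Space n} (i : Fin 2 × Fin n)
    (h : u =ᶠ[𝓝 x] v) : partialDeriv i u x = partialDeriv i v x := by
  simp only [partialDeriv, h.fderiv_eq]

theorem partialDeriv_const (i : Fin 2 × Fin n) (c : F) (x : Space n) :
    partialDeriv i (fun _ => c) x = 0 := by
  simp [partialDeriv]

theorem partialDeriv_add {i : Fin 2 × Fin n} {u v : Space n → F} {x : Space n}
    (hu : DifferentiableAt ℝ u x) (hv : DifferentiableAt ℝ v x) :
    partialDeriv i (fun y => u y + v y) x = partialDeriv i u x + partialDeriv i v x := by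
  simp [partialDeriv, fderiv_fun_add hu hv]

theorem hasFDerivAt_comp_normSq {φ : ℝ → ℝ} {φ' : ℝ} {x : Space n}
    (hφ : HasDerivAt φ φ' (‖x‖ ^ 2)) :
    HasFDerivAt (fun y : Space n => φ (‖y‖ ^ 2)) (φ' • ((2 : ℝ) • innerSL ℝ x)) x := by
  refine (hφ.comp_hasFDerivAt x (hasStrictFDerivAt_norm_sq x).hasFDerivAt).congr_fderiv ?_
  rw [← Nat.cast_smul_eq_nsmul ℝ, Nat.cast_ofNat]

theorem partialDeriv_comp_normSq_smul {φ : ℝ → ℝ} {φ' : ℝ} {x : Space n} (i : Fin 2 × Fin n)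
    (hφ : HasDerivAt φ φ' (‖x‖ ^ 2)) {v : Space n → F} (hv : DifferentiableAt ℝ v x) :
    partialDeriv i (fun y => φ (‖y‖ ^ 2) • v y) x =
      (φ' * (2 * x i)) • v x + φ (‖x‖ ^ 2) • partialDeriv i v x := by
  have h := (hasFDerivAt_comp_normSq hφ).fun_smul hv.hasFDerivAt
  rw [partialDeriv, h.fderiv]
  simp [partialDeriv, EuclideanSpace.inner_single_right, add_comm]

theorem sum_sq_eq_normSq (x : Space n) : ∑ i, x i ^ 2 = ‖x‖ ^ 2 := by
  rw [EuclideanSpace.norm_sq_eq]; simp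

theorem sum_smul_clm_single (L : Space n →L[ℝ] F) (x : Space n) :
    ∑ i, x i • L (EuclideanSpace.single i 1) = L x := by
  simp_rw [← map_smul, ← map_sum]
  congr 1
  ext j
  simp [Finset.sum_apply, Pi.single_apply]

/-- The affine factor `L y + c` covers two uses: `c = 0` for the spinor-valued `𝒟₀^* G₁`, and `L =
0`, `c = 1` for the regularised scalar powers. -/
theorem partialDeriv_partialDeriv_comp_normSq_smul {φ φ' : ℝ → ℝ} {φ'' : ℝ} {x : Space n}
    (i : Fin 2 × Fin n) (hφ : ∀ᶠ y in 𝓝 x, HasDerivAt φ (φ' (‖y‖ ^ 2)) (‖y‖ ^ 2))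
    (hφ' : HasDerivAt φ' φ'' (‖x‖ ^ 2)) (L : Space n →L[ℝ] F) (c : F) :
    partialDeriv i (partialDeriv i (fun y => φ (‖y‖ ^ 2) • (L y + c))) x =
      (4 * φ'' * x i ^ 2) • (L x + c) + (2 * φ' (‖x‖ ^ 2)) • (L x + c) +
        (4 * φ' (‖x‖ ^ 2)) • (x i • L (EuclideanSpace.single i 1)) := by
  have hd : ∀ y, HasFDerivAt (fun y => L y + c) L y := fun y => L.hasFDerivAt.add_const c
  have hpd : ∀ y, partialDeriv i (fun y => L y + c) y = L (EuclideanSpace.single i 1) := fun y => by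
    rw [partialDeriv, (hd y).fderiv]
  have h1 : partialDeriv i (fun y => φ (‖y‖ ^ 2) • (L y + c)) =ᶠ[𝓝 x] fun y =>
      φ' (‖y‖ ^ 2) • ((2 * y i) • (L y + c)) +
        φ (‖y‖ ^ 2) • L (EuclideanSpace.single i 1) := by
    filter_upwards [hφ] with y hy
    rw [partialDeriv_comp_normSq_smul i hy (hd y).differentiableAt, hpd, mul_smul]
  have hl : HasFDerivAt (fun y : Space n => 2 * y i)
      ((2 : ℝ) • (EuclideanSpace.proj i : Space n →L[ℝ] ℝ)) x :=
    ((2 : ℝ) • (EuclideanSpace.proj i : Space n →L[ℝ] ℝ)).hasFDerivAt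
  have h2 := hl.fun_smul (hd x)
  have h3 : partialDeriv i (fun y => (2 * y i) • (L y + c)) x =
      (2 : ℝ) • (L x + c) + (2 * x i) • L (EuclideanSpace.single i 1) := by
    rw [partialDeriv, h2.fderiv]
    simp [add_comm]
  rw [partialDeriv_congr i h1, partialDeriv_add
    ((hasFDerivAt_comp_normSq hφ').fun_smul h2).differentiableAt
    ((hasFDerivAt_comp_normSq hφ.self_of_nhds).smul_const _).differentiableAt,
    partialDeriv_comp_normSq_smul i hφ' h2.differentiableAt, h3,
    partialDeriv_comp_normSq_smul i hφ.self_of_nhds (differentiableAt_const _),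
    partialDeriv_const]
  module

/-- The Laplacian of `φ(|x|²) (L x + c)` with `L` linear. -/
theorem sum_partialDeriv_comp_normSq_smul {φ φ' : ℝ → ℝ} {φ'' : ℝ} {x : Space n}
    (hφ : ∀ᶠ y in 𝓝 x, HasDerivAt φ (φ' (‖y‖ ^ 2)) (‖y‖ ^ 2))
    (hφ' : HasDerivAt φ' φ'' (‖x‖ ^ 2)) (L : Space n →L[ℝ] F) (c : F) :
    ∑ i, partialDeriv i (partialDeriv i (fun y => φ (‖y‖ ^ 2) • (L y + c))) x =
      (4 * ‖x‖ ^ 2 * φ'' + 4 * n * φ' (‖x‖ ^ 2)) • (L x + c) +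
        (4 * φ' (‖x‖ ^ 2)) • L x := by
  simp_rw [partialDeriv_partialDeriv_comp_normSq_smul _ hφ hφ' L c, Finset.sum_add_distrib,
    ← Finset.smul_sum, sum_smul_clm_single, ← Finset.sum_smul, ← Finset.mul_sum,
    sum_sq_eq_normSq]
  congr 1
  simp only [Finset.sum_const, Finset.card_univ, Fintype.card_prod, Fintype.card_fin]
  rw [← Nat.cast_smul_eq_nsmul ℝ, smul_smul, ← add_smul]
  push_cast
  ring_nf

theorem contDiffAt_comp_normSq_smul {k : ℕ∞ω} {φ : ℝ → ℝ} {x : Space n}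
    (hφ : ContDiffAt ℝ k φ (‖x‖ ^ 2)) {v : Space n → F} (hv : ContDiffAt ℝ k v x) :
    ContDiffAt ℝ k (fun y => φ (‖y‖ ^ 2) • v y) x :=
  (hφ.comp x (contDiff_norm_sq ℝ).contDiffAt).smul hv

theorem partialDeriv_partialDeriv {u : Space n → F} {x : Space n} (hu : ContDiffAt ℝ 2 u x)
    (i j : Fin 2 × Fin n) :
    partialDeriv i (partialDeriv j u) x =
      fderiv ℝ (fderiv ℝ u) x (EuclideanSpace.single i 1) (EuclideanSpace.single j 1) := by
  have h : DifferentiableAt ℝ (fderiv ℝ u) x :=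
    (hu.fderiv_right (m := 1) (by norm_num)).differentiableAt one_ne_zero
  have h2 := h.hasFDerivAt.clm_apply (hasFDerivAt_const (EuclideanSpace.single j (1 : ℝ)) x)
  change fderiv ℝ (fun y => fderiv ℝ u y (EuclideanSpace.single j 1)) x _ = _
  rw [h2.fderiv]
  simp

theorem differentiableAt_partialDeriv {u : Space n → F} {x : Space n} (hu : ContDiffAt ℝ 2 u x)
    (j : Fin 2 × Fin n) : DifferentiableAt ℝ (partialDeriv j u) x := by
  have h : DifferentiableAt ℝ (fderiv ℝ u) x :=
    (hu.fderiv_right (m := 1) (by norm_num)).differentiableAt one_ne_zero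
  exact h.clm_apply (differentiableAt_const _)

theorem partialDeriv_comm {u : Space n → F} {x : Space n} (hu : ContDiffAt ℝ 2 u x)
    (i j : Fin 2 × Fin n) :
    partialDeriv i (partialDeriv j u) x = partialDeriv j (partialDeriv i u) x := by
  rw [partialDeriv_partialDeriv hu, partialDeriv_partialDeriv hu]
  exact (hu.isSymmSndFDerivAt (by simp)) _ _

theorem laplacian_eq_sum_partialDeriv {u : Space n → F} {x : Space n} (hu : ContDiffAt ℝ 2 u x) :
    Laplacian.laplacian u x = ∑ i, partialDeriv i (partialDeriv i u) x := by
  rw [InnerProductSpace.laplacian_eq_iteratedFDeriv_orthonormalBasis u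
    (EuclideanSpace.basisFun (Fin 2 × Fin n) ℝ)]
  refine Finset.sum_congr rfl fun i _ => ?_
  rw [partialDeriv_partialDeriv hu, iteratedFDeriv_two_apply]
  simp

end Radial

/-- `𝒟₀^* 𝒟₀ = -Δ`. -/
theorem diracD0Star_diracD0 {n : ℕ} {u : Space n → SpinorPlus n} {x : Space n}
    (hu : ContDiffAt ℝ 2 u x) :
    diracD0Star (diracD0 u) x = -∑ i, partialDeriv i (partialDeriv i u) x := by
  have h1 : ∀ A j, partialDeriv (A, j) (fun y => diracD0 u y A) x =
      ∑ k, gammaPlus n k (partialDeriv (A, j) (partialDeriv (A, k) u) x) := by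
    intro A j
    have h2 : HasFDerivAt (fun y => ∑ k, gammaPlus n k (partialDeriv (A, k) u y))
        (∑ k, (((gammaPlus n k).toContinuousLinearMap.restrictScalars ℝ).comp
          (fderiv ℝ (partialDeriv (A, k) u) x))) x := by
      refine HasFDerivAt.fun_sum fun k _ => ?_
      exact ((gammaPlus n k).toContinuousLinearMap.restrictScalars ℝ).hasFDerivAt.comp x
        (differentiableAt_partialDeriv hu (A, k)).hasFDerivAt
    change fderiv ℝ (fun y => ∑ k, gammaPlus n k (partialDeriv (A, k) u y)) x _ = _
    rw [h2.fderiv]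
    simp [partialDeriv]
  simp only [diracD0Star, adjoint_gammaPlus, h1, LinearMap.neg_apply, Finset.sum_neg_distrib,
    neg_neg, map_sum]
  rw [Fintype.sum_prod_type, ← Finset.sum_neg_distrib]
  refine Finset.sum_congr rfl fun A _ => ?_
  exact sum_gammaMinus_gammaPlus_of_symm _ fun j k => partialDeriv_comm hu _ _

/-- The linear map `x ↦ ∑_A ∑_j x_{Aj} γ_j v_A`. -/
noncomputable def cliffordMul {n : ℕ} (v : SpinorPair n) : Space n →L[ℝ] SpinorPlus n :=
  ∑ A, ∑ j, (EuclideanSpace.proj (A, j) : Space n →L[ℝ] ℝ).smulRight (gammaMinus n j (v A))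

theorem cliffordMul_apply {n : ℕ} (v : SpinorPair n) (x : Space n) :
    cliffordMul v x = ∑ A, ∑ j, x (A, j) • gammaMinus n j (v A) := by
  simp [cliffordMul]

/-- In the variable `s = |x|²` the kernel `G₀` is a multiple of `s^(2-n)`. The minus sign of `𝒟₀^*`
is cancelled by the skew-adjointness of the Dirac matrices. -/
theorem diracD0Star_kernelG1 {n : ℕ} (hn : 3 ≤ n) (v : SpinorPair n) {x : Space n} (hx : x ≠ 0) :
    diracD0Star (fun y => kernelG1 n y v) x =
      (biharmonicConst n * (2 * (2 - n))) • ((‖x‖ ^ 2) ^ (1 - n : ℤ) • cliffordMul v x) := by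
  have hx2 : ‖x‖ ^ 2 ≠ 0 := by positivity
  have h1 : ∀ A j, partialDeriv (A, j) (fun y => kernelG1 n y v A) x =
      (biharmonicConst n * (2 * (2 - n)) * (‖x‖ ^ 2) ^ (1 - n : ℤ) * x (A, j)) • v A := by
    intro A j
    have hd : HasDerivAt (fun s : ℝ => biharmonicConst n * s ^ (2 - n : ℤ))
        (biharmonicConst n * ((2 - n) * (‖x‖ ^ 2) ^ (1 - n : ℤ))) (‖x‖ ^ 2) := by
      refine ((hasDerivAt_zpow (2 - n : ℤ) _ (Or.inl hx2)).const_mul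
        (biharmonicConst n)).congr_deriv ?_
      rw [show (2 - n - 1 : ℤ) = 1 - n by ring]
      push_cast
      rfl
    have he : (fun y => kernelG1 n y v A) =
        fun y => (fun s : ℝ => biharmonicConst n * s ^ (2 - n : ℤ)) (‖y‖ ^ 2) • v A := by
      funext y
      simp only [kernelG1, kernelG0]
      congr 1
      rw [div_eq_mul_inv]
      congr 1
      obtain ⟨m, rfl⟩ : ∃ m, n = m + 2 := ⟨n - 2, by omega⟩
      have : (2 - ((m + 2 : ℕ) : ℤ)) = -(m : ℤ) := by push_cast; ring
      rw [this, zpow_neg, zpow_natCast, ← pow_mul]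
      congr 2
    rw [he, partialDeriv_comp_normSq_smul (A, j) hd (differentiableAt_const _), partialDeriv_const,
      smul_zero, add_zero]
    congr 1
    ring
  simp only [diracD0Star, adjoint_gammaPlus, h1, LinearMap.neg_apply, Finset.sum_neg_distrib,
    neg_neg, cliffordMul_apply, Finset.smul_sum, smul_smul]
  refine Finset.sum_congr rfl fun A _ => Finset.sum_congr rfl fun j _ => ?_
  rw [LinearMap.map_smul_of_tower, mul_assoc _ (_ ^ (_ : ℤ))]

/-- The explicit form of `H`. -/
theorem kernelH_eq_cliffordMul {n : ℕ} (hn : 3 ≤ n) {x : Space n} (hx : x ≠ 0) (v : SpinorPair n) :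
    kernelH n x v = (-8 * ((n : ℝ) - 1) * ((n : ℝ) - 2) * biharmonicConst n) •
      ((‖x‖ ^ (2 * n))⁻¹ • cliffordMul v x) := by
  have hx2 : ‖x‖ ^ 2 ≠ 0 := by positivity
  have hU : ∀ᶠ y in 𝓝 x, y ≠ 0 := isOpen_ne.mem_nhds hx
  set φ : ℝ → ℝ := fun s => biharmonicConst n * (2 * (2 - n)) * s ^ (1 - n : ℤ) with hφ
  set φ' : ℝ → ℝ := fun s => biharmonicConst n * (2 * (2 - n)) * (1 - n) * s ^ (-n : ℤ) with hφ'
  have hd : ∀ s : ℝ, s ≠ 0 → HasDerivAt φ (φ' s) s := by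
    intro s hs
    refine ((hasDerivAt_zpow (1 - n : ℤ) s (Or.inl hs)).const_mul
      (biharmonicConst n * (2 * (2 - n)))).congr_deriv ?_
    rw [show (1 - n - 1 : ℤ) = -n by ring]
    push_cast
    ring
  have hd' : HasDerivAt φ'
      (biharmonicConst n * (2 * (2 - n)) * (1 - n) * (-n) * (‖x‖ ^ 2) ^ (-n - 1 : ℤ))
      (‖x‖ ^ 2) := by
    refine ((hasDerivAt_zpow (-n : ℤ) _ (Or.inl hx2)).const_mul
      (biharmonicConst n * (2 * (2 - n)) * (1 - n))).congr_deriv ?_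
    push_cast
    ring
  have hsm : ContDiffAt ℝ 2 (fun y => φ (‖y‖ ^ 2) • (cliffordMul v y + 0)) x := by
    refine contDiffAt_comp_normSq_smul ?_ ((cliffordMul v).contDiff.add contDiff_const).contDiffAt
    refine contDiffAt_const.mul ?_
    exact ((analyticAt_id (𝕜 := ℝ)).zpow hx2).contDiffAt
  -- The two outer operators differentiate, so the closed form of `𝒟₀^* G₁` is needed as an equality
  -- of germs at `x`.
  have he : diracD0Star (fun y => kernelG1 n y v) =ᶠ[𝓝 x] fun y =>
      φ (‖y‖ ^ 2) • (cliffordMul v y + 0) := by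
    filter_upwards [hU] with y hy
    rw [diracD0Star_kernelG1 hn v hy, smul_smul, add_zero]
  have h1 : diracD0 (diracD0Star (fun y => kernelG1 n y v)) =ᶠ[𝓝 x] diracD0 fun y =>
      φ (‖y‖ ^ 2) • (cliffordMul v y + 0) := by
    filter_upwards [he.eventuallyEq_nhds] with y hy
    exact congrArg diracSymbol (funext fun i => partialDeriv_congr i hy)
  have h2 : kernelH n x v = diracD0Star (diracD0 fun y =>
      φ (‖y‖ ^ 2) • (cliffordMul v y + 0)) x := by
    exact congrArg Neg.neg (Finset.sum_congr rfl fun A _ => Finset.sum_congr rfl fun j _ =>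
      congrArg _ (partialDeriv_congr _ (h1.mono fun y hy => congrFun hy A)))
  -- As `φ'` is a multiple of `s⁻ⁿ`, one has `s φ'' = -n φ'`: the terms `4 s φ''` and `4 n φ'`
  -- cancel and only `4 φ'` survives.
  rw [h2, diracD0Star_diracD0 hsm, sum_partialDeriv_comp_normSq_smul
    (hU.mono fun y hy => hd _ (by positivity)) hd', add_zero, ← add_smul,
    ← neg_smul, smul_smul]
  congr 1
  simp only [hφ']
  rw [zpow_sub_one₀ hx2, zpow_neg, zpow_natCast, ← pow_mul]
  field_simp
  ring

/-! ### The fundamental solution of `Δ²` -/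

theorem sphereArea_pos (n : ℕ) : 0 < sphereArea n := by
  unfold sphereArea; positivity

theorem biharmonicConst_pos {n : ℕ} (hn : 3 ≤ n) : 0 < biharmonicConst n := by
  have h3 : (3 : ℝ) ≤ n := by exact_mod_cast hn
  have := sphereArea_pos n
  have h1 : (0 : ℝ) < n - 1 := by linarith
  have h2 : (0 : ℝ) < n - 2 := by linarith
  unfold biharmonicConst; positivity

/-- This normalisation makes the constant of `H` equal to `-1/ω_{2n}` and gives the regularised
bilaplacian total mass one. -/
theorem biharmonicConst_mul {n : ℕ} (hn : 3 ≤ n) :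
    8 * ((n : ℝ) - 1) * ((n : ℝ) - 2) * biharmonicConst n = (sphereArea n)⁻¹ := by
  have h3 : (3 : ℝ) ≤ n := by exact_mod_cast hn
  have := (sphereArea_pos n).ne'
  have h1 : (n : ℝ) - 1 ≠ 0 := by linarith
  have h2 : (n : ℝ) - 2 ≠ 0 := by linarith
  unfold biharmonicConst
  field_simp

theorem finrank_space (n : ℕ) : Module.finrank ℝ (Space n) = 2 * n := by
  simp

/-- Integration of radial functions. -/
theorem integral_radial {n : ℕ} (hn : 1 ≤ n) (f : ℝ → ℝ) :
    ∫ x : Space n, f ‖x‖ = sphereArea n * ∫ r in Ioi (0 : ℝ), r ^ (2 * n - 1) * f r := by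
  have : Nonempty (Fin n) := ⟨⟨0, hn⟩⟩
  rw [integral_fun_norm_addHaar, finrank_space, Measure.real, EuclideanSpace.volume_ball]
  obtain ⟨m, rfl⟩ : ∃ m, n = m + 1 := ⟨n - 1, by omega⟩
  have h1 : (Real.sqrt Real.pi) ^ (2 * (m + 1)) = Real.pi ^ (m + 1) := by
    rw [pow_mul, Real.sq_sqrt Real.pi_pos.le]
  have h2 : ((Fintype.card (Fin 2 × Fin (m + 1)) : ℕ) : ℝ) / 2 + 1 = ((m + 1 : ℕ) : ℝ) + 1 := by
    simp
  rw [h2, Real.Gamma_nat_eq_factorial]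
  simp only [Fintype.card_prod, Fintype.card_fin, h1, ENNReal.ofReal_one, one_pow, one_mul,
    smul_eq_mul, nsmul_eq_mul]
  rw [ENNReal.toReal_ofReal (by positivity), ← mul_assoc]
  congr 1
  unfold sphereArea
  rw [Nat.factorial_succ, Nat.add_sub_cancel]
  push_cast
  field_simp

theorem locallyIntegrable_kernelG0 {n : ℕ} (hn : 3 ≤ n) :
    LocallyIntegrable (kernelG0 n) volume := by
  refine locallyIntegrable_of_norm_le_rpow (C := biharmonicConst n) (α := ((2 * n - 4 : ℕ) : ℝ))
    (by rw [finrank_space]; omega) (by rw [finrank_space]; exact_mod_cast (by omega))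
    (Eventually.of_forall fun x => ?_) ?_
  · rw [kernelG0, Real.norm_of_nonneg (div_nonneg (biharmonicConst_pos hn).le (by positivity)),
      Real.rpow_neg (norm_nonneg _), Real.rpow_natCast, div_eq_mul_inv]
  · unfold kernelG0
    exact (measurable_const.div (measurable_norm.pow_const _)).aestronglyMeasurable

/-! ### Integration by parts against test functions on the whole space -/

section IntegrationByParts

variable {n : ℕ}

theorem two_le_infty : (2 : ℕ∞ω) ≤ ∞ :=
  WithTop.coe_le_coe.2 (le_top : (2 : ℕ∞) ≤ ⊤)

theorem _root_.ContDiff.partialDeriv {F : Type*} [NormedAddCommGroup F] [NormedSpace ℝ F]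
    {k m : ℕ∞ω} {u : Space n → F} (hu : ContDiff ℝ m u) (i : Fin 2 × Fin n)
    (h : k + 1 ≤ m) : ContDiff ℝ k (partialDeriv i u) :=
  (hu.fderiv_right h).clm_apply contDiff_const

theorem _root_.HasCompactSupport.partialDeriv {F : Type*} [NormedAddCommGroup F] [NormedSpace ℝ F]
    {u : Space n → F} (hu : HasCompactSupport u) (i : Fin 2 × Fin n) :
    HasCompactSupport (partialDeriv i u) :=
  hu.fderiv_apply ℝ _

theorem integral_mul_partialDeriv {u φ : Space n → ℝ} (hu : ContDiff ℝ 1 u) (hφ : ContDiff ℝ 1 φ)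
    (hc : HasCompactSupport φ) (i : Fin 2 × Fin n) :
    ∫ x, u x * partialDeriv i φ x = -∫ x, partialDeriv i u x * φ x := by
  have hu' := (hu.partialDeriv (k := 0) i (by simp)).continuous
  have hφ' := (hφ.partialDeriv (k := 0) i (by simp)).continuous
  exact integral_mul_fderiv_eq_neg_fderiv_mul_of_integrable
    ((hu'.mul hφ.continuous).integrable_of_hasCompactSupport hc.mul_left)
    ((hu.continuous.mul hφ').integrable_of_hasCompactSupport (hc.partialDeriv i).mul_left)
    ((hu.continuous.mul hφ.continuous).integrable_of_hasCompactSupport hc.mul_left)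
    (fun x _ => hu.differentiable one_ne_zero x) (fun x _ => hφ.differentiable one_ne_zero x)

theorem laplacian_eq_sum {u : Space n → ℝ} (hu : ContDiff ℝ 2 u) :
    Laplacian.laplacian u = fun x => ∑ i, partialDeriv i (partialDeriv i u) x :=
  funext fun _ => laplacian_eq_sum_partialDeriv hu.contDiffAt

theorem contDiff_laplacian {u : Space n → ℝ} (hu : ContDiff ℝ ∞ u) :
    ContDiff ℝ ∞ (Laplacian.laplacian u) := by
  rw [laplacian_eq_sum (hu.of_le two_le_infty)]
  exact ContDiff.sum fun i _ => (hu.partialDeriv (k := ∞) i (by simp)).partialDeriv i (by simp)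

theorem hasCompactSupport_laplacian {u : Space n → ℝ} (hu : ContDiff ℝ ∞ u)
    (hc : HasCompactSupport u) : HasCompactSupport (Laplacian.laplacian u) := by
  rw [laplacian_eq_sum (hu.of_le two_le_infty)]
  refine hc.mono' fun x hx => ?_
  by_contra h
  refine hx (Finset.sum_eq_zero fun i _ => ?_)
  by_contra h2
  exact h (tsupport_fderiv_apply_subset ℝ _ (tsupport_fderiv_apply_subset ℝ _
    (subset_tsupport _ h2)))

/-- Green's second identity on the whole space. -/
theorem integral_mul_laplacian {u φ : Space n → ℝ} (hu : ContDiff ℝ ∞ u) (hφ : ContDiff ℝ ∞ φ)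
    (hc : HasCompactSupport φ) :
    ∫ x, u x * Laplacian.laplacian φ x = ∫ x, Laplacian.laplacian u x * φ x := by
  have hu1 : ∀ i, ContDiff ℝ ∞ (partialDeriv i u) := fun i => hu.partialDeriv i (by simp)
  have hφ1 : ∀ i, ContDiff ℝ ∞ (partialDeriv i φ) := fun i => hφ.partialDeriv i (by simp)
  have hu2 : ∀ i, ContDiff ℝ ∞ (partialDeriv i (partialDeriv i u)) :=
    fun i => (hu1 i).partialDeriv i (by simp)
  have hφ2 : ∀ i, ContDiff ℝ ∞ (partialDeriv i (partialDeriv i φ)) :=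
    fun i => (hφ1 i).partialDeriv i (by simp)
  have one_le : (1 : ℕ∞ω) ≤ ∞ := by exact_mod_cast le_top
  rw [laplacian_eq_sum (hu.of_le two_le_infty),
    laplacian_eq_sum (hφ.of_le two_le_infty)]
  simp only [Finset.mul_sum, Finset.sum_mul]
  rw [integral_finsetSum, integral_finsetSum]
  · refine Finset.sum_congr rfl fun i _ => ?_
    rw [integral_mul_partialDeriv (hu.of_le one_le) ((hφ1 i).of_le one_le) (hc.partialDeriv i),
      integral_mul_partialDeriv ((hu1 i).of_le one_le) (hφ.of_le one_le) hc, neg_neg]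
  · exact fun i _ => ((hu2 i).continuous.mul hφ.continuous).integrable_of_hasCompactSupport
      hc.mul_left
  · exact fun i _ => (hu.continuous.mul (hφ2 i).continuous).integrable_of_hasCompactSupport
      ((hc.partialDeriv i).partialDeriv i).mul_left

end IntegrationByParts

/-! ### The regularised powers `(|x|² + a)^m` and their Laplacians -/

section Regularization

variable {n : ℕ}

theorem contDiff_normSq_add_zpow {k : ℕ∞ω} {a : ℝ} (ha : 0 < a) (m : ℤ) :
    ContDiff ℝ k (fun y : Space n => (‖y‖ ^ 2 + a) ^ m) := by
  rw [contDiff_iff_contDiffAt]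
  intro x
  have h : ContDiffAt ℝ k (fun s : ℝ => (s + a) ^ m) (‖x‖ ^ 2) :=
    (((analyticAt_id (𝕜 := ℝ)).add analyticAt_const).zpow
      (by have := sq_nonneg ‖x‖; simp only [Pi.add_apply, id]; positivity)).contDiffAt
  exact h.comp x (contDiff_norm_sq ℝ).contDiffAt

/-- The factor `‖x‖²` in the radial Laplacian is written as `(‖x‖² + a) - a`; the second part
produces the correction proportional to `a`. -/
theorem laplacian_normSq_add_zpow {a : ℝ} (ha : 0 < a) (m : ℤ) (x : Space n) :
    Laplacian.laplacian (fun y : Space n => (‖y‖ ^ 2 + a) ^ m) x =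
      4 * m * (m - 1 + n) * (‖x‖ ^ 2 + a) ^ (m - 1) -
        4 * m * (m - 1) * a * (‖x‖ ^ 2 + a) ^ (m - 2) := by
  have hpos : ∀ y : Space n, ‖y‖ ^ 2 + a ≠ 0 := fun y => by positivity
  have hd : ∀ (k : ℤ) (y : Space n), HasDerivAt (fun s : ℝ => (s + a) ^ k)
      (k * (‖y‖ ^ 2 + a) ^ (k - 1)) (‖y‖ ^ 2) := fun k y => by
    simpa using (hasDerivAt_zpow k _ (Or.inl (hpos y))).comp_add_const (‖y‖ ^ 2) a
  have h := sum_partialDeriv_comp_normSq_smul (x := x)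
    (φ := fun s => (s + a) ^ m) (φ' := fun s => m * (s + a) ^ (m - 1))
    (Eventually.of_forall fun y => hd m y) ((hd (m - 1) x).const_mul _)
    (0 : Space n →L[ℝ] ℝ) 1
  simp only [zero_apply, zero_add, smul_eq_mul, mul_one] at h
  rw [mul_zero, add_zero] at h
  rw [laplacian_eq_sum_partialDeriv (contDiff_normSq_add_zpow ha m).contDiffAt, h]
  rw [show m - 1 - 1 = m - 2 by ring]
  have h2 : (‖x‖ ^ 2 + a) ^ (m - 1) = (‖x‖ ^ 2 + a) * (‖x‖ ^ 2 + a) ^ (m - 2) := by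
    rw [← zpow_one_add₀ (hpos x)]; congr 1; ring
  rw [h2]
  push_cast
  ring

/-- The exponents `-n` and `-n - 1` drop out, which reflects that `|x|^(4-2n)` is biharmonic off the
origin. What remains is, up to the factor `C_{2n}`, a dilate of one integrable profile of mass one.
-/
theorem bilaplacian_normSq_add_zpow {a : ℝ} (ha : 0 < a) (x : Space n) :
    Laplacian.laplacian (Laplacian.laplacian (fun y : Space n => (‖y‖ ^ 2 + a) ^ (2 - n : ℤ))) x =
      16 * n * (n - 1) * (n - 2) * (n + 1) * a ^ 2 * (‖x‖ ^ 2 + a) ^ (-n - 2 : ℤ) := by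
  have h1 : Laplacian.laplacian (fun y : Space n => (‖y‖ ^ 2 + a) ^ (2 - n : ℤ)) =
      ((4 * (2 - n) : ℝ) • fun y : Space n => (‖y‖ ^ 2 + a) ^ (1 - n : ℤ)) +
        ((4 * (2 - n) * (n - 1) * a : ℝ) • fun y : Space n => (‖y‖ ^ 2 + a) ^ (-n : ℤ)) := by
    funext y
    rw [laplacian_normSq_add_zpow ha, show (2 - n - 1 : ℤ) = 1 - n by ring,
      show (2 - n - 2 : ℤ) = -n by ring]
    simp only [Pi.add_apply, Pi.smul_apply, smul_eq_mul]
    push_cast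
    ring
  have hc : ∀ (k : ℝ) (m : ℤ), ContDiffAt ℝ 2 (k • fun y : Space n => (‖y‖ ^ 2 + a) ^ m) x :=
    fun k m => contDiffAt_const.smul (contDiff_normSq_add_zpow ha m).contDiffAt
  have hpos : ‖x‖ ^ 2 + a ≠ 0 := by positivity
  rw [h1, (hc _ _).laplacian_add (hc _ _), InnerProductSpace.laplacian_smul _
    (contDiff_normSq_add_zpow ha _).contDiffAt, InnerProductSpace.laplacian_smul _
    (contDiff_normSq_add_zpow ha _).contDiffAt, laplacian_normSq_add_zpow ha,
    laplacian_normSq_add_zpow ha]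
  rw [show (1 - n - 1 : ℤ) = -n - 2 + 2 by ring, show (1 - n - 2 : ℤ) = -n - 2 + 1 by ring,
    show (-n - 1 : ℤ) = -n - 2 + 1 by ring, zpow_add₀ hpos, zpow_add_one₀ hpos]
  simp only [smul_eq_mul]
  push_cast
  rw [zpow_ofNat]
  ring

theorem integral_normSq_add_one_zpow {n : ℕ} (hn : 3 ≤ n) :
    ∫ x : Space n, biharmonicConst n * (16 * n * (n - 1) * (n - 2) * (n + 1) *
      (‖x‖ ^ 2 + 1) ^ (-n - 2 : ℤ)) = 1 := by
  have h3 : (3 : ℝ) ≤ n := by exact_mod_cast hn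
  have hI : ∫ r in Ioi (0 : ℝ), r ^ (2 * n - 1) * (r ^ 2 + 1) ^ (-n - 2 : ℤ) =
      (2 * n * (n + 1) : ℝ)⁻¹ := by
    -- The antiderivative comes from `u = r² / (r² + 1)`: then `du = 2r / (r² + 1)² dr`, and the
    -- integral becomes that of `u^(n-1) (1 - u) / 2`.
    have hd : ∀ r : ℝ, HasDerivAt (fun r : ℝ => (r ^ 2 / (r ^ 2 + 1)) ^ n / (2 * n) -
        (r ^ 2 / (r ^ 2 + 1)) ^ (n + 1) / (2 * (n + 1)))
        (r ^ (2 * n - 1) * (r ^ 2 + 1) ^ (-n - 2 : ℤ)) r := by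
      intro r
      have hp : r ^ 2 + 1 ≠ 0 := by positivity
      have hu : HasDerivAt (fun r : ℝ => r ^ 2 / (r ^ 2 + 1)) (2 * r / (r ^ 2 + 1) ^ 2) r := by
        refine ((hasDerivAt_pow 2 r).div ((hasDerivAt_pow 2 r).add_const 1) hp).congr_deriv ?_
        field_simp
        ring
      refine (((hu.pow n).div_const (2 * n)).sub
        ((hu.pow (n + 1)).div_const (2 * (n + 1)))).congr_deriv ?_
      obtain ⟨m, rfl⟩ : ∃ m, n = m + 1 := ⟨n - 1, by omega⟩
      have e1 : (-((m + 1 : ℕ) : ℤ) - 2) = -((m + 3 : ℕ) : ℤ) := by push_cast; ring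
      rw [e1, zpow_neg, zpow_natCast, show 2 * (m + 1) - 1 = 2 * m + 1 by omega]
      simp only [Nat.add_sub_cancel, div_pow]
      push_cast
      field_simp
      ring
    have ht : Tendsto (fun r : ℝ => r ^ 2 / (r ^ 2 + 1)) atTop (𝓝 1) := by
      have h : Tendsto (fun r : ℝ => 1 - (r ^ 2 + 1)⁻¹) atTop (𝓝 (1 - 0)) :=
        tendsto_const_nhds.sub ((tendsto_atTop_add_const_right _ 1
          (tendsto_pow_atTop two_ne_zero)).inv_tendsto_atTop)
      rw [sub_zero] at h
      refine h.congr fun r => ?_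
      have hp : r ^ 2 + 1 ≠ 0 := by positivity
      field_simp
      ring
    have ht2 := ((ht.pow n).div_const (2 * n : ℝ)).sub
      ((ht.pow (n + 1)).div_const (2 * (n + 1) : ℝ))
    rw [integral_Ioi_of_hasDerivAt_of_nonneg' (fun r _ => hd r) (fun r hr => ?_) ht2]
    · have : (n : ℝ) ≠ 0 := by positivity
      simp [show n ≠ 0 by omega]
      field_simp
      ring
    · have : (0 : ℝ) < r := hr
      positivity
  have hr := integral_radial (n := n) (by omega) fun r => (r ^ 2 + 1) ^ (-n - 2 : ℤ)
  rw [integral_const_mul, integral_const_mul, hr, hI]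
  have h8 := biharmonicConst_mul hn
  have hs := (sphereArea_pos n).ne'
  have hn0 : (n : ℝ) ≠ 0 := by positivity
  have hn1 : (n : ℝ) + 1 ≠ 0 := by positivity
  have : biharmonicConst n * (16 * n * (n - 1) * (n - 2) * (n + 1) *
      (sphereArea n * (2 * n * (n + 1) : ℝ)⁻¹)) =
      (8 * ((n : ℝ) - 1) * ((n : ℝ) - 2) * biharmonicConst n) * sphereArea n := by
    field_simp
    ring
  rw [this, h8, inv_mul_cancel₀ hs]

end Regularization

theorem kernelG0_eq_zpow {n : ℕ} (hn : 3 ≤ n) (x : Space n) :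
    kernelG0 n x = biharmonicConst n * (‖x‖ ^ 2) ^ (2 - n : ℤ) := by
  unfold kernelG0
  obtain ⟨m, rfl⟩ : ∃ m, n = m + 2 := ⟨n - 2, by omega⟩
  rw [show (2 - ((m + 2 : ℕ) : ℤ)) = -(m : ℤ) by push_cast; ring, zpow_neg, zpow_natCast, ← pow_mul,
    div_eq_mul_inv]
  congr 2

/-- The pairing of `Δ² φ` with `C_{2n} (|x|² + c⁻²)^(2-n)` is computed in two ways as `c → ∞`.
Moving both Laplacians onto the power gives `φ` tested against the approximate identity `c^(2n) P(c
x)`, hence `φ 0`. Directly, the powers converge to `G₀` off the origin and are dominated by it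
because the exponent is negative. -/
theorem isBiharmonicFundamentalSolution_kernelG0 {n : ℕ} (hn : 3 ≤ n) :
    IsBiharmonicFundamentalSolution (kernelG0 n) := by
  refine ⟨locallyIntegrable_kernelG0 hn, fun φ hφ hc => ?_⟩
  have hLφ := contDiff_laplacian hφ
  have hLc := hasCompactSupport_laplacian hφ hc
  have hLLφ := contDiff_laplacian hLφ
  have hLLc := hasCompactSupport_laplacian hLφ hLc
  have hn3 : (3 : ℝ) ≤ n := by exact_mod_cast hn
  have hC := biharmonicConst_pos hn
  set P : Space n → ℝ := fun x => biharmonicConst n * (16 * n * (n - 1) * (n - 2) * (n + 1) *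
      (‖x‖ ^ 2 + 1) ^ (-n - 2 : ℤ)) with hP
  have hK : (0 : ℝ) ≤ 16 * n * (n - 1) * (n - 2) * (n + 1) := by
    have : (0 : ℝ) ≤ n - 1 := by linarith
    have : (0 : ℝ) ≤ n - 2 := by linarith
    positivity
  have hP0 : ∀ x, 0 ≤ P x := fun x => by simp only [hP]; positivity
  have hPlim : Tendsto (fun x => ‖x‖ ^ Module.finrank ℝ (Space n) * P x)
      (Bornology.cobounded (Space n)) (𝓝 0) := by
    have h1 : Tendsto (fun x : Space n => (biharmonicConst n *
        (16 * n * (n - 1) * (n - 2) * (n + 1))) * ((‖x‖ ^ 2 + 1)⁻¹))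
        (Bornology.cobounded (Space n)) (𝓝 (_ * 0)) :=
      tendsto_const_nhds.mul ((tendsto_atTop_add_const_right _ 1
        ((tendsto_pow_atTop two_ne_zero).comp tendsto_norm_cobounded_atTop)).inv_tendsto_atTop)
    rw [mul_zero] at h1
    refine squeeze_zero (fun x => mul_nonneg (by positivity) (hP0 x)) (fun x => ?_) h1
    rw [finrank_space, pow_mul]
    simp only [hP]
    rw [show (-n - 2 : ℤ) = -((n + 2 : ℕ) : ℤ) by push_cast; ring, zpow_neg, zpow_natCast]
    have h2 : (‖x‖ ^ 2) ^ n * ((‖x‖ ^ 2 + 1) ^ (n + 2))⁻¹ ≤ (‖x‖ ^ 2 + 1)⁻¹ := by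
      rw [← div_eq_mul_inv, div_le_iff₀ (by positivity), pow_add, pow_two (‖x‖ ^ 2 + 1)]
      have h3 : (‖x‖ ^ 2) ^ n ≤ (‖x‖ ^ 2 + 1) ^ n := pow_le_pow_left₀ (by positivity) (by linarith) n
      have h4 : (‖x‖ ^ 2 + 1)⁻¹ * ((‖x‖ ^ 2 + 1) ^ n * ((‖x‖ ^ 2 + 1) * (‖x‖ ^ 2 + 1))) =
          (‖x‖ ^ 2 + 1) ^ n * (‖x‖ ^ 2 + 1) := by field_simp
      rw [h4]
      nlinarith [sq_nonneg ‖x‖, pow_pos (show 0 < ‖x‖ ^ 2 + 1 by positivity) n]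
    calc _ = (biharmonicConst n * (16 * n * (n - 1) * (n - 2) * (n + 1))) *
          ((‖x‖ ^ 2) ^ n * ((‖x‖ ^ 2 + 1) ^ (n + 2))⁻¹) := by ring
      _ ≤ _ := mul_le_mul_of_nonneg_left h2 (mul_nonneg hC.le hK)
  have hlim1 := tendsto_integral_comp_smul_smul_of_integrable hP0
    (integral_normSq_add_one_zpow hn) hPlim
    (hφ.continuous.integrable_of_hasCompactSupport hc) hφ.continuous.continuousAt
  have heq : ∀ c : ℝ, 0 < c → ∫ x, (c ^ Module.finrank ℝ (Space n) * P (c • x)) • φ x =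
      ∫ x, biharmonicConst n * (‖x‖ ^ 2 + (c ^ 2)⁻¹) ^ (2 - n : ℤ) *
        Laplacian.laplacian (Laplacian.laplacian φ) x := by
    intro c hcpos
    have ha : 0 < (c ^ 2)⁻¹ := by positivity
    have hsm := contDiff_normSq_add_zpow (n := n) (k := ∞) ha (2 - n)
    simp_rw [mul_assoc]
    rw [integral_const_mul, integral_mul_laplacian hsm hLφ hLc,
      integral_mul_laplacian (contDiff_laplacian hsm) hφ hc, ← integral_const_mul]
    congr 1
    funext x
    rw [bilaplacian_normSq_add_zpow ha]
    simp only [hP, finrank_space, norm_smul, smul_eq_mul]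
    have e1 : (‖c‖ * ‖x‖) ^ 2 + 1 = c ^ 2 * (‖x‖ ^ 2 + (c ^ 2)⁻¹) := by
      rw [mul_pow, Real.norm_eq_abs, sq_abs]; field_simp
    have e2 : c ^ (2 * n) * (c ^ 2) ^ (-n - 2 : ℤ) = ((c ^ 2)⁻¹) ^ 2 := by
      rw [show (-n - 2 : ℤ) = -((n + 2 : ℕ) : ℤ) by push_cast; ring, zpow_neg, zpow_natCast]
      field_simp
      ring
    rw [e1, mul_zpow, ← e2]
    ring
  have hlim2 : Tendsto (fun c : ℝ => ∫ x, biharmonicConst n * (‖x‖ ^ 2 + (c ^ 2)⁻¹) ^ (2 - n : ℤ) *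
        Laplacian.laplacian (Laplacian.laplacian φ) x) atTop
      (𝓝 (∫ x, kernelG0 n x * Laplacian.laplacian (Laplacian.laplacian φ) x)) := by
    have : Nontrivial (Space n) := by
      apply Module.nontrivial_of_finrank_pos (R := ℝ); rw [finrank_space]; omega
    have hne : ∀ᵐ x : Space n, x ≠ 0 := by
      simp [ae_iff]
    refine tendsto_integral_filter_of_dominated_convergence
      (fun x => ‖kernelG0 n x * Laplacian.laplacian (Laplacian.laplacian φ) x‖) ?_ ?_ ?_ ?_
    · filter_upwards [eventually_gt_atTop 0] with c hc0
      exact ((continuous_const.mul (contDiff_normSq_add_zpow (n := n) (k := 0)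
        (by positivity : 0 < (c ^ 2)⁻¹) (2 - n)).continuous).mul
          hLLφ.continuous).aestronglyMeasurable
    · filter_upwards [eventually_gt_atTop 0] with c hc0
      filter_upwards [hne] with x hx
      rw [kernelG0_eq_zpow hn, norm_mul, norm_mul, norm_mul, norm_mul]
      refine mul_le_mul_of_nonneg_right ?_ (norm_nonneg _)
      refine mul_le_mul_of_nonneg_left ?_ (norm_nonneg _)
      rw [Real.norm_of_nonneg (by positivity), Real.norm_of_nonneg (by positivity)]
      obtain ⟨m, rfl⟩ : ∃ m, n = m + 2 := ⟨n - 2, by omega⟩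
      rw [show (2 - ((m + 2 : ℕ) : ℤ)) = -(m : ℤ) by push_cast; ring, zpow_neg, zpow_natCast,
        zpow_neg, zpow_natCast]
      have : 0 < ‖x‖ := norm_pos_iff.2 hx
      gcongr
      have : 0 < (c ^ 2)⁻¹ := by positivity
      linarith
    · exact ((locallyIntegrable_kernelG0 hn).integrable_smul_right_of_hasCompactSupport
        hLLφ.continuous hLLc).norm
    · filter_upwards [hne] with x hx
      rw [kernelG0_eq_zpow hn]
      refine ((Tendsto.zpow₀ ?_ _ (Or.inl ?_)).const_mul _).mul_const _
      · have h := (tendsto_const_nhds (x := ‖x‖ ^ 2)).add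
          ((tendsto_pow_atTop (α := ℝ) two_ne_zero).inv_tendsto_atTop)
        rw [add_zero] at h
        exact h
      · have : 0 < ‖x‖ := norm_pos_iff.2 hx
        positivity
  refine tendsto_nhds_unique hlim2 (hlim1.congr' ?_)
  filter_upwards [eventually_gt_atTop 0] with c hc0 using heq c hc0

/-! ### Hypographs of Lipschitz functions -/

section Hypograph

variable {E : Type*} [NormedAddCommGroup E] [InnerProductSpace ℝ E] [FiniteDimensional ℝ E]

/-- The hyperplane orthogonal to `u`. -/
noncomputable abbrev hyperplane (u : E) : Submodule ℝ E := (ℝ ∙ u)ᗮ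

/-- The orthogonal projection onto the hyperplane orthogonal to `u`. -/
noncomputable abbrev hyperplaneProj (u : E) : E →L[ℝ] hyperplane u :=
  (hyperplane u).orthogonalProjectionOnto

/-- The chart `(k, τ) ↦ k + (g(k) + τ) u` that straightens the graph of `g`. -/
noncomputable def graphMap (u : E) (g : hyperplane u → ℝ) (q : hyperplane u × ℝ) : E :=
  (q.1 : E) + (g q.1 + q.2) • u

/-- The height above the graph of `g`. -/
noncomputable def graphHeight (u : E) (g : hyperplane u → ℝ) (y : E) : ℝ :=
  inner ℝ u y - g (hyperplaneProj u y)

variable {u : E} {g : hyperplane u → ℝ}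

theorem hyperplaneProj_add_inner_smul (hu : ‖u‖ = 1) (y : E) :
    (hyperplaneProj u y : E) + (inner ℝ u y : ℝ) • u = y := by
  have h : ((hyperplaneProj u y : hyperplane u) : E) = y - (ℝ ∙ u).starProjection y :=
    congrArg Subtype.val (Submodule.orthogonalProjectionOnto_orthogonal y)
  rw [h, Submodule.starProjection_unit_singleton ℝ hu]
  simp

theorem inner_hyperplane (k : hyperplane u) : inner ℝ u (k : E) = 0 :=
  Submodule.mem_orthogonal_singleton_iff_inner_right.1 k.2

theorem hyperplaneProj_coe_add_smul (k : hyperplane u) (t : ℝ) :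
    hyperplaneProj u ((k : E) + t • u) = k := by
  rw [map_add, map_smul, Submodule.orthogonalProjectionOnto_orthogonalComplement_singleton_eq_zero]
  simp

theorem inner_coe_add_smul (hu : ‖u‖ = 1) (k : hyperplane u) (t : ℝ) :
    inner ℝ u ((k : E) + t • u) = t := by
  rw [inner_add_right, inner_hyperplane, inner_smul_right, real_inner_self_eq_norm_sq, hu]
  simp

theorem hyperplaneProj_graphMap (q : hyperplane u × ℝ) : hyperplaneProj u (graphMap u g q) = q.1 :=
  hyperplaneProj_coe_add_smul _ _

theorem graphHeight_graphMap (hu : ‖u‖ = 1) (q : hyperplane u × ℝ) :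
    graphHeight u g (graphMap u g q) = q.2 := by
  rw [graphHeight, hyperplaneProj_graphMap, graphMap, inner_coe_add_smul hu]
  ring

theorem graphMap_proj_height (hu : ‖u‖ = 1) (y : E) :
    graphMap u g (hyperplaneProj u y, graphHeight u g y) = y := by
  rw [graphMap, graphHeight]
  simp only [add_sub_cancel]
  exact hyperplaneProj_add_inner_smul hu y

theorem continuous_graphMap (hg : Continuous g) : Continuous (graphMap u g) := by
  unfold graphMap; fun_prop

theorem continuous_graphHeight (hg : Continuous g) : Continuous (graphHeight u g) := by
  unfold graphHeight
  exact (continuous_const.inner continuous_id).sub (hg.comp (hyperplaneProj u).continuous)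

/-- The straightening chart as a homeomorphism. -/
noncomputable def graphHomeomorph (hu : ‖u‖ = 1) (hg : Continuous g) : hyperplane u × ℝ ≃ₜ E where
  toFun := graphMap u g
  invFun y := (hyperplaneProj u y, graphHeight u g y)
  left_inv q := Prod.ext (hyperplaneProj_graphMap q) (graphHeight_graphMap hu q)
  right_inv y := graphMap_proj_height hu y
  continuous_toFun := continuous_graphMap hg
  continuous_invFun := (hyperplaneProj u).continuous.prodMk (continuous_graphHeight hg)

variable [MeasurableSpace E] [BorelSpace E]

/-- The hyperplane carries its Lebesgue measure, not the restriction of the ambient one. -/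
noncomputable instance (u : E) : MeasureSpace (hyperplane u) := measureSpaceOfInnerProductSpace

theorem measurePreserving_coe_add_smul (hu : ‖u‖ = 1) :
    MeasurePreserving (fun q : hyperplane u × ℝ => (q.1 : E) + q.2 • u)
      (volume.prod volume) volume := by
  have h1 := ((ℝ ∙ u).measurePreserving_measurableEquivProd (0 : E)).symm
  rw [InnerProductSpace.euclideanHausdorffMeasure_eq_volume] at h1
  have h2 := (LinearIsometryEquiv.toSpanUnitSingleton (𝕜 := ℝ) u hu).measurePreserving
  have h3 : MeasurePreserving (Prod.swap : hyperplane u × ℝ → ℝ × hyperplane u)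
    (volume.prod volume) (volume.prod volume) := Measure.measurePreserving_swap
  have h4 := h1.comp ((h2.prod (MeasurePreserving.id (volume : Measure (hyperplane u)))).comp h3)
  have h5 : (fun q : hyperplane u × ℝ => (q.1 : E) + q.2 • u) =
      ((ℝ ∙ u).measurableEquivProd (0 : E)).symm ∘
        Prod.map (LinearIsometryEquiv.toSpanUnitSingleton (𝕜 := ℝ) u hu) id ∘ Prod.swap := by
    funext q
    simp [add_comm]
  rw [h5]
  exact h4

/-- The chart is a shear, a translation on each vertical line, followed by the orthogonal splitting
of the space. Volume is therefore preserved for merely continuous `g`. -/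
theorem measurePreserving_graphMap (hu : ‖u‖ = 1) (hg : Continuous g) :
    MeasurePreserving (graphMap u g) (volume.prod volume) volume := by
  have h1 : MeasurePreserving (fun q : hyperplane u × ℝ => (q.1, g q.1 + q.2))
      (volume.prod volume) (volume.prod volume) :=
    (MeasurePreserving.id _).skew_product (g := fun k t => g k + t) (by fun_prop)
      (Eventually.of_forall fun k => (measurePreserving_add_left volume (g k)).map_eq)
  exact (measurePreserving_coe_add_smul hu).comp h1

variable {F : Type*} [NormedAddCommGroup F] [NormedSpace ℝ F]

theorem integral_comp_graphMap (hu : ‖u‖ = 1) (hg : Continuous g) (v : E → F) :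
    ∫ q, v (graphMap u g q) ∂(volume.prod volume) = ∫ y, v y :=
  (measurePreserving_graphMap hu hg).integral_comp
    (graphHomeomorph hu hg).measurableEmbedding v

theorem integrable_comp_graphMap (hu : ‖u‖ = 1) (hg : Continuous g) {v : E → F}
    (hv : Integrable v) : Integrable (fun q => v (graphMap u g q)) (volume.prod volume) :=
  (measurePreserving_graphMap hu hg).integrable_comp_of_integrable hv

theorem hasCompactSupport_comp_graphMap_fst {w : E → F} (hc : HasCompactSupport w) (t : ℝ) :
    HasCompactSupport fun k => w (graphMap u g (k, t)) := by
  refine HasCompactSupport.intro (hc.isCompact.image (hyperplaneProj u).continuous)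
    fun k hk => image_eq_zero_of_notMem_tsupport fun h => hk ?_
  exact ⟨_, h, hyperplaneProj_graphMap _⟩

variable [CompleteSpace F]

/-- The fundamental theorem of calculus in the direction transversal to a graph. -/
theorem setIntegral_hypograph_fderiv_normal (hu : ‖u‖ = 1) (hg : Continuous g) {w : E → F}
    (hw : ContDiff ℝ 1 w) (hc : HasCompactSupport w) :
    ∫ y in {y | graphHeight u g y < 0}, fderiv ℝ w y u = ∫ k, w (graphMap u g (k, 0)) := by
  have hm : MeasurableSet {y | graphHeight u g y < 0} :=
    (isOpen_lt (continuous_graphHeight hg) continuous_const).measurableSet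
  have hd : Continuous fun y => fderiv ℝ w y u :=
    (hw.continuous_fderiv one_ne_zero).clm_apply continuous_const
  have hi : Integrable fun y => fderiv ℝ w y u :=
    hd.integrable_of_hasCompactSupport (hc.fderiv_apply ℝ u)
  rw [← integral_indicator hm, ← integral_comp_graphMap hu hg,
    integral_prod _ (integrable_comp_graphMap hu hg (hi.indicator hm))]
  congr 1
  funext k
  have hline : ∀ t, HasDerivAt (fun t => w (graphMap u g (k, t)))
      (fderiv ℝ w (graphMap u g (k, t)) u) t := by
    intro t
    have h1 : HasDerivAt (fun t => graphMap u g (k, t)) u t := by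
      simpa [graphMap] using (((hasDerivAt_id t).const_add (g k)).smul_const u).const_add (k : E)
    exact (hw.differentiable one_ne_zero _).hasFDerivAt.comp_hasDerivAt t h1
  have hcd : ContDiff ℝ 1 fun t => w (graphMap u g (k, t)) := by
    have h1 : ContDiff ℝ 1 fun t : ℝ => (k : E) + (g k + t) • u :=
      contDiff_const.add ((contDiff_const.add contDiff_id).smul contDiff_const)
    exact hw.comp h1
  have hcs : HasCompactSupport fun t => w (graphMap u g (k, t)) := by
    refine HasCompactSupport.intro (hc.isCompact.image (continuous_graphHeight hg))
      fun t ht => image_eq_zero_of_notMem_tsupport fun h => ht ?_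
    exact ⟨_, h, graphHeight_graphMap hu _⟩
  -- On each vertical line the hypograph is a half-line, and compact support removes the
  -- contribution at `-∞`.
  rw [← hcs.integral_Iic_deriv_eq hcd 0, integral_Iic_eq_integral_Iio,
    ← integral_indicator measurableSet_Iio]
  congr 1
  funext t
  simp only [indicator, mem_ofPred_eq, graphHeight_graphMap hu, mem_Iio, (hline t).deriv]

/-- The mass of `w` in the layer at height `τ` above the graph. -/
theorem continuous_integral_graphMap (hg : Continuous g) {w : E → F}
    (hw : Continuous w) (hc : HasCompactSupport w) :
    Continuous fun t => ∫ k, ‖w (graphMap u g (k, t))‖ := by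
  have hK := hc.isCompact.image (hyperplaneProj u).continuous
  have h := continuous_parametric_integral_of_continuous (μ := (volume : Measure (hyperplane u)))
    (f := fun t k => ‖w (graphMap u g (k, t))‖)
    ((hw.comp ((continuous_graphMap hg).comp continuous_swap)).norm) hK
  convert h using 2 with t
  refine (setIntegral_eq_integral_of_forall_compl_eq_zero fun k hk => ?_).symm
  rw [norm_eq_zero]
  refine image_eq_zero_of_notMem_tsupport fun h => hk ⟨_, h, hyperplaneProj_graphMap _⟩

/-- A directional derivative under the integral becomes the derivative of a translation, which can
afterwards be moved from the function to the domain of integration. -/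
theorem hasDerivAt_setIntegral_comp_add_smul {w : E → F} (hw : ContDiff ℝ 1 w)
    (hc : HasCompactSupport w) (s : Set E) (e : E) :
    HasDerivAt (fun h : ℝ => ∫ y in s, w (y + h • e)) (∫ y in s, fderiv ℝ w y e) 0 := by
  have hd : Continuous fun y => fderiv ℝ w y e :=
    (hw.continuous_fderiv one_ne_zero).clm_apply continuous_const
  obtain ⟨C, hC⟩ := hd.bounded_above_of_compact_support (hc.fderiv_apply ℝ e)
  -- All points from which a shift by at most `1` along `e` can reach the support; a constant on
  -- this compact set dominates the derivatives.
  set K : Set E := (fun q : E × ℝ => q.1 - q.2 • e) '' (tsupport w ×ˢ Metric.closedBall 0 1) with hK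
  have hKc : IsCompact K := (hc.isCompact.prod (isCompact_closedBall 0 1)).image (by fun_prop)
  have hCnn : 0 ≤ C := (norm_nonneg _).trans (hC 0)
  have h := (hasDerivAt_integral_of_dominated_loc_of_deriv_le (μ := volume.restrict s) (𝕜 := ℝ)
    (F := fun h y => w (y + h • e)) (F' := fun h y => fderiv ℝ w (y + h • e) e)
    (x₀ := 0) (s := Metric.ball 0 1) (bound := K.indicator fun _ => C)
    (Metric.ball_mem_nhds _ one_pos) ?_ ?_ ?_ ?_ ?_ ?_).2
  · simpa using h
  · exact Eventually.of_forall fun h =>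
      (hw.continuous.comp (continuous_id.add continuous_const)).aestronglyMeasurable
  · simp only [zero_smul, add_zero]
    exact (hw.continuous.integrable_of_hasCompactSupport hc).integrableOn
  · exact (hd.comp (continuous_id.add continuous_const)).aestronglyMeasurable
  · refine Eventually.of_forall fun y h hh => ?_
    by_cases hy : y ∈ K
    · rw [indicator_of_mem hy]; exact hC _
    · rw [indicator_of_notMem hy, norm_le_zero_iff]
      have : y + h • e ∉ tsupport w := fun hmem => hy ⟨(y + h • e, h),
        ⟨hmem, Metric.ball_subset_closedBall hh⟩, by simp⟩
      exact image_eq_zero_of_notMem_tsupport (f := fun y => fderiv ℝ w y e)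
        fun h2 => this (tsupport_fderiv_apply_subset ℝ e h2)
  · exact ((integrable_indicator_iff hKc.measurableSet).2
      (integrableOn_const (hKc.measure_lt_top.ne))).integrableOn
  · refine Eventually.of_forall fun y h _ => ?_
    have h1 : HasDerivAt (fun h : ℝ => y + h • e) e h := by
      simpa using ((hasDerivAt_id h).smul_const e).const_add y
    exact (hw.differentiable one_ne_zero _).hasFDerivAt.comp_hasDerivAt h h1

/-- In directions tangent to the reference hyperplane, the integral of a derivative over the
hypograph is controlled by the Lipschitz constant of the graph. -/
theorem norm_setIntegral_hypograph_fderiv_tangential_le (hu : ‖u‖ = 1) {η : NNReal}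
    (hg : LipschitzWith η g) {w : E → F} (hw : ContDiff ℝ 1 w) (hc : HasCompactSupport w) {e : E}
    (he : inner ℝ u e = 0) :
    ‖∫ y in {y | graphHeight u g y < 0}, fderiv ℝ w y e‖ ≤
      2 * (η * ‖e‖) * ∫ k, ‖w (graphMap u g (k, 0))‖ := by
  set H : Set E := {y | graphHeight u g y < 0} with hH
  have hgc := hg.continuous
  have hm : MeasurableSet H := (isOpen_lt (continuous_graphHeight hgc) continuous_const).measurableSet
  have hwi : Integrable w := hw.continuous.integrable_of_hasCompactSupport hc
  set J : ℝ → ℝ := fun t => ∫ k, ‖w (graphMap u g (k, t))‖ with hJ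
  have hJc : Continuous J := continuous_integral_graphMap hgc hw.continuous hc
  have hderiv := hasDerivAt_setIntegral_comp_add_smul hw hc H e
  set I : ℝ → F := fun h => ∫ y in H, w (y + h • e) with hI
  -- As `e` is orthogonal to `u`, moving along it changes the height only through `g`.
  have hmove : ∀ (y : E) (h : ℝ),
      |graphHeight u g (y - h • e) - graphHeight u g y| ≤ η * ‖e‖ * |h| := by
    intro y h
    have h1 : graphHeight u g (y - h • e) - graphHeight u g y =
        g (hyperplaneProj u y) - g (hyperplaneProj u (y - h • e)) := by
      simp only [graphHeight, inner_sub_right, inner_smul_right, he]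
      ring
    rw [h1, ← Real.dist_eq]
    refine (hg.dist_le_mul _ _).trans ?_
    rw [dist_eq_norm, ← map_sub, mul_assoc]
    gcongr
    refine ((hyperplane u).norm_orthogonalProjectionOnto_apply_le _).trans ?_
    simp [norm_smul, mul_comm]
  -- Translation invariance moves the shift from `w` to the indicator of the hypograph. The two
  -- indicators can differ only where the height is at most `η ‖e‖ |h|` in absolute value, and
  -- Fubini slices this layer by height.
  have hbound : ∀ h : ℝ, ‖I h - I 0‖ ≤ ∫ t in Icc (-(η * ‖e‖ * |h|)) (η * ‖e‖ * |h|), J t := by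
    intro h
    set δ := η * ‖e‖ * |h| with hδ
    set S : Set E := {y | |graphHeight u g y| ≤ δ} with hS
    have hSm : MeasurableSet S :=
      (isClosed_le (continuous_graphHeight hgc).abs continuous_const).measurableSet
    have hshift : I h = ∫ y, (H.indicator (fun _ => (1 : ℝ)) (y - h • e)) • w y := by
      rw [hI, ← integral_add_right_eq_self _ (h • e)]
      simp only [add_sub_cancel_right]
      rw [← integral_indicator hm]
      congr 1
      funext y
      by_cases hy : y ∈ H <;> simp [hy]
    have hzero : I 0 = ∫ y, (H.indicator (fun _ => (1 : ℝ)) y) • w y := by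
      simp only [hI, zero_smul, add_zero]
      rw [← integral_indicator hm]
      congr 1
      funext y
      by_cases hy : y ∈ H <;> simp [hy]
    have hmeas : Measurable (H.indicator (fun _ => (1 : ℝ))) := measurable_const.indicator hm
    have hind : ∀ y, ‖H.indicator (fun _ => (1 : ℝ)) y‖ ≤ 1 := fun y => by
      by_cases hy : y ∈ H <;> simp [hy]
    have i1 : Integrable fun y => (H.indicator (fun _ => (1 : ℝ)) (y - h • e)) • w y :=
      hwi.bdd_smul 1 (hmeas.comp (measurable_id.sub_const _)).aestronglyMeasurable
        (Eventually.of_forall fun y => hind _)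
    have i2 : Integrable fun y => (H.indicator (fun _ => (1 : ℝ)) y) • w y :=
      hwi.bdd_smul 1 hmeas.aestronglyMeasurable (Eventually.of_forall fun y => hind _)
    rw [hshift, hzero, ← integral_sub i1 i2]
    have hle : ‖∫ y, ((H.indicator (fun _ => (1 : ℝ)) (y - h • e)) • w y -
        (H.indicator (fun _ => (1 : ℝ)) y) • w y)‖ ≤ ∫ y, S.indicator (fun y => ‖w y‖) y := by
      refine norm_integral_le_of_norm_le (hwi.norm.indicator hSm) (Eventually.of_forall fun y => ?_)
      rw [← sub_smul, norm_smul]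
      have := hmove y h
      by_cases hy : y ∈ S
      · rw [indicator_of_mem hy]
        refine mul_le_of_le_one_left (norm_nonneg _) ?_
        by_cases h1 : y ∈ H <;> by_cases h2 : y - h • e ∈ H <;> simp [h1, h2]
      · rw [indicator_of_notMem hy]
        have hy' : δ < |graphHeight u g y| := not_le.1 hy
        have hiff : y - h • e ∈ H ↔ y ∈ H := by
          simp only [hH, mem_ofPred_eq]
          rw [abs_le] at this
          rcases lt_abs.1 hy' with h3 | h3
          · constructor <;> intro h4 <;> linarith [abs_nonneg h, norm_nonneg e]
          · constructor <;> intro h4 <;> linarith [abs_nonneg h, norm_nonneg e]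
        by_cases h1 : y ∈ H
        · simp [h1, hiff.2 h1]
        · simp [h1, mt hiff.1 h1]
    refine hle.trans (le_of_eq ?_)
    rw [← integral_comp_graphMap hu hgc, integral_prod_symm _
      (integrable_comp_graphMap hu hgc (hwi.norm.indicator hSm)), ← integral_indicator measurableSet_Icc]
    congr 1
    funext t
    have hiff : ∀ k : hyperplane u, graphMap u g (k, t) ∈ S ↔ t ∈ Icc (-δ) δ := fun k => by
      simp only [hS, mem_ofPred_eq, graphHeight_graphMap hu, mem_Icc, abs_le]
    by_cases ht : t ∈ Icc (-δ) δ
    · simp [indicator, hiff, ht, hJ]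
    · simp [indicator, hiff, ht]
  refine le_of_forall_pos_le_add fun ε hε => ?_
  set a := η * ‖e‖ with ha
  have ha0 : 0 ≤ a := by positivity
  obtain ⟨ε', hε', hle'⟩ : ∃ ε' > 0, 2 * a * ε' ≤ ε :=
    ⟨ε / (2 * a + 1), by positivity, by
      rw [← mul_div_assoc, div_le_iff₀ (by positivity)]; nlinarith⟩
  obtain ⟨δ₀, hδ₀, hJδ⟩ := Metric.continuousAt_iff.1 hJc.continuousAt ε' hε'
  have hslope := hderiv.tendsto_slope_zero_right.norm
  refine le_trans ?_ (show 2 * a * (J 0 + ε') ≤ 2 * a * J 0 + ε by linarith)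
  -- The layer has thickness `2 a h`, and on it `J` exceeds `J 0` by at most `ε'`, so every small
  -- difference quotient obeys the bound.
  refine le_of_tendsto hslope ?_
  have hsmall : ∀ᶠ h : ℝ in 𝓝[>] 0, a * |h| < δ₀ := by
    have h1 : Tendsto (fun h : ℝ => a * |h|) (𝓝[>] 0) (𝓝 (a * |0|)) :=
      ((continuous_const.mul continuous_abs).tendsto 0).mono_left nhdsWithin_le_nhds
    rw [abs_zero, mul_zero] at h1
    exact h1.eventually_lt_const hδ₀
  filter_upwards [hsmall, self_mem_nhdsWithin] with h hh hpos
  have hpos' : (0 : ℝ) < h := hpos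
  rw [abs_of_pos hpos'] at hh
  rw [norm_smul, zero_add, norm_inv, Real.norm_of_nonneg hpos'.le, inv_mul_le_iff₀ hpos']
  refine (hbound h).trans ?_
  rw [abs_of_pos hpos']
  have h2 : ‖∫ t in Icc (-(a * h)) (a * h), J t‖ ≤
      (J 0 + ε') * volume.real (Icc (-(a * h)) (a * h)) := by
    refine norm_setIntegral_le_of_norm_le_const (by simp) fun t ht => ?_
    have h3 : dist t 0 < δ₀ := by
      rw [Real.dist_eq, sub_zero]; exact (abs_le.2 ht).trans_lt hh
    have h4 := hJδ h3
    have hJnn : 0 ≤ J t := integral_nonneg fun _ => norm_nonneg _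
    rw [Real.norm_of_nonneg hJnn]
    rw [Real.dist_eq] at h4
    linarith [(abs_lt.1 h4).2]
  refine (le_abs_self _).trans (h2.trans (le_of_eq ?_))
  rw [Real.volume_real_Icc_of_le (by nlinarith)]
  ring

end Hypograph

/-! ### The Hausdorff measure on Lipschitz graphs -/

/-- The difference `μ - m` is itself a measure, and the mass it gives to `‖φ‖` is at most `c - 1`
times that given by `m`. -/
theorem norm_integral_sub_integral_le {α F : Type*} [MeasurableSpace α] [NormedAddCommGroup F]
    [NormedSpace ℝ F] {m μ : Measure α} [IsFiniteMeasure m] {c : NNReal} (h1 : m ≤ μ)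
    (h2 : μ ≤ c • m) {φ : α → F} (hφ : Integrable φ m) :
    ‖(∫ x, φ x ∂μ) - ∫ x, φ x ∂m‖ ≤ (c - 1) * ∫ x, ‖φ x‖ ∂m := by
  have hμ : Integrable φ μ := (hφ.smul_measure_nnreal (c := c)).mono_measure h2
  have hs : μ - m + m = μ := Measure.sub_add_cancel_of_le h1
  have hν : Integrable φ (μ - m) := hμ.mono_measure Measure.sub_le
  have e1 : ∫ x, φ x ∂μ = (∫ x, φ x ∂(μ - m)) + ∫ x, φ x ∂m := by
    rw [← integral_add_measure hν hφ, hs]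
  have e2 : ∫ x, ‖φ x‖ ∂μ = (∫ x, ‖φ x‖ ∂(μ - m)) + ∫ x, ‖φ x‖ ∂m := by
    rw [← integral_add_measure hν.norm hφ.norm, hs]
  have e3 : ∫ x, ‖φ x‖ ∂μ ≤ c * ∫ x, ‖φ x‖ ∂m := by
    refine (integral_mono_measure h2 (Eventually.of_forall fun _ => norm_nonneg _)
      (hφ.norm.smul_measure_nnreal (c := c))).trans ?_
    rw [integral_smul_nnreal_measure]
    exact le_of_eq (by rw [NNReal.smul_def, smul_eq_mul])
  rw [e1, add_sub_cancel_right]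
  refine (norm_integral_le_integral_norm _).trans ?_
  linarith

theorem _root_.LipschitzWith.euclideanHausdorffMeasure_image_le {X Y : Type*} [MetricSpace X]
    [MetricSpace Y] [MeasurableSpace X] [BorelSpace X] [MeasurableSpace Y] [BorelSpace Y]
    {K : NNReal} {f : X → Y} (hf : LipschitzWith K f) (d : ℕ) (s : Set X) :
    μHE[d] (f '' s) ≤ (K : ENNReal) ^ d * μHE[d] s := by
  simp only [Measure.euclideanHausdorffMeasure_def, Measure.smul_apply]
  rw [ENNReal.smul_def, ENNReal.smul_def, smul_eq_mul, smul_eq_mul, mul_left_comm]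
  gcongr
  have := hf.hausdorffMeasure_image_le (d := d) (by positivity) s
  rwa [ENNReal.rpow_natCast] at this

theorem setIntegral_eq_of_mem_iff {α F : Type*} [MeasurableSpace α] [NormedAddCommGroup F]
    [NormedSpace ℝ F] {μ : Measure α} {S T W : Set α} (hS : MeasurableSet S) (hT : MeasurableSet T)
    (h : ∀ y ∈ W, y ∈ S ↔ y ∈ T) {v : α → F} (hv : ∀ y, y ∉ W → v y = 0) :
    ∫ y in S, v y ∂μ = ∫ y in T, v y ∂μ := by
  rw [← integral_indicator hS, ← integral_indicator hT]
  congr 1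
  funext y
  by_cases hy : y ∈ W
  · by_cases hy' : y ∈ T
    · simp [hy', (h y hy).2 hy']
    · simp [hy', mt (h y hy).1 hy']
  · simp [indicator, hv y hy]

section GraphMeasure

variable {E : Type*} [NormedAddCommGroup E] [InnerProductSpace ℝ E] [FiniteDimensional ℝ E]
  [MeasurableSpace E] [BorelSpace E] {u : E} {g : hyperplane u → ℝ} {d : ℕ}

theorem volume_hyperplane_eq (hu : ‖u‖ = 1) (hd : Module.finrank ℝ E = d + 1) :
    (volume : Measure (hyperplane u)) = μHE[d] := by
  have : Fact (Module.finrank ℝ E = d + 1) := ⟨hd⟩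
  have h : Module.finrank ℝ (hyperplane u) = d :=
    Submodule.finrank_orthogonal_span_singleton (by rintro rfl; simp at hu)
  rw [← InnerProductSpace.euclideanHausdorffMeasure_eq_volume, h]

theorem lipschitzWith_graphMap (hu : ‖u‖ = 1) {η : NNReal} (hg : LipschitzWith η g) :
    LipschitzWith (1 + η) fun k => graphMap u g (k, 0) := by
  refine LipschitzWith.of_dist_le_mul fun k l => ?_
  have h : graphMap u g (k, 0) - graphMap u g (l, 0) = ((k - l : hyperplane u) : E) +
      (g k - g l) • u := by
    simp only [graphMap, add_zero, Submodule.coe_sub]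
    module
  rw [dist_eq_norm, h]
  refine (norm_add_le _ _).trans ?_
  have h2 := hg.dist_le_mul k l
  rw [Real.dist_eq] at h2
  rw [norm_smul, hu, mul_one, Real.norm_eq_abs, ← Submodule.coe_norm, ← dist_eq_norm]
  push_cast
  linarith

theorem lipschitzWith_hyperplaneProj : LipschitzWith 1 (hyperplaneProj u) := by
  refine LipschitzWith.of_dist_le_mul fun x y => ?_
  rw [dist_eq_norm, ← map_sub, dist_eq_norm, NNReal.coe_one, one_mul]
  exact (hyperplane u).norm_orthogonalProjectionOnto_apply_le _

theorem graphMap_zero_of_height_eq_zero (hu : ‖u‖ = 1) {y : E} (hy : graphHeight u g y = 0) :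
    graphMap u g (hyperplaneProj u y, 0) = y := by
  rw [← hy, graphMap_proj_height hu]

/-- The orthogonal projection inverts the parametrisation of the graph and, being `1`-Lipschitz,
does not increase Hausdorff measure. -/
theorem map_graphMap_le (hu : ‖u‖ = 1) (hd : Module.finrank ℝ E = d + 1) (hg : Continuous g) :
    (volume : Measure (hyperplane u)).map (fun k => graphMap u g (k, 0)) ≤
      (μHE[d] : Measure E).restrict {y | graphHeight u g y = 0} := by
  have hΦ : Continuous fun k => graphMap u g (k, 0) :=
    (continuous_graphMap hg).comp (continuous_id.prodMk continuous_const)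
  refine Measure.le_iff.2 fun A hA => ?_
  rw [Measure.map_apply hΦ.measurable hA, Measure.restrict_apply hA, volume_hyperplane_eq hu hd]
  have h : (fun k => graphMap u g (k, 0)) ⁻¹' A ⊆
      hyperplaneProj u '' (A ∩ {y | graphHeight u g y = 0}) := fun k hk =>
    ⟨_, ⟨hk, graphHeight_graphMap hu _⟩, hyperplaneProj_graphMap _⟩
  refine (measure_mono h).trans ?_
  have h2 := (lipschitzWith_hyperplaneProj (u := u)).euclideanHausdorffMeasure_image_le d
    (A ∩ {y | graphHeight u g y = 0})
  rwa [ENNReal.coe_one, one_pow, one_mul] at h2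

/-- The parametrisation is `(1 + η)`-Lipschitz. Together with `map_graphMap_le` this replaces an
area formula: the constants `1` and `(1 + η) ^ d` merge as the slope tends to zero. -/
theorem restrict_le_map_graphMap (hu : ‖u‖ = 1) (hd : Module.finrank ℝ E = d + 1) {η : NNReal}
    (hg : LipschitzWith η g) :
    (μHE[d] : Measure E).restrict {y | graphHeight u g y = 0} ≤
      ((1 + η) ^ d : NNReal) •
        (volume : Measure (hyperplane u)).map (fun k => graphMap u g (k, 0)) := by
  have hΦ : Continuous fun k => graphMap u g (k, 0) :=
    (continuous_graphMap hg.continuous).comp (continuous_id.prodMk continuous_const)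
  refine Measure.le_iff.2 fun A hA => ?_
  rw [Measure.smul_apply, Measure.map_apply hΦ.measurable hA, Measure.restrict_apply hA,
    volume_hyperplane_eq hu hd]
  have h : A ∩ {y | graphHeight u g y = 0} ⊆
      (fun k => graphMap u g (k, 0)) '' ((fun k => graphMap u g (k, 0)) ⁻¹' A) := by
    rintro y ⟨hyA, hy⟩
    have := graphMap_zero_of_height_eq_zero hu hy
    exact ⟨hyperplaneProj u y, by rwa [mem_preimage, this], this⟩
  refine (measure_mono h).trans ?_
  refine ((lipschitzWith_graphMap hu hg).euclideanHausdorffMeasure_image_le d _).trans ?_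
  rw [ENNReal.smul_def, smul_eq_mul, ENNReal.coe_pow]

theorem map_graphMap_lt_top (hg : Continuous g) {S : Set E} (hS : IsCompact S) :
    (volume : Measure (hyperplane u)).map (fun k => graphMap u g (k, 0)) S < ⊤ := by
  have hΦ : Continuous fun k => graphMap u g (k, 0) :=
    (continuous_graphMap hg).comp (continuous_id.prodMk continuous_const)
  rw [Measure.map_apply hΦ.measurable hS.measurableSet]
  refine (measure_mono ?_).trans_lt (hS.image (hyperplaneProj u).continuous).measure_lt_top
  exact fun k hk => ⟨_, hk, hyperplaneProj_graphMap _⟩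

variable {F : Type*} [NormedAddCommGroup F] [NormedSpace ℝ F]

theorem integrable_graph (hu : ‖u‖ = 1) (hd : Module.finrank ℝ E = d + 1) {η : NNReal}
    (hg : LipschitzWith η g) {w : E → F} (hw : Continuous w) (hc : HasCompactSupport w) :
    IntegrableOn w {y | graphHeight u g y = 0} μHE[d] := by
  have hΦ : Continuous fun k => graphMap u g (k, 0) :=
    (continuous_graphMap hg.continuous).comp (continuous_id.prodMk continuous_const)
  have h : Integrable w ((volume : Measure (hyperplane u)).map fun k => graphMap u g (k, 0)) := by
    refine (integrable_map_measure ?_ hΦ.aemeasurable).2 ?_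
    · exact (hw.stronglyMeasurable_of_hasCompactSupport hc).aestronglyMeasurable
    · exact (hw.comp hΦ).integrable_of_hasCompactSupport (hasCompactSupport_comp_graphMap_fst hc 0)
  exact (h.smul_measure_nnreal (c := (1 + η) ^ d)).mono_measure (restrict_le_map_graphMap hu hd hg)

theorem integral_norm_graphMap_le (hu : ‖u‖ = 1) (hd : Module.finrank ℝ E = d + 1) {η : NNReal}
    (hg : LipschitzWith η g) {w : E → F} (hw : Continuous w) (hc : HasCompactSupport w) :
    ∫ k, ‖w (graphMap u g (k, 0))‖ ≤ ∫ y in {y | graphHeight u g y = 0}, ‖w y‖ ∂μHE[d] := by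
  have hΦ : Continuous fun k => graphMap u g (k, 0) :=
    (continuous_graphMap hg.continuous).comp (continuous_id.prodMk continuous_const)
  rw [← integral_map (f := fun y => ‖w y‖) hΦ.aemeasurable hw.norm.aestronglyMeasurable]
  exact integral_mono_measure (map_graphMap_le hu hd hg.continuous)
    (Eventually.of_forall fun _ => norm_nonneg _) (integrable_graph hu hd hg hw hc).norm

theorem norm_integral_graph_sub_le (hu : ‖u‖ = 1) (hd : Module.finrank ℝ E = d + 1) {η : NNReal}
    (hg : LipschitzWith η g) {w : E → F} (hw : Continuous w) (hc : HasCompactSupport w) :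
    ‖(∫ y in {y | graphHeight u g y = 0}, w y ∂μHE[d]) - ∫ k, w (graphMap u g (k, 0))‖ ≤
      ((1 + η) ^ d - 1) * ∫ y in {y | graphHeight u g y = 0}, ‖w y‖ ∂μHE[d] := by
  have hΦ : Continuous fun k => graphMap u g (k, 0) :=
    (continuous_graphMap hg.continuous).comp (continuous_id.prodMk continuous_const)
  have hsm := hw.stronglyMeasurable_of_hasCompactSupport hc
  set m := (volume : Measure (hyperplane u)).map fun k => graphMap u g (k, 0) with hm
  -- The comparison is made on the support of `w`, where the pushed-forward measure is finite.
  set S := tsupport w with hS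
  have hSm : MeasurableSet S := hc.isCompact.measurableSet
  have : IsFiniteMeasure (m.restrict S) :=
    ⟨by rw [Measure.restrict_apply_univ]; exact map_graphMap_lt_top hg.continuous hc.isCompact⟩
  have h1 : m.restrict S ≤ ((μHE[d] : Measure E).restrict {y | graphHeight u g y = 0}).restrict S :=
    Measure.restrict_mono le_rfl (map_graphMap_le hu hd hg.continuous)
  have h2 : ((μHE[d] : Measure E).restrict {y | graphHeight u g y = 0}).restrict S ≤
      ((1 + η) ^ d : NNReal) • m.restrict S := by
    rw [← Measure.restrict_smul]
    exact Measure.restrict_mono le_rfl (restrict_le_map_graphMap hu hd hg)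
  have hi : Integrable w (m.restrict S) := by
    refine Integrable.mono_measure ?_ (h1.trans Measure.restrict_le_self)
    exact integrable_graph hu hd hg hw hc
  have h := norm_integral_sub_integral_le h1 h2 hi
  have hw0 : ∀ y, y ∉ S → w y = 0 := fun y hy => image_eq_zero_of_notMem_tsupport hy
  have hw0' : ∀ y, y ∉ S → ‖w y‖ = 0 := fun y hy => by rw [hw0 y hy, norm_zero]
  rw [setIntegral_eq_integral_of_forall_compl_eq_zero hw0,
    setIntegral_eq_integral_of_forall_compl_eq_zero hw0,
    setIntegral_eq_integral_of_forall_compl_eq_zero hw0', hm,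
    integral_map hΦ.aemeasurable hsm.aestronglyMeasurable,
    integral_map hΦ.aemeasurable hsm.norm.aestronglyMeasurable] at h
  refine h.trans ?_
  push_cast
  refine mul_le_mul_of_nonneg_left (integral_norm_graphMap_le hu hd hg hw hc) ?_
  rw [sub_nonneg]
  exact one_le_pow₀ (by simp)

variable [CompleteSpace F]

/-- The divergence theorem near a boundary point, up to an error that is controlled by the slope of
the boundary. -/
theorem norm_setIntegral_fderiv_sub_boundary_le (hu : ‖u‖ = 1) (hd : Module.finrank ℝ E = d + 1)
    {η : NNReal} (hg : LipschitzWith η g) {Ω W : Set E} (hΩo : IsOpen Ω)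
    (hΩ : ∀ y ∈ W, y ∈ Ω ↔ graphHeight u g y < 0)
    (hfr : ∀ y ∈ W, y ∈ frontier Ω ↔ graphHeight u g y = 0) {ν : E → E}
    (hνm : AEStronglyMeasurable ν ((μHE[d] : Measure E).restrict (frontier Ω)))
    (hν : ∀ y ∈ W, y ∈ frontier Ω → ‖ν y - u‖ ≤ η)
    {w : E → F} (hw : ContDiff ℝ 1 w) (hc : HasCompactSupport w) (hwW : tsupport w ⊆ W) (e : E) :
    ‖(∫ y in Ω, fderiv ℝ w y e) - ∫ y in frontier Ω, (inner ℝ (ν y) e : ℝ) • w y ∂μHE[d]‖ ≤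
      (3 * η + ((1 + η) ^ d - 1)) * ‖e‖ * ∫ y in frontier Ω, ‖w y‖ ∂μHE[d] := by
  have hgc := hg.continuous
  set H : Set E := {y | graphHeight u g y < 0} with hH
  set Γ : Set E := {y | graphHeight u g y = 0} with hΓ
  have hHm : MeasurableSet H :=
    (isOpen_lt (continuous_graphHeight hgc) continuous_const).measurableSet
  have hΓm : MeasurableSet Γ :=
    (isClosed_eq (continuous_graphHeight hgc) continuous_const).measurableSet
  have hw0 : ∀ y, y ∉ W → w y = 0 := fun y hy => image_eq_zero_of_notMem_tsupport fun h => hy (hwW h)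
  have hwd0 : ∀ (e : E) y, y ∉ W → fderiv ℝ w y e = 0 := fun e y hy =>
    image_eq_zero_of_notMem_tsupport (f := fun y => fderiv ℝ w y e)
      fun h => hy (hwW (tsupport_fderiv_apply_subset ℝ e h))
  have hvol : ∀ e, ∫ y in Ω, fderiv ℝ w y e = ∫ y in H, fderiv ℝ w y e := fun e =>
    setIntegral_eq_of_mem_iff hΩo.measurableSet hHm hΩ (hwd0 e)
  have hbd : ∫ y in frontier Ω, w y ∂μHE[d] = ∫ y in Γ, w y ∂μHE[d] :=
    setIntegral_eq_of_mem_iff isClosed_frontier.measurableSet hΓm hfr hw0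
  have hbdN : ∫ y in frontier Ω, ‖w y‖ ∂μHE[d] = ∫ y in Γ, ‖w y‖ ∂μHE[d] :=
    setIntegral_eq_of_mem_iff isClosed_frontier.measurableSet hΓm hfr
      fun y hy => by rw [hw0 y hy, norm_zero]
  have hwΓ : IntegrableOn w Γ μHE[d] := integrable_graph hu hd hg hw.continuous hc
  have hwfr : IntegrableOn w (frontier Ω) μHE[d] := by
    have h := (integrable_indicator_iff hΓm).2 hwΓ
    rw [← integrable_indicator_iff isClosed_frontier.measurableSet]
    refine h.congr (Eventually.of_forall fun y => ?_)
    by_cases hy : y ∈ W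
    · by_cases hy' : y ∈ Γ
      · simp [hy', (hfr y hy).2 hy']
      · simp [hy', mt (hfr y hy).1 hy']
    · simp [indicator, hw0 y hy]
  rw [hbdN]
  set N := ∫ y in Γ, ‖w y‖ ∂μHE[d] with hN
  have hN0 : 0 ≤ N := integral_nonneg fun _ => norm_nonneg _
  -- In the splitting `e = c u + e'` the normal part is integrated exactly, while the tangential
  -- part only contributes an error.
  set c : ℝ := inner ℝ u e with hce
  have hcle : |c| ≤ ‖e‖ := by simpa [hu] using abs_real_inner_le_norm u e
  set e' : E := e - c • u with he'
  have he'0 : inner ℝ u e' = 0 := by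
    rw [he', inner_sub_right, inner_smul_right, real_inner_self_eq_norm_sq, hu]; simp [hce]
  have he'n : ‖e'‖ ≤ ‖e‖ := by
    have h1 : ‖e‖ * ‖e‖ = ‖e'‖ * ‖e'‖ + ‖c • u‖ * ‖c • u‖ := by
      have h2 : e = e' + c • u := by rw [he']; abel
      conv_lhs => rw [h2]
      refine norm_add_sq_eq_norm_sq_add_norm_sq_real ?_
      rw [inner_smul_right, real_inner_comm, he'0, mul_zero]
    nlinarith [norm_nonneg e, norm_nonneg e', norm_nonneg (c • u)]
  have hdi : ∀ e : E, Integrable fun y => fderiv ℝ w y e := fun e =>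
    ((hw.continuous_fderiv one_ne_zero).clm_apply continuous_const).integrable_of_hasCompactSupport
      (hc.fderiv_apply ℝ e)
  have hsplit : ∫ y in H, fderiv ℝ w y e =
      c • (∫ k, w (graphMap u g (k, 0))) + ∫ y in H, fderiv ℝ w y e' := by
    have hn := setIntegral_hypograph_fderiv_normal hu hgc hw hc
    have hi1 : Integrable (fun y => c • fderiv ℝ w y u) (volume.restrict H) :=
      ((hdi u).smul c).integrableOn
    rw [← hn, ← integral_smul, ← integral_add hi1 (hdi e').integrableOn]
    congr 1
    funext y
    rw [← map_smul, ← map_add, he', add_sub_cancel]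
  have hR1 : ‖∫ y in H, fderiv ℝ w y e'‖ ≤ 2 * (η * ‖e‖) * N := by
    refine (norm_setIntegral_hypograph_fderiv_tangential_le hu hg hw hc he'0).trans ?_
    gcongr
    exact integral_norm_graphMap_le hu hd hg hw.continuous hc
  have hR3 := norm_integral_graph_sub_le hu hd hg hw.continuous hc
  have hR2 : ‖(∫ y in frontier Ω, (inner ℝ (ν y) e : ℝ) • w y ∂μHE[d]) -
      c • ∫ y in Γ, w y ∂μHE[d]‖ ≤ η * ‖e‖ * N := by
    rw [← hbd, ← integral_smul]
    have hb : ∀ y ∈ frontier Ω, ‖(inner ℝ (ν y) e : ℝ) • w y - c • w y‖ ≤ η * ‖e‖ * ‖w y‖ := by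
      intro y hy
      by_cases hyW : y ∈ W
      · rw [← sub_smul, norm_smul]
        gcongr
        rw [hce, ← inner_sub_left]
        refine (norm_inner_le_norm _ _).trans ?_
        gcongr
        exact hν y hyW hy
      · simp [hw0 y hyW]
    have hae := (ae_restrict_mem (μ := (μHE[d] : Measure E)) (isClosed_frontier (s := Ω)).measurableSet)
    have hi2 : Integrable (fun y => c • w y) ((μHE[d] : Measure E).restrict (frontier Ω)) :=
      hwfr.smul c
    have hmeas : AEStronglyMeasurable (fun y => (inner ℝ (ν y) e : ℝ) • w y)
        ((μHE[d] : Measure E).restrict (frontier Ω)) :=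
      (hνm.inner aestronglyMeasurable_const).smul hwfr.aestronglyMeasurable
    have hi1 : Integrable (fun y => (inner ℝ (ν y) e : ℝ) • w y)
        ((μHE[d] : Measure E).restrict (frontier Ω)) := by
      have h3 : Integrable (fun y => (inner ℝ (ν y) e : ℝ) • w y - c • w y)
          ((μHE[d] : Measure E).restrict (frontier Ω)) := by
        refine Integrable.mono' (hwfr.norm.const_mul (η * ‖e‖)) (hmeas.sub hi2.aestronglyMeasurable) ?_
        filter_upwards [hae] with y hy using hb y hy
      refine (h3.add hi2).congr (Eventually.of_forall fun y => ?_)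
      simp
    rw [← integral_sub hi1 hi2, ← hbdN, ← integral_const_mul]
    refine norm_integral_le_of_norm_le (hwfr.norm.const_mul _) ?_
    filter_upwards [hae] with y hy using hb y hy
  have hve := hvol e
  rw [hve, hsplit]
  set A := ∫ k, w (graphMap u g (k, 0))
  set B := ∫ y in Γ, w y ∂μHE[d]
  set D := ∫ y in H, fderiv ℝ w y e'
  set X := ∫ y in frontier Ω, (inner ℝ (ν y) e : ℝ) • w y ∂μHE[d]
  -- Three errors remain: `D` from the tangential derivative, `X - c • B` from replacing `ν` by `u`,
  -- and `c • (B - A)` from replacing Hausdorff measure by Lebesgue measure on the hyperplane.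
  have hfin : c • A + D - X = D - (X - c • B) - c • (B - A) := by module
  rw [hfin]
  have h4 : ‖c • (B - A)‖ ≤ ‖e‖ * (((1 + η) ^ d - 1) * N) := by
    rw [norm_smul]
    exact mul_le_mul hcle hR3 (norm_nonneg _) (norm_nonneg _)
  calc _ ≤ ‖D‖ + ‖X - c • B‖ + ‖c • (B - A)‖ :=
        (norm_sub_le _ _).trans (by gcongr; exact norm_sub_le _ _)
    _ ≤ 2 * (η * ‖e‖) * N + η * ‖e‖ * N + ‖e‖ * (((1 + η) ^ d - 1) * N) := by gcongr
    _ = _ := by ring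

end GraphMeasure

/-! ### Domains with `C²` boundary as local hypographs -/

section Boundary

variable {n : ℕ} {Ω : Set (Space n)} {p : Space n} {V : Set (Space n)} {ρ : Space n → ℝ}

theorem IsLocalDefiningFunction.of_mem (h : IsLocalDefiningFunction Ω p V ρ) {y : Space n}
    (hy : y ∈ V) : IsLocalDefiningFunction Ω y V ρ :=
  { h with mem := hy }

theorem IsLocalDefiningFunction.mem_iff (h : IsLocalDefiningFunction Ω p V ρ) {y : Space n}
    (hy : y ∈ V) : y ∈ Ω ↔ ρ y < 0 := by
  have := congrArg (y ∈ ·) h.inter_eq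
  simpa [hy] using this

theorem IsLocalDefiningFunction.contDiffAt (h : IsLocalDefiningFunction Ω p V ρ) {y : Space n}
    (hy : y ∈ V) : ContDiffAt ℝ 2 ρ y :=
  h.contDiffOn.contDiffAt (h.isOpen.mem_nhds hy)

theorem inner_gradient (ρ : Space n → ℝ) (y v : Space n) :
    inner ℝ (gradient ρ y) v = fderiv ℝ ρ y v := by
  rw [gradient, InnerProductSpace.toDual_symm_apply]

theorem IsLocalDefiningFunction.continuousAt_gradient (h : IsLocalDefiningFunction Ω p V ρ)
    {y : Space n} (hy : y ∈ V) : ContinuousAt (gradient ρ) y :=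
  (InnerProductSpace.toDual ℝ (Space n)).symm.continuous.continuousAt.comp
    ((h.contDiffAt hy).fderiv_right (m := 1) (by norm_num)).continuousAt

theorem IsLocalDefiningFunction.continuousAt_normal (h : IsLocalDefiningFunction Ω p V ρ)
    {y : Space n} (hy : y ∈ V) : ContinuousAt (fun z => ‖gradient ρ z‖⁻¹ • gradient ρ z) y :=
  ((h.continuousAt_gradient hy).norm.inv₀ (norm_ne_zero_iff.2 (h.gradient_ne_zero y hy))).smul
    (h.continuousAt_gradient hy)

theorem IsLocalDefiningFunction.eq_zero_of_mem_frontier (h : IsLocalDefiningFunction Ω p V ρ)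
    (hΩ : IsOpen Ω) {y : Space n} (hy : y ∈ V) (hyf : y ∈ frontier Ω) : ρ y = 0 := by
  rw [hΩ.frontier_eq] at hyf
  refine le_antisymm (not_lt.1 fun hpos => ?_) (not_lt.1 fun hneg => hyf.2 ((h.mem_iff hy).2 hneg))
  have h1 : ∀ᶠ z in 𝓝 y, z ∈ V ∧ 0 < ρ z :=
    (h.isOpen.eventually_mem hy).and
      ((h.contDiffAt hy).continuousAt.eventually_const_lt hpos)
  obtain ⟨z, hz, hzΩ⟩ := mem_closure_iff_nhds.1 hyf.1 _ h1
  exact absurd ((h.mem_iff hz.1).1 hzΩ) (not_lt.2 hz.2.le)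

/-- The difference quotients of `ρ` along the ray tend to a positive directional derivative. This is
used to detect a disagreement between two normals. -/
theorem IsLocalDefiningFunction.eventually_sign (h : IsLocalDefiningFunction Ω p V ρ)
    (hp : ρ p = 0) {v : Space n} (hv : 0 < inner ℝ (gradient ρ p) v) :
    ∀ᶠ t : ℝ in 𝓝[>] 0, p + t • v ∈ V ∧ 0 < ρ (p + t • v) := by
  have hl : HasDerivAt (fun t : ℝ => p + t • v) v 0 := by
    simpa using ((hasDerivAt_id (0 : ℝ)).smul_const v).const_add p
  have hd : HasDerivAt (fun t : ℝ => ρ (p + t • v)) (inner ℝ (gradient ρ p) v) 0 := by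
    rw [inner_gradient]
    have h1 : HasFDerivAt ρ (fderiv ℝ ρ p) (p + (0 : ℝ) • v) := by
      rw [zero_smul, add_zero]
      exact ((h.contDiffAt h.mem).differentiableAt two_ne_zero).hasFDerivAt
    exact h1.comp_hasDerivAt 0 hl
  have h1 := hd.tendsto_slope_zero_right.eventually_const_lt hv
  have h2 : ∀ᶠ t : ℝ in 𝓝[>] 0, p + t • v ∈ V := by
    have h3 : Tendsto (fun t : ℝ => p + t • v) (𝓝[>] 0) (𝓝 p) := by
      have := hl.continuousAt.tendsto
      rw [zero_smul, add_zero] at this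
      exact this.mono_left nhdsWithin_le_nhds
    exact h3.eventually (h.isOpen.mem_nhds h.mem)
  filter_upwards [h1, h2, self_mem_nhdsWithin] with t ht htV htpos
  refine ⟨htV, ?_⟩
  have htpos' : (0 : ℝ) < t := htpos
  simp only [zero_add, zero_smul, add_zero, hp, sub_zero, smul_eq_mul] at ht
  exact pos_of_mul_pos_right ht (by positivity)

/-- The outer unit normal does not depend on the defining function. -/
theorem IsOuterUnitNormal.eq_of_defining (hΩ : IsOpen Ω) (hp : p ∈ frontier Ω) {ν : Space n}
    (hν : IsOuterUnitNormal Ω p ν) (h : IsLocalDefiningFunction Ω p V ρ) :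
    ν = ‖gradient ρ p‖⁻¹ • gradient ρ p := by
  obtain ⟨V', ρ', h', rfl⟩ := hν
  have hz := h.eq_zero_of_mem_frontier hΩ h.mem hp
  have hz' := h'.eq_zero_of_mem_frontier hΩ h'.mem hp
  have ha : 0 < ‖gradient ρ p‖ := norm_pos_iff.2 (h.gradient_ne_zero p h.mem)
  have ha' : 0 < ‖gradient ρ' p‖ := norm_pos_iff.2 (h'.gradient_ne_zero p h'.mem)
  set a := ‖gradient ρ p‖⁻¹ • gradient ρ p with hadef
  set b := ‖gradient ρ' p‖⁻¹ • gradient ρ' p with hbdef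
  have hna : ‖a‖ = 1 := by
    rw [hadef, norm_smul, norm_inv, norm_norm, inv_mul_cancel₀ ha.ne']
  have hnb : ‖b‖ = 1 := by
    rw [hbdef, norm_smul, norm_inv, norm_norm, inv_mul_cancel₀ ha'.ne']
  by_contra hne
  have hlt : inner ℝ a b < 1 := (inner_lt_one_iff_real_of_norm_eq_one hna hnb).2 (Ne.symm hne)
  -- For distinct unit vectors `a` and `b`, the direction `a - b` increases `ρ` and decreases `ρ'`:
  -- a short step along it would lie in `Ω` according to `ρ'` and outside according to `ρ`.
  have h1 : 0 < inner ℝ (gradient ρ p) (a - b) := by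
    have h2 : gradient ρ p = ‖gradient ρ p‖ • a := by
      rw [hadef, smul_smul, mul_inv_cancel₀ ha.ne', one_smul]
    rw [h2, real_inner_smul_left, inner_sub_right, real_inner_self_eq_norm_sq, hna]
    exact mul_pos ha (by linarith)
  have h2 : 0 < inner ℝ (gradient (-ρ') p) (a - b) := by
    have h3 : gradient ρ' p = ‖gradient ρ' p‖ • b := by
      rw [hbdef, smul_smul, mul_inv_cancel₀ ha'.ne', one_smul]
    rw [inner_gradient, fderiv_neg, neg_apply, ← inner_gradient, h3,
      real_inner_smul_left, inner_sub_right, real_inner_self_eq_norm_sq, hnb, real_inner_comm]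
    rw [← mul_neg]
    exact mul_pos ha' (by linarith)
  have h3 : ∀ᶠ t : ℝ in 𝓝[>] 0, p + t • (a - b) ∈ V' ∧ 0 < (-ρ') (p + t • (a - b)) := by
    -- `-ρ'` is a defining function of the opposite side, which makes the sign lemma applicable to
    -- it.
    have hc : IsLocalDefiningFunction {x ∈ V' | 0 < ρ' x} p V' (-ρ') :=
      { isOpen := h'.isOpen
        mem := h'.mem
        contDiffOn := h'.contDiffOn.neg
        gradient_ne_zero := fun x hx h0 => h'.gradient_ne_zero x hx (by
          have := congrArg Neg.neg h0
          rw [gradient, fderiv_neg, map_neg, neg_neg, neg_zero] at this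
          exact this)
        inter_eq := by ext x; simp; tauto }
    exact hc.eventually_sign (by simp [hz']) h2
  obtain ⟨t, ⟨htV, ht⟩, htV', ht'⟩ := ((h.eventually_sign hz h1).and h3).exists
  rw [Pi.neg_apply, neg_pos] at ht'
  exact absurd ((h.mem_iff htV).1 ((h'.mem_iff htV').2 ht')) (not_lt.2 ht.le)

/-- By uniqueness of the normal, one defining function near `p` computes `ν` at all nearby boundary
points, and its normalised gradient is continuous. -/
theorem continuousOn_outerNormal (hΩ : IsOpen Ω) (hC : HasC2Boundary Ω) {ν : Space n → Space n}
    (hν : ∀ y ∈ frontier Ω, IsOuterUnitNormal Ω y (ν y)) : ContinuousOn ν (frontier Ω) := by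
  intro p hp
  obtain ⟨V, ρ, h⟩ := hC p hp
  refine (h.continuousAt_normal h.mem).continuousWithinAt.congr_of_eventuallyEq ?_
    ((hν p hp).eq_of_defining hΩ hp h)
  filter_upwards [self_mem_nhdsWithin, mem_nhdsWithin_of_mem_nhds (h.isOpen.mem_nhds h.mem)]
    with y hy hyV
  exact (hν y hy).eq_of_defining hΩ hy (h.of_mem hyV)

/-- Near a boundary point, `Ω` is the hypograph of a function with small Lipschitz constant over the
tangent hyperplane, and the normal varies little. -/
theorem exists_local_hypograph (hΩ : IsOpen Ω) (hC : HasC2Boundary Ω) {ν : Space n → Space n}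
    (hν : ∀ y ∈ frontier Ω, IsOuterUnitNormal Ω y (ν y)) (hp : p ∈ frontier Ω) {η : NNReal}
    (hη : 0 < η) :
    ∃ (u : Space n) (g : hyperplane u → ℝ) (W : Set (Space n)), ‖u‖ = 1 ∧ LipschitzWith η g ∧
      IsOpen W ∧ p ∈ W ∧ (∀ y ∈ W, y ∈ Ω ↔ graphHeight u g y < 0) ∧
      (∀ y ∈ W, y ∈ frontier Ω ↔ graphHeight u g y = 0) ∧
      ∀ y ∈ W, y ∈ frontier Ω → ‖ν y - u‖ ≤ η := by
  obtain ⟨V, ρ, h⟩ := hC p hp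
  have hρp := h.eq_zero_of_mem_frontier hΩ h.mem hp
  set D := gradient ρ p with hD
  set a := ‖D‖ with ha
  have hapos : 0 < a := norm_pos_iff.2 (h.gradient_ne_zero p h.mem)
  set u := a⁻¹ • D with hu
  have hDu : D = a • u := by rw [hu, smul_smul, mul_inv_cancel₀ hapos.ne', one_smul]
  have hun : ‖u‖ = 1 := by
    rw [hu, norm_smul, norm_inv, Real.norm_of_nonneg hapos.le, inv_mul_cancel₀ hapos.ne']
  have hηr : (0 : ℝ) < η := hη
  -- The bound `1 / 4` serves the sign arguments; `δ ≤ η / (1 + η)` says that `δ / (1 - δ) ≤ η`,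
  -- which will be the slope of the graph.
  set δ : ℝ := min (1 / 4) (η / (1 + η)) with hδ
  have hδ0 : 0 < δ := lt_min (by norm_num) (by positivity)
  have hδ1 : δ ≤ 1 / 4 := min_le_left _ _
  have hδη : δ * (1 + η) ≤ η := by
    have : δ ≤ η / (1 + η) := min_le_right _ _
    rwa [le_div_iff₀ (by positivity)] at this
  -- a ball on which everything is controlled
  have hstrict := ((h.contDiffAt h.mem).hasStrictFDerivAt two_ne_zero).isLittleO.def
    (mul_pos hδ0 hapos)
  obtain ⟨r₁, hr₁, hball₁⟩ := Metric.eventually_nhds_iff.1 hstrict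
  obtain ⟨r₂, hr₂, hball₂⟩ := Metric.isOpen_iff.1 h.isOpen p h.mem
  obtain ⟨r₃, hr₃, hball₃⟩ := Metric.continuousAt_iff.1 (h.continuousAt_normal h.mem) η hηr
  set r := min r₁ (min r₂ r₃) with hr
  have hr0 : 0 < r := lt_min hr₁ (lt_min hr₂ hr₃)
  have hV : ∀ y, dist y p < r → y ∈ V := fun y hy =>
    hball₂ (hy.trans_le ((min_le_right _ _).trans (min_le_left _ _)))
  set π := hyperplaneProj u with hπ
  have hnorm : ∀ y z : Space n, ‖y - z‖ ≤ |inner ℝ u y - inner ℝ u z| + ‖π y - π z‖ := by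
    intro y z
    have h1 := hyperplaneProj_add_inner_smul hun (y - z)
    calc ‖y - z‖ = ‖(hyperplaneProj u (y - z) : Space n) + (inner ℝ u (y - z) : ℝ) • u‖ := by rw [h1]
      _ ≤ ‖(hyperplaneProj u (y - z) : Space n)‖ + ‖(inner ℝ u (y - z) : ℝ) • u‖ := norm_add_le _ _
      _ = _ := by
        rw [norm_smul, hun, mul_one, Real.norm_eq_abs, inner_sub_right, ← Submodule.coe_norm,
          map_sub, add_comm]
  -- Strict differentiability at `p` compares `ρ` with its linear part `a ⟨u, ·⟩` while both points
  -- vary.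
  have hkey : ∀ y z : Space n, dist y p < r → dist z p < r →
      |ρ y - ρ z - a * (inner ℝ u y - inner ℝ u z)| ≤
        δ * a * (|inner ℝ u y - inner ℝ u z| + ‖π y - π z‖) := by
    intro y z hy hz
    have h1 := hball₁ (y := (y, z)) (by
      rw [Prod.dist_eq]
      exact max_lt (hy.trans_le (min_le_left _ _)) (hz.trans_le (min_le_left _ _)))
    have h2 : fderiv ℝ ρ p (y - z) = a * (inner ℝ u y - inner ℝ u z) := by
      rw [← inner_gradient, ← hD, hDu, real_inner_smul_left, inner_sub_right]
    rw [h2, Real.norm_eq_abs] at h1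
    refine h1.trans ?_
    gcongr
    exact hnorm y z
  set s := r / 2 with hs
  have hs0 : 0 < s := by positivity
  set t₀ : ℝ := inner ℝ u p with ht₀
  have hdist : ∀ y : Space n, ‖π y - π p‖ < s → |inner ℝ u y - t₀| ≤ s → dist y p < r := by
    intro y h1 h2
    rw [dist_eq_norm]
    linarith [hnorm y p]
  have hπc : ∀ (k : hyperplane u) (t : ℝ), π ((k : Space n) + t • u) = k :=
    hyperplaneProj_coe_add_smul
  have hic : ∀ (k : hyperplane u) (t : ℝ), inner ℝ u ((k : Space n) + t • u) = t :=
    inner_coe_add_smul hun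
  have hdist' : ∀ (k : hyperplane u) (t : ℝ), ‖k - π p‖ < s → |t - t₀| ≤ s →
      dist ((k : Space n) + t • u) p < r := fun k t h1 h2 =>
    hdist _ (by rwa [hπc]) (by rwa [hic])
  -- At the ends of a vertical segment the linear part is `± a s`, and the error is at most `a s /
  -- 2`; hence `ρ` changes sign.
  have hex : ∀ k : hyperplane u, ‖k - π p‖ < s →
      ∃ t, |t - t₀| < s ∧ ρ ((k : Space n) + t • u) = 0 := by
    intro k hk
    have hcont : ContinuousOn (fun t : ℝ => ρ ((k : Space n) + t • u)) (Icc (t₀ - s) (t₀ + s)) := by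
      refine h.contDiffOn.continuousOn.comp (by fun_prop) fun t ht => hV _ (hdist' k t hk ?_)
      rw [abs_le]; constructor <;> linarith [ht.1, ht.2]
    have hp0 : dist p p < r := by rw [dist_self]; exact hr0
    have hplus := hkey _ p (hdist' k (t₀ + s) hk (by rw [add_sub_cancel_left, abs_of_pos hs0])) hp0
    have hminus := hkey _ p (hdist' k (t₀ - s) hk (by
      rw [sub_sub_cancel_left, abs_neg, abs_of_pos hs0])) hp0
    rw [hic, hπc, hρp, ← ht₀, add_sub_cancel_left, abs_of_pos hs0, abs_le] at hplus
    rw [hic, hπc, hρp, ← ht₀, sub_sub_cancel_left, abs_neg, abs_of_pos hs0, abs_le] at hminus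
    have hsm : δ * a * (s + ‖k - π p‖) ≤ 1 / 4 * a * (s + s) := by gcongr
    have has : 0 < a * s := by positivity
    obtain ⟨t, ht, hzero⟩ := intermediate_value_Ioo (by linarith) hcont
      (show (0 : ℝ) ∈ Ioo _ _ from ⟨by linarith [hminus.2], by linarith [hplus.1]⟩)
    exact ⟨t, by rw [abs_lt]; constructor <;> linarith [ht.1, ht.2], hzero⟩
  choose! g₀ hg₀s hg₀ using hex
  -- At two zeros of `ρ`, `hkey` bounds the height difference by `δ` times the sum of itself and the
  -- horizontal distance; the height difference is absorbed on the left.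
  have hLip : LipschitzOnWith η g₀ {k | ‖k - π p‖ < s} := by
    refine LipschitzOnWith.of_dist_le_mul fun k hk l hl => ?_
    have h1 := hkey _ _ (hdist' k (g₀ k) hk (hg₀s k hk).le) (hdist' l (g₀ l) hl (hg₀s l hl).le)
    rw [hg₀ k hk, hg₀ l hl, hic, hic, hπc, hπc, sub_zero, zero_sub, abs_neg, abs_mul,
      abs_of_pos hapos] at h1
    rw [Real.dist_eq, dist_eq_norm]
    have h2 : |g₀ k - g₀ l| ≤ δ * (|g₀ k - g₀ l| + ‖k - l‖) := by
      refine le_of_mul_le_mul_left ?_ hapos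
      linarith
    have h3 : |g₀ k - g₀ l| * (1 - δ) ≤ η * ‖k - l‖ * (1 - δ) := by
      have h4 : δ * ‖k - l‖ ≤ η * (1 - δ) * ‖k - l‖ := by
        gcongr; linarith
      linarith
    exact le_of_mul_le_mul_right h3 (by linarith)
  -- The extension to the whole hyperplane keeps the Lipschitz constant, so the global graph chart
  -- is available.
  obtain ⟨g, hg, hgeq⟩ := hLip.extend_real
  have hgeq' : ∀ {k : hyperplane u}, ‖k - π p‖ < s → g₀ k = g k := fun hk => hgeq hk
  set W : Set (Space n) := {y | ‖π y - π p‖ < s ∧ |inner ℝ u y - t₀| < s} with hW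
  have hWo : IsOpen W := by
    have h1 : Continuous fun y : Space n => ‖π y - π p‖ := (π.continuous.sub continuous_const).norm
    have h2 : Continuous fun y : Space n => |inner ℝ u y - t₀| := by fun_prop
    exact (isOpen_lt h1 continuous_const).inter (isOpen_lt h2 continuous_const)
  -- Comparison with the zero on the same vertical line shows that `ρ` and the height above the
  -- graph have the same sign in `W`.
  have hsign : ∀ y ∈ W, |ρ y - a * graphHeight u g y| ≤ 1 / 4 * a * |graphHeight u g y| := by
    intro y hy
    have hk : ‖π y - π p‖ < s := hy.1
    have h1 := hkey y _ (hdist y hk hy.2.le) (hdist' (π y) (g₀ (π y)) hk (hg₀s _ hk).le)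
    rw [hg₀ _ hk, hic, hπc, sub_zero, sub_self, norm_zero, add_zero, hgeq' hk] at h1
    refine h1.trans ?_
    have : graphHeight u g y = inner ℝ u y - g (π y) := rfl
    rw [this]
    gcongr
  have hΩW : ∀ y ∈ W, y ∈ Ω ↔ graphHeight u g y < 0 := by
    intro y hy
    rw [h.mem_iff (hV y (hdist y hy.1 hy.2.le))]
    have h1 := abs_le.1 (hsign y hy)
    rcases le_or_gt 0 (graphHeight u g y) with h2 | h2
    · rw [abs_of_nonneg h2] at h1
      have : 0 ≤ a * graphHeight u g y := by positivity
      constructor <;> intro h3 <;> linarith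
    · rw [abs_of_neg h2] at h1
      have : a * graphHeight u g y < 0 := mul_neg_of_pos_of_neg hapos h2
      constructor <;> intro h3 <;> linarith
  refine ⟨u, g, W, hun, hg, hWo, ⟨by simpa using hs0, by simpa [ht₀] using hs0⟩, hΩW, ?_, ?_⟩
  · intro y hy
    constructor
    · intro hyf
      have h1 := hsign y hy
      rw [h.eq_zero_of_mem_frontier hΩ (hV y (hdist y hy.1 hy.2.le)) hyf, zero_sub, abs_neg,
        abs_mul, abs_of_pos hapos] at h1
      by_contra hne
      have := abs_pos.2 hne
      nlinarith
    · intro h0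
      rw [hΩ.frontier_eq]
      refine ⟨?_, fun hyΩ => absurd ((hΩW y hy).1 hyΩ) (by rw [h0]; exact lt_irrefl _)⟩
      -- A point of height zero is approached from inside `Ω` by moving down along `u`.
      have hl : Tendsto (fun t : ℝ => y - t • u) (𝓝[>] 0) (𝓝 y) := by
        have h1 : Continuous fun t : ℝ => y - t • u := by fun_prop
        have := h1.tendsto 0
        rw [zero_smul, sub_zero] at this
        exact this.mono_left nhdsWithin_le_nhds
      refine mem_closure_of_tendsto hl ?_
      filter_upwards [hl.eventually (hWo.mem_nhds hy), self_mem_nhdsWithin] with t ht htpos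
      rw [hΩW _ ht]
      have h2 : hyperplaneProj u (y - t • u) = hyperplaneProj u y := by
        have := hyperplaneProj_coe_add_smul (0 : hyperplane u) t
        rw [map_sub, sub_eq_self]
        rwa [Submodule.coe_zero, zero_add] at this
      have h3 : graphHeight u g (y - t • u) = graphHeight u g y - t := by
        rw [graphHeight, h2, graphHeight, inner_sub_right, inner_smul_right,
          real_inner_self_eq_norm_sq, hun]
        ring
      rw [h3, h0, zero_sub, neg_lt_zero]
      exact htpos
  · intro y hy hyf
    have hd := hdist y hy.1 hy.2.le
    have h1 := hball₃ (hd.trans_le ((min_le_right _ _).trans (min_le_right _ _)))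
    rw [(hν y hyf).eq_of_defining hΩ hyf (h.of_mem (hV y hd)), hu, hD, ← dist_eq_norm]
    exact h1.le

end Boundary

/-! ### The divergence theorem -/

section Partition

open scoped Manifold

variable {E F : Type*} [NormedAddCommGroup E] [NormedSpace ℝ E] [FiniteDimensional ℝ E]
  [NormedAddCommGroup F] [NormedSpace ℝ F]

/-- A compactly supported `C¹` function is a sum of functions that are supported in the members of a
given open cover. -/
theorem exists_finset_sum_tsupport_subset {w : E → F} (hw : ContDiff ℝ 1 w)
    (hc : HasCompactSupport w) {W : E → Set E} (hWo : ∀ p, IsOpen (W p)) (hW : ∀ p, p ∈ W p) :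
    ∃ (t : Finset E) (v : E → E → F), (∀ i, ContDiff ℝ 1 (v i)) ∧ (∀ i, HasCompactSupport (v i)) ∧
      (∀ i, tsupport (v i) ⊆ W i) ∧ (∀ y, w y = ∑ i ∈ t, v i y) ∧
      ∀ y, ∑ i ∈ t, ‖v i y‖ = ‖w y‖ := by
  obtain ⟨θ, hθ⟩ := SmoothPartitionOfUnity.exists_isSubordinate 𝓘(ℝ, E) (isClosed_tsupport w) W hWo
    (fun p _ => mem_iUnion.2 ⟨p, hW p⟩)
  have hfin := θ.locallyFinite.finite_nonempty_inter_compact hc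
  have hsum : ∀ y ∈ tsupport w, ∑ i ∈ hfin.toFinset, θ i y = 1 := fun y hy => by
    rw [← θ.sum_eq_one hy]
    refine (finsum_eq_sum_of_support_subset _ fun i hi => ?_).symm
    rw [Finite.coe_toFinset]
    exact ⟨y, hi, hy⟩
  refine ⟨hfin.toFinset, fun i y => θ i y • w y, fun i => ?_, fun i => ?_, fun i => ?_, fun y => ?_,
    fun y => ?_⟩
  · exact ((θ i).contMDiff.contDiff.of_le (by norm_cast)).smul hw
  · exact hc.smul_left
  · have hs : Function.support (fun y => θ i y • w y) ⊆ Function.support (θ i) :=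
      fun y hy h0 => hy (by
      change θ i y • w y = 0
      rw [show θ i y = 0 from h0, zero_smul])
    exact (closure_mono hs).trans (hθ i)
  · by_cases hy : y ∈ tsupport w
    · rw [← Finset.sum_smul, hsum y hy, one_smul]
    · simp [image_eq_zero_of_notMem_tsupport hy]
  -- The weights are nonnegative, so the norms of the pieces add up without loss. This keeps the
  -- total error independent of the number of pieces.
  · by_cases hy : y ∈ tsupport w
    · simp_rw [norm_smul, Real.norm_of_nonneg (θ.nonneg _ _)]
      rw [← Finset.sum_mul, hsum y hy, one_mul]
    · simp [image_eq_zero_of_notMem_tsupport hy]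

end Partition

section Divergence

variable {n : ℕ} {Ω : Set (Space n)} {ν : Space n → Space n}
  {F : Type*} [NormedAddCommGroup F] [NormedSpace ℝ F]

theorem finrank_space_eq_succ (hn : 1 ≤ n) :
    Module.finrank ℝ (Space n) = (2 * n - 1) + 1 := by
  rw [finrank_space]; omega

theorem isCompact_frontier (hb : Bornology.IsBounded Ω) : IsCompact (frontier Ω) :=
  Metric.isCompact_of_isClosed_isBounded isClosed_frontier
    (hb.closure.subset frontier_subset_closure)

/-- A bounded `C²` boundary has finite area. -/
theorem measure_frontier_lt_top (hn : 1 ≤ n) (hΩ : IsOpen Ω) (hb : Bornology.IsBounded Ω)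
    (hC : HasC2Boundary Ω) (hν : ∀ y ∈ frontier Ω, IsOuterUnitNormal Ω y (ν y)) :
    (μHE[2 * n - 1] : Measure (Space n)) (frontier Ω) < ⊤ := by
  refine (isCompact_frontier hb).measure_lt_top_of_nhdsWithin fun p hp => ?_
  obtain ⟨u, g, W, hu, hg, hWo, hpW, -, hfr, -⟩ := exists_local_hypograph hΩ hC hν hp one_pos
  obtain ⟨r, hr, hball⟩ := Metric.nhds_basis_closedBall.mem_iff.1 (hWo.mem_nhds hpW)
  refine ⟨Metric.closedBall p r ∩ frontier Ω, inter_mem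
    (mem_nhdsWithin_of_mem_nhds (Metric.closedBall_mem_nhds p hr)) self_mem_nhdsWithin, ?_⟩
  calc (μHE[2 * n - 1] : Measure (Space n)) (Metric.closedBall p r ∩ frontier Ω)
      ≤ (μHE[2 * n - 1] : Measure (Space n)).restrict {y | graphHeight u g y = 0}
          (Metric.closedBall p r) := by
        rw [Measure.restrict_apply Metric.isClosed_closedBall.measurableSet]
        exact measure_mono fun y hy => ⟨hy.1, (hfr y (hball hy.1)).1 hy.2⟩
    _ ≤ _ := restrict_le_map_graphMap hu (finrank_space_eq_succ hn) hg _
    _ < ⊤ := by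
        rw [Measure.smul_apply]
        exact ENNReal.mul_lt_top (ENNReal.coe_lt_top)
          (map_graphMap_lt_top hg.continuous (isCompact_closedBall p r))

/-- The surface measure is infinite on nonempty open sets, so local finiteness is not available;
finiteness on the compact set takes its place. -/
theorem _root_.ContinuousOn.integrableOn_of_isCompact_of_lt_top {X G : Type*} [TopologicalSpace X]
    [MeasurableSpace X] [OpensMeasurableSpace X] [TopologicalSpace.PseudoMetrizableSpace X]
    [T2Space X] [NormedAddCommGroup G] [SecondCountableTopologyEither X G]
    {μ : Measure X} {K : Set X} (hK : IsCompact K) (hμ : μ K < ⊤)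
    {h : X → G} (hh : ContinuousOn h K) : IntegrableOn h K μ := by
  obtain ⟨C, hCb⟩ := hK.exists_bound_of_continuousOn hh
  exact IntegrableOn.of_bound hμ (hh.aestronglyMeasurable hK.measurableSet) C
    ((ae_restrict_iff' hK.measurableSet).2 (Eventually.of_forall hCb))

theorem integral_fderiv_apply_eq_zero {w : Space n → F} (hw : ContDiff ℝ 1 w)
    (hc : HasCompactSupport w) (e : Space n) : ∫ y, fderiv ℝ w y e = 0 := by
  have h0 := integral_smul_fderiv_eq_neg_fderiv_smul_of_integrable (𝕜 := ℝ)
    (μ := (volume : Measure (Space n))) (f := fun _ : Space n => (1 : ℝ)) (g := w) (v := e)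
    (by simp)
    (by
      simp only [one_smul]
      exact ((hw.continuous_fderiv one_ne_zero).clm_apply
        continuous_const).integrable_of_hasCompactSupport (hc.fderiv_apply ℝ e))
    (by simpa only [one_smul] using hw.continuous.integrable_of_hasCompactSupport hc)
    (fun x _ => differentiableAt_const _) (fun x _ => hw.differentiable one_ne_zero x)
  simpa only [one_smul, fderiv_fun_const, Pi.zero_apply, zero_apply, zero_smul, integral_zero,
    neg_zero] using h0

variable [CompleteSpace F]

/-- Every point has a neighbourhood in which the divergence theorem holds up to a small error. -/
theorem exists_nhds_norm_setIntegral_fderiv_sub_boundary_le (hn : 1 ≤ n) (hΩ : IsOpen Ω)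
    (hC : HasC2Boundary Ω) (hν : ∀ y ∈ frontier Ω, IsOuterUnitNormal Ω y (ν y)) {η : NNReal}
    (hη : 0 < η) (p : Space n) :
    ∃ W : Set (Space n), IsOpen W ∧ p ∈ W ∧ ∀ w : Space n → F, ContDiff ℝ 1 w →
      HasCompactSupport w → tsupport w ⊆ W → ∀ e : Space n,
      ‖(∫ y in Ω, fderiv ℝ w y e) -
          ∫ y in frontier Ω, (inner ℝ (ν y) e : ℝ) • w y ∂μHE[2 * n - 1]‖ ≤
        (3 * η + ((1 + η) ^ (2 * n - 1) - 1)) * ‖e‖ *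
          ∫ y in frontier Ω, ‖w y‖ ∂μHE[2 * n - 1] := by
  have hrhs : ∀ (w : Space n → F) (e : Space n), 0 ≤
      (3 * (η : ℝ) + ((1 + (η : ℝ)) ^ (2 * n - 1) - 1)) * ‖e‖ *
          ∫ y in frontier Ω, ‖w y‖ ∂μHE[2 * n - 1] := fun w e => by
    have h1 : (1 : ℝ) ≤ (1 + (η : ℝ)) ^ (2 * n - 1) :=
      one_le_pow₀ (le_add_of_nonneg_right η.coe_nonneg)
    have h2 : (0 : ℝ) ≤ (1 + (η : ℝ)) ^ (2 * n - 1) - 1 := sub_nonneg.2 h1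
    have h3 : (0 : ℝ) ≤ ∫ y in frontier Ω, ‖w y‖ ∂μHE[2 * n - 1] :=
      integral_nonneg fun _ => norm_nonneg _
    positivity
  have hzero : ∀ w : Space n → F, (∀ y ∈ frontier Ω, w y = 0) → ∀ e : Space n,
      ∫ y in frontier Ω, (inner ℝ (ν y) e : ℝ) • w y ∂μHE[2 * n - 1] = 0 := fun w h e =>
    setIntegral_eq_zero_of_forall_eq_zero fun y hy => by rw [h y hy, smul_zero]
  have hfd : ∀ (w : Space n → F) (e : Space n) y, y ∉ tsupport w → fderiv ℝ w y e = 0 :=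
    fun w e y hy => image_eq_zero_of_notMem_tsupport (f := fun y => fderiv ℝ w y e)
      fun h => hy (tsupport_fderiv_apply_subset ℝ e h)
  by_cases hpf : p ∈ frontier Ω
  · obtain ⟨u, g, W, hu, hg, hWo, hpW, hΩW, hfr, hνW⟩ := exists_local_hypograph hΩ hC hν hpf hη
    refine ⟨W, hWo, hpW, fun w hw hc hwW e => ?_⟩
    exact norm_setIntegral_fderiv_sub_boundary_le hu (finrank_space_eq_succ hn) hg hΩ hΩW hfr
      ((continuousOn_outerNormal hΩ hC hν).aestronglyMeasurable isClosed_frontier.measurableSet)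
      hνW hw hc hwW e
  by_cases hpΩ : p ∈ Ω
  · refine ⟨Ω, hΩ, hpΩ, fun w hw hc hwW e => ?_⟩
    rw [hzero w (fun y hy => image_eq_zero_of_notMem_tsupport fun h => by
      rw [hΩ.frontier_eq] at hy; exact hy.2 (hwW h)) e,
      setIntegral_eq_integral_of_forall_compl_eq_zero fun y hy => hfd w e y fun h => hy (hwW h),
      integral_fderiv_apply_eq_zero hw hc, sub_zero, norm_zero]
    exact hrhs w e
  · refine ⟨(closure Ω)ᶜ, isClosed_closure.isOpen_compl, fun h => hpf ?_, fun w hw hc hwW e => ?_⟩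
    · rw [hΩ.frontier_eq]; exact ⟨h, hpΩ⟩
    · rw [hzero w (fun y hy => image_eq_zero_of_notMem_tsupport fun h =>
        hwW h (frontier_subset_closure hy)) e,
        setIntegral_eq_zero_of_forall_eq_zero fun y hy => hfd w e y fun h =>
          hwW h (subset_closure hy), sub_zero, norm_zero]
      exact hrhs w e

/-- The divergence theorem on a bounded open set with `C²` boundary. -/
theorem setIntegral_fderiv_eq_boundary (hn : 1 ≤ n) (hΩ : IsOpen Ω) (hb : Bornology.IsBounded Ω)
    (hC : HasC2Boundary Ω) (hν : ∀ y ∈ frontier Ω, IsOuterUnitNormal Ω y (ν y))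
    {w : Space n → F} (hw : ContDiff ℝ 1 w) (hc : HasCompactSupport w) (e : Space n) :
    ∫ y in Ω, fderiv ℝ w y e =
      ∫ y in frontier Ω, (inner ℝ (ν y) e : ℝ) • w y ∂μHE[2 * n - 1] := by
  have hcp := isCompact_frontier hb
  have hfin := measure_frontier_lt_top hn hΩ hb hC hν
  have hνc := continuousOn_outerNormal hΩ hC hν
  set B : ℝ := ∫ y in frontier Ω, ‖w y‖ ∂μHE[2 * n - 1] with hB
  -- The cover and the partition depend on `η`, but the resulting error is a function of `η` times
  -- the fixed quantity `‖e‖ * B`.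
  have key : ∀ η : NNReal, 0 < η → ‖(∫ y in Ω, fderiv ℝ w y e) -
      ∫ y in frontier Ω, (inner ℝ (ν y) e : ℝ) • w y ∂μHE[2 * n - 1]‖ ≤
      (3 * η + ((1 + η) ^ (2 * n - 1) - 1)) * ‖e‖ * B := by
    intro η hη
    choose W hWo hW hest using
      exists_nhds_norm_setIntegral_fderiv_sub_boundary_le (F := F) hn hΩ hC hν hη
    obtain ⟨t, v, hv, hvc, hvW, hsum, hnorm⟩ := exists_finset_sum_tsupport_subset hw hc hWo hW
    have h1 : ∫ y in Ω, fderiv ℝ w y e = ∑ i ∈ t, ∫ y in Ω, fderiv ℝ (v i) y e := by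
      have hwd : ∀ y, fderiv ℝ w y e = ∑ i ∈ t, fderiv ℝ (v i) y e := fun y => by
        have : w = fun y => ∑ i ∈ t, v i y := funext hsum
        rw [this, fderiv_fun_sum fun i _ => (hv i).differentiable one_ne_zero y, sum_apply]
      simp_rw [hwd]
      refine integral_finsetSum _ fun i _ => ?_
      exact (((hv i).continuous_fderiv one_ne_zero).clm_apply
        continuous_const).integrable_of_hasCompactSupport ((hvc i).fderiv_apply ℝ e) |>.integrableOn
    have h2 : ∫ y in frontier Ω, (inner ℝ (ν y) e : ℝ) • w y ∂μHE[2 * n - 1] =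
        ∑ i ∈ t, ∫ y in frontier Ω, (inner ℝ (ν y) e : ℝ) • v i y ∂μHE[2 * n - 1] := by
      simp_rw [hsum, Finset.smul_sum]
      refine integral_finsetSum _ fun i _ => ?_
      exact ((hνc.inner continuousOn_const).smul
        (hv i).continuous.continuousOn).integrableOn_of_isCompact_of_lt_top hcp hfin
    have h3 : B = ∑ i ∈ t, ∫ y in frontier Ω, ‖v i y‖ ∂μHE[2 * n - 1] := by
      rw [hB]
      simp_rw [← hnorm]
      refine integral_finsetSum _ fun i _ => ?_
      exact (hv i).continuous.norm.continuousOn.integrableOn_of_isCompact_of_lt_top hcp hfin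
    rw [h1, h2, h3, ← Finset.sum_sub_distrib, Finset.mul_sum]
    exact (norm_sum_le _ _).trans
      (Finset.sum_le_sum fun i _ => hest i (v i) (hv i) (hvc i) (hvW i) e)
  have hlim : Tendsto (fun η : ℝ => (3 * η + ((1 + η) ^ (2 * n - 1) - 1)) * ‖e‖ * B)
      (𝓝[>] 0) (𝓝 0) := by
    have h1 : Continuous fun η : ℝ => (3 * η + ((1 + η) ^ (2 * n - 1) - 1)) * ‖e‖ * B := by
      fun_prop
    have h2 := h1.tendsto 0
    simp only [mul_zero, add_zero, one_pow, sub_self, zero_mul] at h2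
    exact h2.mono_left nhdsWithin_le_nhds
  refine sub_eq_zero.1 (norm_le_zero_iff.1 (ge_of_tendsto hlim ?_))
  filter_upwards [self_mem_nhdsWithin] with η hη
  have hη' : (0 : ℝ) < η := hη
  exact key ⟨η, hη'.le⟩ hη'

end Divergence

/-! ### Green's formula for continuous Sobolev functions -/

section Sobolev

open scoped Convolution

variable {n : ℕ} {F : Type*} [NormedAddCommGroup F] [NormedSpace ℝ F]

local notation "lsm" => ContinuousLinearMap.lsmul ℝ ℝ

theorem fderiv_convolution_left_apply {φ : Space n → ℝ} (hφc : HasCompactSupport φ)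
    (hφ : ContDiff ℝ 1 φ) {g : Space n → F} (hg : LocallyIntegrable g volume) (x e : Space n) :
    fderiv ℝ (φ ⋆[lsm, volume] g) x e = ∫ t, fderiv ℝ φ (x - t) e • g t := by
  rw [(hφc.hasFDerivAt_convolution_left lsm hφ hg x).fderiv]
  have hex := (hφc.fderiv ℝ).convolutionExists_left
    (ContinuousLinearMap.precompL (Space n) (lsm : ℝ →L[ℝ] F →L[ℝ] F))
    (hφ.continuous_fderiv one_ne_zero) hg x
  rw [convolution_def, ContinuousLinearMap.integral_apply hex]
  have h1 : ∀ t, (ContinuousLinearMap.precompL (Space n) (lsm : ℝ →L[ℝ] F →L[ℝ] F)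
      (fderiv ℝ φ t) (g (x - t))) e = fderiv ℝ φ t e • g (x - t) := fun t => rfl
  simp_rw [h1]
  rw [← integral_sub_left_eq_self _ volume x]
  simp_rw [sub_sub_cancel]

variable {U K : Set (Space n)} {f : Space n → F} {d : Fin 2 × Fin n → Space n → F}

/-- Mollification commutes with weak differentiation. -/
theorem fderiv_mollify (hf : IsW12 U f d) (hKU : K ⊆ U) (hK : MeasurableSet K)
    (hU : MeasurableSet U)
    (hfK : IntegrableOn f K volume) (i : Fin 2 × Fin n) (φ : ContDiffBump (0 : Space n)) {x : Space n}
    (hx : Metric.closedBall x φ.rOut ⊆ K) :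
    fderiv ℝ (φ.normed volume ⋆[lsm, volume] K.indicator f) x (EuclideanSpace.single i 1) =
      ∫ t, φ.normed volume (x - t) • K.indicator (d i) t := by
  -- The weak derivative is tested against the reflected mollifier centred at `x`. The sign from the
  -- reflection cancels the sign in the definition of the weak derivative.
  set θ : Space n → ℝ := fun t => φ.normed volume (x - t) with hθ
  have hφs : ContDiff ℝ ∞ (φ.normed (volume : Measure (Space n))) := φ.contDiff_normed
  have hθs : ContDiff ℝ ∞ θ := hφs.comp (contDiff_const.sub contDiff_id)
  have hθt : tsupport θ ⊆ Metric.closedBall x φ.rOut := by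
    refine closure_minimal (fun t ht => ?_) Metric.isClosed_closedBall
    have h1 : x - t ∈ Function.support (φ.normed (volume : Measure (Space n))) := ht
    rw [φ.support_normed_eq, mem_ball_zero_iff] at h1
    rw [Metric.mem_closedBall, dist_comm, dist_eq_norm]
    exact h1.le
  have hθc : HasCompactSupport θ :=
    (isCompact_closedBall x φ.rOut).of_isClosed_subset (isClosed_tsupport _) hθt
  have hpd : ∀ t, partialDeriv i θ t =
      -fderiv ℝ (φ.normed volume) (x - t) (EuclideanSpace.single i 1) := fun t => by
    have h1 : HasFDerivAt (φ.normed (volume : Measure (Space n)))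
        (fderiv ℝ (φ.normed volume) (x - t)) (x - t) :=
      (hφs.differentiable (by simp) _).hasFDerivAt
    have h2 : HasFDerivAt (fun t : Space n => x - t)
        (-ContinuousLinearMap.id ℝ (Space n)) t := (hasFDerivAt_id t).const_sub x
    have h3 : HasFDerivAt θ ((fderiv ℝ (φ.normed volume) (x - t)).comp
      (-ContinuousLinearMap.id ℝ (Space n))) t := h1.comp t h2
    rw [partialDeriv, h3.fderiv]
    simp
  have h0 : ∀ t, t ∉ K → θ t = 0 := fun t ht =>
    image_eq_zero_of_notMem_tsupport fun h => ht (hx (hθt h))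
  have hd0 : ∀ t, t ∉ K → partialDeriv i θ t = 0 := fun t ht =>
    image_eq_zero_of_notMem_tsupport (f := fun t => partialDeriv i θ t)
      fun h => ht (hx (hθt (tsupport_fderiv_apply_subset ℝ _ h)))
  rw [fderiv_convolution_left_apply φ.hasCompactSupport_normed φ.contDiff_normed
    ((integrable_indicator_iff hK).2 hfK).locallyIntegrable]
  have hw := hf.weak_deriv i θ hθs hθc (hθt.trans (hx.trans hKU))
  have e1 : ∫ t in U, partialDeriv i θ t • f t = ∫ t, partialDeriv i θ t • K.indicator f t := by
    rw [← integral_indicator hU]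
    refine integral_congr_ae (Eventually.of_forall fun t => ?_)
    by_cases ht : t ∈ K
    · simp [ht, hKU ht]
    · by_cases htU : t ∈ U <;> simp [htU, hd0 t ht]
  have e2 : ∫ t in U, θ t • d i t = ∫ t, θ t • K.indicator (d i) t := by
    rw [← integral_indicator hU]
    refine integral_congr_ae (Eventually.of_forall fun t => ?_)
    by_cases ht : t ∈ K
    · simp [ht, hKU ht]
    · by_cases htU : t ∈ U <;> simp [htU, h0 t ht]
  rw [e1, e2] at hw
  simp_rw [hpd, neg_smul] at hw
  rw [integral_neg, neg_inj] at hw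
  exact hw

/-- A mollifier can be moved to the other factor. -/
theorem integral_smul_mollify [CompleteSpace F] {k : Space n → ℝ} (hkm : AEStronglyMeasurable k volume) {M : ℝ}
    (hM : ∀ x, ‖k x‖ ≤ M) {D : Space n → F} (hD : Integrable D volume)
    (φ : ContDiffBump (0 : Space n)) :
    ∫ x, k x • ∫ t, φ.normed volume (x - t) • D t =
      ∫ t, (φ.normed volume ⋆[lsm, volume] k) t • D t := by
  have h1 : Integrable (fun p : Space n × Space n =>
      k p.1 • (φ.normed volume (p.1 - p.2) • D p.2)) (volume.prod volume) := by
    have h2 : Integrable (fun p : Space n × Space n => φ.normed volume (p.1 - p.2) • D p.2)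
        (volume.prod volume) :=
      hD.convolution_integrand (ContinuousLinearMap.lsmul ℝ ℝ).flip φ.integrable_normed
    exact h2.bdd_smul M hkm.comp_fst (Eventually.of_forall fun p => hM _)
  simp_rw [← integral_smul]
  rw [integral_integral_swap h1]
  refine integral_congr_ae (Eventually.of_forall fun t => ?_)
  change ∫ x, k x • (φ.normed volume (x - t) • D t) = _
  simp_rw [smul_smul]
  rw [integral_smul_const, convolution_lsmul_swap]
  congr 1
  refine integral_congr_ae (Eventually.of_forall fun x => ?_)
  change k x * _ = _ • k x
  rw [smul_eq_mul, mul_comm, ← φ.normed_neg, neg_sub]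

/-- Bump functions that shrink to the origin. -/
noncomputable def shrinkingBump (n : ℕ) (R : ℝ) (hR : 0 < R) (j : ℕ) : ContDiffBump (0 : Space n) :=
  ⟨R / (j + 1) / 2, R / (j + 1), by positivity, half_lt_self (by positivity)⟩

theorem tendsto_shrinkingBump_rOut (R : ℝ) (hR : 0 < R) :
    Tendsto (fun j => (shrinkingBump n R hR j).rOut) atTop (𝓝 0) := by
  have h : Tendsto (fun j : ℕ => R * (1 / ((j : ℝ) + 1))) atTop (𝓝 (R * 0)) :=
    tendsto_one_div_add_atTop_nhds_zero_nat.const_mul R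
  rw [mul_zero] at h
  refine h.congr fun j => ?_
  rw [mul_one_div]
  rfl

theorem shrinkingBump_rOut_le (R : ℝ) (hR : 0 < R) (j : ℕ) :
    (shrinkingBump n R hR j).rOut ≤ R :=
  div_le_self hR.le (by linarith [(Nat.cast_nonneg j : (0 : ℝ) ≤ j)])

variable {Ω : Set (Space n)} {ν : Space n → Space n} [CompleteSpace F]

/-- Green's formula for a continuous function of class `W^{1,2}`. -/
theorem setIntegral_smul_weakDeriv_add (hn : 1 ≤ n) (hΩ : IsOpen Ω) (hb : Bornology.IsBounded Ω)
    (hC : HasC2Boundary Ω) (hν : ∀ y ∈ frontier Ω, IsOuterUnitNormal Ω y (ν y))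
    (hU : IsOpen U) (hΩU : closure Ω ⊆ U) (hfc : ContinuousOn f U) (hf : IsW12 U f d)
    {k : Space n → ℝ} (hk : ContDiff ℝ 1 k) (i : Fin 2 × Fin n) :
    (∫ y in Ω, k y • d i y) + ∫ y in Ω, partialDeriv i k y • f y =
      ∫ y in frontier Ω, ν y i • k y • f y ∂μHE[2 * n - 1] := by
  have hcl : IsCompact (closure Ω) := hb.isCompact_closure
  -- A compact collar of `closure Ω` inside `U`: there `f` is bounded and the weak derivatives are
  -- integrable, and it contains all mollification balls about points of `closure Ω`.
  obtain ⟨R, hR, hRU⟩ := hcl.exists_cthickening_subset_open hU hΩU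
  set K := Metric.cthickening R (closure Ω) with hKdef
  have hKc : IsCompact K := hcl.cthickening
  have hKm : MeasurableSet K := hKc.measurableSet
  have hΩK : closure Ω ⊆ K := Metric.self_subset_cthickening _
  have hfK : ContinuousOn f K := hfc.mono hRU
  obtain ⟨M, hM⟩ := hKc.exists_bound_of_continuousOn hfK
  have hfKi : IntegrableOn f K volume := hfK.integrableOn_compact hKc
  set G := K.indicator f with hG
  have hGi : Integrable G volume := (integrable_indicator_iff hKm).2 hfKi
  set D := K.indicator (d i) with hDdef
  have hdK : IntegrableOn (d i) K volume := by
    have h1 : MemLp (d i) 2 (volume.restrict K) :=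
      (hf.memLp_deriv i).mono_measure (Measure.restrict_mono hRU le_rfl)
    have : IsFiniteMeasure ((volume : Measure (Space n)).restrict K) :=
      ⟨by rw [Measure.restrict_apply_univ]; exact hKc.measure_lt_top⟩
    exact h1.integrable one_le_two
  have hDi : Integrable D volume := (integrable_indicator_iff hKm).2 hdK
  set φ := shrinkingBump n R hR with hφ
  set w : ℕ → Space n → F := fun j => (φ j).normed volume ⋆[lsm, volume] G with hw
  have hws : ∀ j, ContDiff ℝ 1 (w j) := fun j =>
    (φ j).hasCompactSupport_normed.contDiff_convolution_left (n := 1) lsm (φ j).contDiff_normed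
      hGi.locallyIntegrable
  have hGc : HasCompactSupport G := HasCompactSupport.intro hKc fun x hx => indicator_of_notMem hx _
  have hwc : ∀ j, HasCompactSupport (w j) := fun j =>
    (φ j).hasCompactSupport_normed.convolution lsm hGc
  have hballK : ∀ x ∈ closure Ω, ∀ j, Metric.closedBall x (φ j).rOut ⊆ K := fun x hx j =>
    (Metric.closedBall_subset_closedBall (shrinkingBump_rOut_le R hR j)).trans
      (Metric.closedBall_subset_cthickening hx R)
  -- the mollified functions converge
  have hwlim : ∀ x ∈ closure Ω, Tendsto (fun j => w j x) atTop (𝓝 (f x)) := by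
    intro x hx
    have hGx : G x = f x := indicator_of_mem (hΩK hx) f
    rw [← hGx]
    refine Metric.tendsto_nhds.2 fun ε hε => ?_
    have hcx := Metric.continuousWithinAt_iff.1 (hfK x (hΩK hx)) (ε / 2) (half_pos hε)
    obtain ⟨δ, hδ, hδf⟩ := hcx
    filter_upwards [(tendsto_shrinkingBump_rOut R hR).eventually_lt_const hδ] with j hj
    refine lt_of_le_of_lt ((φ j).dist_normed_convolution_le hGi.aestronglyMeasurable
      (ε := ε / 2) fun y hy => ?_) (half_lt_self hε)
    have hyK : y ∈ K := hballK x hx j (Metric.ball_subset_closedBall hy)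
    rw [hGx, show G y = f y from indicator_of_mem hyK f]
    exact (hδf hyK ((Metric.mem_ball.1 hy).trans hj)).le
  have hGM : ∀ x, ‖G x‖ ≤ max M 0 := fun x => by
    by_cases hx : x ∈ K
    · rw [show G x = f x from indicator_of_mem hx f]; exact (hM x hx).trans (le_max_left _ _)
    · rw [show G x = 0 from indicator_of_notMem hx f, norm_zero]; exact le_max_right _ _
  set M' := max M 0 with hM'
  have hwM : ∀ j x, ‖w j x‖ ≤ 3 * M' := fun j x => by
    have h1 := (φ j).dist_normed_convolution_le (μ := volume) (x₀ := x) (ε := 2 * M')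
      hGi.aestronglyMeasurable fun y _ => by
        rw [dist_eq_norm]
        linarith [norm_sub_le (G y) (G x), hGM x, hGM y]
    rw [dist_eq_norm] at h1
    have h2 := norm_sub_norm_le (w j x) (G x)
    have h3 : ‖w j x - G x‖ ≤ 2 * M' := h1
    linarith [hGM x]
  -- bounds for `k`
  obtain ⟨Mk, hMk⟩ := hcl.exists_bound_of_continuousOn hk.continuous.continuousOn
  have hkd : Continuous (partialDeriv i k) :=
    (hk.continuous_fderiv one_ne_zero).clm_apply continuous_const
  obtain ⟨Mk', hMk'⟩ := hcl.exists_bound_of_continuousOn hkd.continuousOn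
  have hΩfin : volume Ω < ⊤ := (measure_mono subset_closure).trans_lt hcl.measure_lt_top
  have hΩfinm : IsFiniteMeasure ((volume : Measure (Space n)).restrict Ω) :=
    ⟨by rw [Measure.restrict_apply_univ]; exact hΩfin⟩
  have hfrfin := measure_frontier_lt_top hn hΩ hb hC hν
  have hfrfinm : IsFiniteMeasure ((μHE[2 * n - 1] : Measure (Space n)).restrict (frontier Ω)) :=
    ⟨by rw [Measure.restrict_apply_univ]; exact hfrfin⟩
  have hνc := continuousOn_outerNormal hΩ hC hν
  -- the divergence theorem for the mollified functions
  have hgreen : ∀ j, (∫ y in Ω, k y • partialDeriv i (w j) y) +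
      ∫ y in Ω, partialDeriv i k y • w j y =
        ∫ y in frontier Ω, ν y i • k y • w j y ∂μHE[2 * n - 1] := by
    intro j
    have h1 := setIntegral_fderiv_eq_boundary hn hΩ hb hC hν (hk.smul (hws j))
      (hwc j).smul_left (EuclideanSpace.single i 1)
    have h2 : ∀ y, fderiv ℝ (fun y => k y • w j y) y (EuclideanSpace.single i 1) =
        k y • partialDeriv i (w j) y + partialDeriv i k y • w j y := fun y => by
      rw [((hk.differentiable one_ne_zero y).hasFDerivAt.fun_smul
        ((hws j).differentiable one_ne_zero y).hasFDerivAt).fderiv]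
      rfl
    have h3 : Continuous (partialDeriv i (w j)) :=
      ((hws j).continuous_fderiv one_ne_zero).clm_apply continuous_const
    rw [← integral_add]
    · refine Eq.trans ?_ (h1.trans ?_)
      · exact integral_congr_ae (Eventually.of_forall fun y => (h2 y).symm)
      · refine integral_congr_ae (Eventually.of_forall fun y => ?_)
        change (inner ℝ (ν y) (EuclideanSpace.single i 1) : ℝ) • k y • w j y = _
        rw [EuclideanSpace.inner_single_right]
        simp
    · exact ((hk.continuous.smul h3).continuousOn.integrableOn_compact hcl).mono_set subset_closure
    · exact ((hkd.smul (hws j).continuous).continuousOn.integrableOn_compact hcl).mono_set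
        subset_closure
  -- passage to the limit, term by term
  have hl2 : Tendsto (fun j => ∫ y in Ω, partialDeriv i k y • w j y) atTop
      (𝓝 (∫ y in Ω, partialDeriv i k y • f y)) := by
    refine tendsto_integral_of_dominated_convergence (fun _ => Mk' * (3 * M')) (fun j => ?_)
      (integrable_const _) (fun j => ?_) ?_
    · exact (hkd.smul (hws j).continuous).aestronglyMeasurable
    · refine (ae_restrict_iff' hΩ.measurableSet).2 (Eventually.of_forall fun y hy => ?_)
      rw [norm_smul]
      exact mul_le_mul (hMk' y (subset_closure hy)) (hwM j y) (norm_nonneg _)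
        ((norm_nonneg _).trans (hMk' y (subset_closure hy)))
    · refine (ae_restrict_iff' hΩ.measurableSet).2 (Eventually.of_forall fun y hy => ?_)
      exact (hwlim y (subset_closure hy)).const_smul _
  have hl3 : Tendsto (fun j => ∫ y in frontier Ω, ν y i • k y • w j y ∂μHE[2 * n - 1]) atTop
      (𝓝 (∫ y in frontier Ω, ν y i • k y • f y ∂μHE[2 * n - 1])) := by
    have hνi : ContinuousOn (fun y => ν y i) (frontier Ω) :=
      (EuclideanSpace.proj (𝕜 := ℝ) i).continuous.comp_continuousOn hνc
    obtain ⟨Mν, hMν⟩ := (isCompact_frontier hb).exists_bound_of_continuousOn hνi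
    refine tendsto_integral_of_dominated_convergence (fun _ => Mν * (Mk * (3 * M'))) (fun j => ?_)
      (integrable_const _) (fun j => ?_) ?_
    · exact (hνi.smul (hk.continuous.smul (hws j).continuous).continuousOn).aestronglyMeasurable
        isClosed_frontier.measurableSet
    · refine (ae_restrict_iff' isClosed_frontier.measurableSet).2
        (Eventually.of_forall fun y hy => ?_)
      have hyc := frontier_subset_closure hy
      rw [norm_smul, norm_smul]
      exact mul_le_mul (hMν y hy) (mul_le_mul (hMk y hyc) (hwM j y) (norm_nonneg _)
        ((norm_nonneg _).trans (hMk y hyc))) (by positivity) ((norm_nonneg _).trans (hMν y hy))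
    · refine (ae_restrict_iff' isClosed_frontier.measurableSet).2
        (Eventually.of_forall fun y hy => ?_)
      exact ((hwlim y (frontier_subset_closure hy)).const_smul _).const_smul _
  -- The derivatives of the mollified functions need not converge pointwise. The mollifier is moved
  -- to the bounded function `κ`, whose mollifications converge almost everywhere by Lebesgue
  -- differentiation and are dominated against the integrable `D`.
  have hl1 : Tendsto (fun j => ∫ y in Ω, k y • partialDeriv i (w j) y) atTop
      (𝓝 (∫ y in Ω, k y • d i y)) := by
    set κ := Ω.indicator k with hκ
    have hκm : AEStronglyMeasurable κ volume :=
      hk.continuous.aestronglyMeasurable.indicator hΩ.measurableSet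
    have hκb : ∀ x, ‖κ x‖ ≤ max Mk 0 := fun x => by
      by_cases hx : x ∈ Ω
      · rw [show κ x = k x from indicator_of_mem hx k]
        exact (hMk x (subset_closure hx)).trans (le_max_left _ _)
      · rw [show κ x = 0 from indicator_of_notMem hx k, norm_zero]; exact le_max_right _ _
    have hκi : Integrable κ volume := (integrable_indicator_iff hΩ.measurableSet).2
      ((hk.continuous.continuousOn.integrableOn_compact hcl).mono_set subset_closure)
    have e1 : ∀ j, ∫ y in Ω, k y • partialDeriv i (w j) y =
        ∫ t, ((φ j).normed volume ⋆[lsm, volume] κ) t • D t := fun j => by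
      rw [← integral_smul_mollify hκm hκb hDi (φ j), ← integral_indicator hΩ.measurableSet]
      refine integral_congr_ae (Eventually.of_forall fun y => ?_)
      by_cases hy : y ∈ Ω
      · simp only [indicator_of_mem hy, hκ]
        congr 1
        exact fderiv_mollify hf hRU hKm hU.measurableSet hfKi i (φ j)
          (hballK y (subset_closure hy) j)
      · simp [hκ, hy]
    have e2 : ∫ y in Ω, k y • d i y = ∫ t, κ t • D t := by
      rw [← integral_indicator hΩ.measurableSet]
      refine integral_congr_ae (Eventually.of_forall fun y => ?_)
      by_cases hy : y ∈ Ω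
      · simp [hκ, hDdef, hy, hΩK (subset_closure hy)]
      · simp [hκ, hy]
    simp_rw [e1]
    rw [e2]
    have hcontκ : ∀ j, Continuous ((φ j).normed volume ⋆[lsm, volume] κ) := fun j =>
      ((φ j).hasCompactSupport_normed.contDiff_convolution_left (n := 1) lsm (φ j).contDiff_normed
        hκi.locallyIntegrable).continuous
    refine tendsto_integral_of_dominated_convergence (fun t => 3 * max Mk 0 * ‖D t‖) (fun j => ?_)
      (hDi.norm.const_mul _) (fun j => Eventually.of_forall fun t => ?_) ?_
    · exact (hcontκ j).aestronglyMeasurable.smul hDi.aestronglyMeasurable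
    · rw [norm_smul]
      refine mul_le_mul_of_nonneg_right ?_ (norm_nonneg _)
      have h1 := (φ j).dist_normed_convolution_le (μ := volume) (x₀ := t) (ε := 2 * max Mk 0)
        hκm fun y _ => by
          rw [dist_eq_norm]
          linarith [norm_sub_le (κ y) (κ t), hκb t, hκb y]
      rw [dist_eq_norm] at h1
      have h2 := norm_sub_norm_le (((φ j).normed volume ⋆[lsm, volume] κ) t) (κ t)
      linarith [hκb t]
    -- The factor `2` is the fixed ratio between the outer and inner radii of the bumps.
    · have h1 := ContDiffBump.ae_convolution_tendsto_right_of_locallyIntegrable (K := 2)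
        (tendsto_shrinkingBump_rOut (n := n) R hR)
        (Eventually.of_forall fun j => (by
          change R / (j + 1) ≤ 2 * (R / (j + 1) / 2)
          linarith)) hκi.locallyIntegrable
      filter_upwards [h1] with t ht
      exact ht.smul_const _
  exact tendsto_nhds_unique (hl1.add hl2) (hl3.congr fun j => (hgreen j).symm)

end Sobolev

/-! ### The representation formula -/

section Representation

variable {n : ℕ}

/-- `γ_j γ_l`, as a real linear operator on `𝕊⁺`. -/
noncomputable def gammaGamma (j l : Fin n) : SpinorPlus n →L[ℝ] SpinorPlus n :=
  (LinearMap.toContinuousLinearMap (gammaMinus n j ∘ₗ gammaPlus n l)).restrictScalars ℝ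

theorem gammaGamma_apply (j l : Fin n) (v : SpinorPlus n) :
    gammaGamma j l v = gammaMinus n j (gammaPlus n l v) := rfl

/-- `∑_A (∑_j γ_j z_{Aj}) (∑_l γ_l d_{Al})`. -/
noncomputable def cliffordSymbol (z : Space n) (d : Fin 2 × Fin n → SpinorPlus n) : SpinorPlus n :=
  ∑ A, ∑ j, ∑ l, z (A, j) • gammaGamma j l (d (A, l))

theorem cliffordMul_diracSymbol (z : Space n) (d : Fin 2 × Fin n → SpinorPlus n) :
    cliffordMul (diracSymbol d) z = cliffordSymbol z d := by
  rw [cliffordMul_apply, cliffordSymbol]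
  refine Finset.sum_congr rfl fun A _ => Finset.sum_congr rfl fun j _ => ?_
  rw [diracSymbol, map_sum, Finset.smul_sum]
  rfl

theorem exists_norm_cliffordSymbol_le (n : ℕ) :
    ∃ C : ℝ, 0 ≤ C ∧ ∀ (z : Space n) (d : Fin 2 × Fin n → SpinorPlus n),
      ‖cliffordSymbol z d‖ ≤ C * ‖z‖ * ∑ i, ‖d i‖ := by
  refine ⟨∑ _A : Fin 2, ∑ j, ∑ l, ‖gammaGamma (n := n) j l‖,
    Finset.sum_nonneg fun _ _ => Finset.sum_nonneg fun _ _ => Finset.sum_nonneg fun _ _ =>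
      norm_nonneg _, fun z d => ?_⟩
  simp_rw [Finset.sum_mul]
  refine norm_sum_le_of_le _ fun A _ => norm_sum_le_of_le _ fun j _ => norm_sum_le_of_le _
    fun l _ => ?_
  rw [norm_smul, mul_comm ‖gammaGamma j l‖ ‖z‖, mul_assoc]
  refine mul_le_mul (PiLp.norm_apply_le z (A, j)) ?_ (norm_nonneg _) (norm_nonneg _)
  refine ((gammaGamma j l).le_opNorm _).trans (mul_le_mul_of_nonneg_left ?_ (norm_nonneg _))
  exact Finset.single_le_sum (f := fun i => ‖d i‖) (fun i _ => norm_nonneg _) (Finset.mem_univ _)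

theorem kernelH_diracSymbol (hn : 3 ≤ n) {z : Space n} (hz : z ≠ 0)
    (d : Fin 2 × Fin n → SpinorPlus n) :
    kernelH n z (diracSymbol d) =
      (-(sphereArea n)⁻¹) • ((‖z‖ ^ (2 * n))⁻¹ • cliffordSymbol z d) := by
  rw [kernelH_eq_cliffordMul hn hz, cliffordMul_diracSymbol, ← biharmonicConst_mul hn]
  congr 1
  ring

theorem volumeIntegrand_eq (hn : 3 ≤ n) (d : Fin 2 × Fin n → Space n → SpinorPlus n)
    {x y : Space n} (hxy : y ≠ x) :
    volumeIntegrand d x y = (-(sphereArea n)⁻¹) •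
      ((‖x - y‖ ^ (2 * n))⁻¹ • cliffordSymbol (x - y) (fun i => d i y)) :=
  kernelH_diracSymbol hn (sub_ne_zero.2 hxy.symm) _

/-- The boundary term is the volume term with each partial derivative replaced by a component of the
normal times `f`, so one explicit formula serves both. -/
theorem boundaryIntegrand_eq_volumeIntegrand (ν : Space n → Space n) (f : Space n → SpinorPlus n)
    (x : Space n) : boundaryIntegrand ν f x = volumeIntegrand (fun i y => ν y i • f y) x := by
  funext y
  rw [boundaryIntegrand, volumeIntegrand]
  congr 1
  funext A
  exact Finset.sum_congr rfl fun j _ => (LinearMap.map_smul_of_tower _ _ _).symm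

theorem aestronglyMeasurable_cliffordSymbol {μ : Measure (Space n)} {z : Space n → Space n}
    (hz : AEStronglyMeasurable z μ) {d : Fin 2 × Fin n → Space n → SpinorPlus n}
    (hd : ∀ i, AEStronglyMeasurable (d i) μ) :
    AEStronglyMeasurable (fun y => cliffordSymbol (z y) (fun i => d i y)) μ := by
  unfold cliffordSymbol
  refine Finset.aestronglyMeasurable_fun_sum _ fun A _ => Finset.aestronglyMeasurable_fun_sum _
    fun j _ => Finset.aestronglyMeasurable_fun_sum _ fun l _ => ?_
  exact ((EuclideanSpace.proj (𝕜 := ℝ) (A, j)).continuous.comp_aestronglyMeasurable hz).smul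
    ((gammaGamma j l).continuous.comp_aestronglyMeasurable (hd _))

theorem ae_ne_restrict (hn : 1 ≤ n) (x : Space n) (s : Set (Space n)) :
    ∀ᵐ y ∂(volume.restrict s), y ≠ x := by
  have : Nontrivial (Space n) := Module.nontrivial_of_finrank_pos (R := ℝ) (by
    rw [finrank_space]; omega)
  exact ae_restrict_of_ae (Measure.ae_ne volume x)

theorem aestronglyMeasurable_volumeIntegrand (hn : 3 ≤ n) {s : Set (Space n)}
    {d : Fin 2 × Fin n → Space n → SpinorPlus n}
    (hd : ∀ i, AEStronglyMeasurable (d i) (volume.restrict s)) (x : Space n) :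
    AEStronglyMeasurable (volumeIntegrand d x) (volume.restrict s) := by
  have hz : Continuous fun y : Space n => x - y := by fun_prop
  have h1 : AEStronglyMeasurable (fun y => (-(sphereArea n)⁻¹) • ((‖x - y‖ ^ (2 * n))⁻¹ •
      cliffordSymbol (x - y) (fun i => d i y))) (volume.restrict s) := by
    have hinv : AEStronglyMeasurable (fun y => (‖x - y‖ ^ (2 * n))⁻¹) (volume.restrict s) :=
      (hz.norm.pow (2 * n)).measurable.inv.aestronglyMeasurable
    exact (hinv.smul (aestronglyMeasurable_cliffordSymbol hz.aestronglyMeasurable hd)).const_smul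
      (-(sphereArea n)⁻¹)
  refine h1.congr ?_
  filter_upwards [ae_ne_restrict (by omega) x s] with y hy
  exact (volumeIntegrand_eq hn d hy).symm

/-- The singularity `|x - y|^(1-2n)` is locally integrable in dimension `2n` but not locally square
integrable. Hence `L²` derivatives do not ensure absolute convergence at every point, and a
principal value is needed. -/
theorem exists_norm_volumeIntegrand_le (hn : 3 ≤ n) :
    ∃ C : ℝ, 0 ≤ C ∧ ∀ (d : Fin 2 × Fin n → Space n → SpinorPlus n) (x y : Space n), y ≠ x →
      ‖volumeIntegrand d x y‖ ≤ C * (‖x - y‖ ^ (2 * n - 1))⁻¹ * ∑ i, ‖d i y‖ := by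
  obtain ⟨C, hC, hle⟩ := exists_norm_cliffordSymbol_le n
  have hω := sphereArea_pos n
  refine ⟨(sphereArea n)⁻¹ * C, by positivity, fun d x y hxy => ?_⟩
  have hpos : 0 < ‖x - y‖ := norm_pos_iff.2 (sub_ne_zero.2 hxy.symm)
  rw [volumeIntegrand_eq hn d hxy, norm_smul, norm_smul, norm_neg, norm_inv, norm_inv, norm_pow,
    norm_norm, Real.norm_of_nonneg hω.le]
  have h1 : (‖x - y‖ ^ (2 * n - 1))⁻¹ = (‖x - y‖ ^ (2 * n))⁻¹ * ‖x - y‖ := by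
    obtain ⟨m, hm⟩ : ∃ m, 2 * n = m + 1 := ⟨2 * n - 1, by omega⟩
    rw [hm, Nat.add_sub_cancel, pow_succ]
    field_simp
  calc (sphereArea n)⁻¹ * ((‖x - y‖ ^ (2 * n))⁻¹ * ‖cliffordSymbol (x - y) fun i => d i y‖)
      ≤ (sphereArea n)⁻¹ * ((‖x - y‖ ^ (2 * n))⁻¹ * (C * ‖x - y‖ * ∑ i, ‖d i y‖)) := by
        gcongr; exact hle _ _
    _ = _ := by rw [h1]; ring

theorem integrableOn_volumeIntegrand_diff_closedBall (hn : 3 ≤ n) {Ω : Set (Space n)}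
    (hΩ : MeasurableSet Ω) {d : Fin 2 × Fin n → Space n → SpinorPlus n}
    (hd : ∀ i, IntegrableOn (d i) Ω volume) (x : Space n) {ε : ℝ} (hε : 0 < ε) :
    IntegrableOn (volumeIntegrand d x) (Ω \ Metric.closedBall x ε) volume := by
  obtain ⟨C, hC, hle⟩ := exists_norm_volumeIntegrand_le hn
  have hd' : ∀ i, IntegrableOn (d i) (Ω \ Metric.closedBall x ε) volume := fun i =>
    (hd i).mono_set sdiff_subset
  refine Integrable.mono' (g := fun y => C * (ε ^ (2 * n - 1))⁻¹ * ∑ i, ‖d i y‖) ?_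
    (aestronglyMeasurable_volumeIntegrand hn (fun i => (hd' i).aestronglyMeasurable) x) ?_
  · exact (integrable_finsetSum _ fun i _ => (hd' i).norm).const_mul _
  · refine (ae_restrict_iff' (hΩ.diff Metric.isClosed_closedBall.measurableSet)).2
      (Eventually.of_forall fun y hy => ?_)
    have h1 : ε < ‖x - y‖ := by
      have := hy.2
      rwa [Metric.mem_closedBall, not_le, dist_comm, dist_eq_norm] at this
    refine (hle d x y fun h => ?_).trans ?_
    · rw [h, sub_self, norm_zero] at h1; exact absurd h1 (not_lt.2 hε.le)
    · have h2 : 0 ≤ ∑ i, ‖d i y‖ := Finset.sum_nonneg fun _ _ => norm_nonneg _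
      gcongr

theorem continuousOn_boundaryIntegrand (hn : 3 ≤ n) {s : Set (Space n)} {ν : Space n → Space n}
    {f : Space n → SpinorPlus n} (hν : ContinuousOn ν s) (hf : ContinuousOn f s) {x : Space n}
    (hx : x ∉ s) : ContinuousOn (boundaryIntegrand ν f x) s := by
  have hz : Continuous fun y : Space n => x - y := by fun_prop
  have hne : ∀ y ∈ s, y ≠ x := fun y hy h => hx (h ▸ hy)
  have h1 : ContinuousOn (fun y => (-(sphereArea n)⁻¹) • ((‖x - y‖ ^ (2 * n))⁻¹ •
      cliffordSymbol (x - y) (fun i => ν y i • f y))) s := by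
    have hinv : ContinuousOn (fun y => (‖x - y‖ ^ (2 * n))⁻¹) s :=
      (hz.norm.pow (2 * n)).continuousOn.inv₀ fun y hy =>
        pow_ne_zero _ (norm_ne_zero_iff.2 (sub_ne_zero.2 (hne y hy).symm))
    have hsym : ContinuousOn (fun y => cliffordSymbol (x - y) (fun i => ν y i • f y)) s := by
      unfold cliffordSymbol
      refine continuousOn_finsetSum _ fun A _ => continuousOn_finsetSum _ fun j _ =>
        continuousOn_finsetSum _ fun l _ => ?_
      exact ((EuclideanSpace.proj (𝕜 := ℝ) (A, j)).continuous.comp hz).continuousOn.smul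
        ((gammaGamma j l).continuous.comp_continuousOn
          (((EuclideanSpace.proj (𝕜 := ℝ) (A, l)).continuous.comp_continuousOn hν).smul hf))
    exact (hinv.smul hsym).const_smul (-(sphereArea n)⁻¹)
  refine h1.congr fun y hy => ?_
  rw [boundaryIntegrand_eq_volumeIntegrand, volumeIntegrand_eq hn _ (hne y hy)]

/-- The volume integral converges absolutely at almost every point. -/
theorem ae_integrableOn_volumeIntegrand (hn : 3 ≤ n) {Ω : Set (Space n)} (hΩ : MeasurableSet Ω)
    (hb : Bornology.IsBounded Ω) {d : Fin 2 × Fin n → Space n → SpinorPlus n}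
    (hd : ∀ i, IntegrableOn (d i) Ω volume) :
    ∀ᵐ x ∂(volume.restrict Ω), IntegrableOn (volumeIntegrand d x) Ω volume := by
  obtain ⟨C, hC, hle⟩ := exists_norm_volumeIntegrand_le hn
  obtain ⟨R, hR⟩ := Metric.isBounded_iff.1 hb
  -- Differences of points of `Ω` lie in this ball, so cutting the kernel off outside it changes
  -- nothing and leaves an integrable function to convolve with.
  set κ : Space n → ℝ := (Metric.ball (0 : Space n) (R + 1)).indicator
    (fun z => (‖z‖ ^ (2 * n - 1))⁻¹) with hκ
  have hκi : Integrable κ volume := by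
    rw [hκ, integrable_indicator_iff Metric.isOpen_ball.measurableSet]
    refine integrableOn_ball_of_norm_le_rpow (C := 1) (α := (2 * n - 1 : ℕ)) ?_ ?_ ?_ ?_
    · rw [finrank_space]; omega
    · rw [finrank_space]; exact_mod_cast (by omega : 2 * n - 1 < 2 * n)
    · refine Eventually.of_forall fun z => ?_
      rw [norm_inv, norm_pow, norm_norm, one_mul, Real.rpow_neg (norm_nonneg _), Real.rpow_natCast]
    · exact (continuous_norm.pow _).measurable.inv.aestronglyMeasurable
  set g : Space n → ℝ := Ω.indicator (fun y => ∑ i, ‖d i y‖) with hg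
  have hgi : Integrable g volume := (integrable_indicator_iff hΩ).2
    (integrable_finsetSum _ fun i _ => (hd i).norm)
  have hex := hgi.ae_convolution_exists (ContinuousLinearMap.mul ℝ ℝ) hκi
  refine (ae_restrict_iff' hΩ).2 ?_
  filter_upwards [hex] with x hx hxΩ
  have h1 : Integrable (fun y => g y * κ (x - y)) volume := hx
  refine Integrable.mono' (h1.const_mul C).integrableOn
    (aestronglyMeasurable_volumeIntegrand hn (fun i => (hd i).aestronglyMeasurable) x) ?_
  filter_upwards [ae_ne_restrict (by omega) x Ω, ae_restrict_mem hΩ] with y hyx hy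
  refine (hle d x y hyx).trans_eq ?_
  have h2 : x - y ∈ Metric.ball (0 : Space n) (R + 1) := by
    rw [mem_ball_zero_iff, ← dist_eq_norm]
    linarith [hR hxΩ hy]
  rw [hg, hκ, indicator_of_mem hy, indicator_of_mem h2]
  ring

/-- Green's formula for the operator with symbol `Ψ(|x-y|²) ∑_A (∑_j γ_j (x-y)_{Aj}) γ_A`. -/
theorem setIntegral_smul_cliffordSymbol_add (hn : 1 ≤ n) {Ω U : Set (Space n)} (hΩ : IsOpen Ω)
    (hb : Bornology.IsBounded Ω) (hC : HasC2Boundary Ω) {ν : Space n → Space n}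
    (hν : ∀ y ∈ frontier Ω, IsOuterUnitNormal Ω y (ν y)) (hU : IsOpen U) (hΩU : closure Ω ⊆ U)
    {f : Space n → SpinorPlus n} {d : Fin 2 × Fin n → Space n → SpinorPlus n}
    (hfc : ContinuousOn f U) (hf : IsW12 U f d) (hd : ∀ i, IntegrableOn (d i) Ω volume)
    {Ψ Ψ' : ℝ → ℝ} (hΨ : ContDiff ℝ 1 Ψ) (hΨ' : ∀ s, HasDerivAt Ψ (Ψ' s) s) (x : Space n) :
    (∫ y in Ω, Ψ (‖x - y‖ ^ 2) • cliffordSymbol (x - y) (fun i => d i y)) +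
      ∫ y in Ω, (2 * n * Ψ (‖x - y‖ ^ 2) + 2 * ‖x - y‖ ^ 2 * Ψ' (‖x - y‖ ^ 2)) • f y =
      ∫ y in frontier Ω, Ψ (‖x - y‖ ^ 2) • cliffordSymbol (x - y) (fun i => ν y i • f y)
        ∂μHE[2 * n - 1] := by
  have hcl : IsCompact (closure Ω) := hb.isCompact_closure
  set k : Fin 2 × Fin n → Space n → ℝ := fun i y => Ψ (‖x - y‖ ^ 2) * (x - y) i with hkdef
  have hz : ContDiff ℝ 1 fun y : Space n => x - y := contDiff_const.sub contDiff_id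
  have hk : ∀ i, ContDiff ℝ 1 (k i) := fun i =>
    (hΨ.comp ((contDiff_norm_sq ℝ).comp hz)).mul
      ((EuclideanSpace.proj (𝕜 := ℝ) i).contDiff.comp hz)
  have hkd : ∀ A j l y, partialDeriv (A, l) (k (A, j)) y =
      -(Ψ' (‖x - y‖ ^ 2) * (2 * (x - y) (A, l)) * (x - y) (A, j) +
        Ψ (‖x - y‖ ^ 2) * if j = l then 1 else 0) := by
    intro A j l y
    set P : Space n →L[ℝ] ℝ := EuclideanSpace.proj (A, j) with hP
    have h1 := partialDeriv_comp_normSq_smul (A, l) (hΨ' (‖x - y‖ ^ 2)) P.differentiableAt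
    have h2 : DifferentiableAt ℝ (fun z : Space n => Ψ (‖z‖ ^ 2) • P z) (x - y) :=
      (hasFDerivAt_comp_normSq (hΨ' (‖x - y‖ ^ 2))).differentiableAt.fun_smul P.differentiableAt
    have h3 : HasFDerivAt (fun y : Space n => x - y) (-ContinuousLinearMap.id ℝ (Space n)) y :=
      (hasFDerivAt_id y).const_sub x
    have h4 : HasFDerivAt (k (A, j)) ((fderiv ℝ (fun z : Space n => Ψ (‖z‖ ^ 2) • P z)
        (x - y)).comp (-ContinuousLinearMap.id ℝ (Space n))) y :=
      h2.hasFDerivAt.comp y h3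
    have h5 : partialDeriv (A, l) (k (A, j)) y =
        -partialDeriv (A, l) (fun z : Space n => Ψ (‖z‖ ^ 2) • P z) (x - y) := by
      rw [partialDeriv, h4.fderiv]
      simp [partialDeriv]
    have h6 : partialDeriv (A, l) P (x - y) = if j = l then 1 else 0 := by
      rw [partialDeriv, P.fderiv, hP]
      simp
    rw [h5, h1, h6]
    rfl
  have hkc : ∀ i, Continuous (k i) := fun i => (hk i).continuous
  have hkdc : ∀ A j l, Continuous (partialDeriv (A, l) (k (A, j))) := fun A j l =>
    ((hk _).continuous_fderiv one_ne_zero).clm_apply continuous_const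
  have hfcl : ContinuousOn f (closure Ω) := hfc.mono hΩU
  have hfrfin := measure_frontier_lt_top hn hΩ hb hC hν
  have hνc := continuousOn_outerNormal hΩ hC hν
  have i1 : ∀ A j l, IntegrableOn (fun y => k (A, j) y • d (A, l) y) Ω volume := fun A j l => by
    obtain ⟨M, hM⟩ := hcl.exists_bound_of_continuousOn (hkc (A, j)).continuousOn
    refine (hd (A, l)).bdd_smul M (hkc _).aestronglyMeasurable ?_
    exact (ae_restrict_iff' hΩ.measurableSet).2
      (Eventually.of_forall fun y hy => hM y (subset_closure hy))
  have i2 : ∀ A j l, IntegrableOn (fun y => partialDeriv (A, l) (k (A, j)) y • f y) Ω volume :=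
    fun A j l => (((hkdc A j l).continuousOn.smul hfcl).integrableOn_compact hcl).mono_set
      subset_closure
  have i3 : ∀ A j l, IntegrableOn (fun y => ν y (A, l) • k (A, j) y • f y) (frontier Ω)
      μHE[2 * n - 1] := fun A j l =>
    (((EuclideanSpace.proj (𝕜 := ℝ) (A, l)).continuous.comp_continuousOn hνc).smul
      ((hkc _).continuousOn.smul (hfcl.mono frontier_subset_closure))
      ).integrableOn_of_isCompact_of_lt_top (isCompact_frontier hb) hfrfin
  -- The scalar Green formula for the component `k (A, j)` in the direction `(A, l)`; contraction
  -- with `γ_j γ_l` assembles the Clifford version.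
  have hgreen := fun A j l =>
    setIntegral_smul_weakDeriv_add hn hΩ hb hC hν hU hΩU hfc hf (hk (A, j)) (A, l)
  have sum_comm_integral : ∀ (μ : Measure (Space n)) (h : Fin 2 → Fin n → Fin n → Space n →
      SpinorPlus n), (∀ A j l, Integrable (h A j l) μ) →
      ∫ y, ∑ A, ∑ j, ∑ l, gammaGamma j l (h A j l y) ∂μ =
        ∑ A, ∑ j, ∑ l, gammaGamma j l (∫ y, h A j l y ∂μ) := by
    intro μ h hi
    have hi' := fun A j l => (gammaGamma j l).integrable_comp (hi A j l)
    rw [integral_finsetSum _ fun A _ => integrable_finsetSum _ fun j _ =>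
      integrable_finsetSum _ fun l _ => hi' A j l]
    refine Finset.sum_congr rfl fun A _ => ?_
    rw [integral_finsetSum _ fun j _ => integrable_finsetSum _ fun l _ => hi' A j l]
    refine Finset.sum_congr rfl fun j _ => ?_
    rw [integral_finsetSum _ fun l _ => hi' A j l]
    exact Finset.sum_congr rfl fun l _ => (gammaGamma j l).integral_comp_comm (hi A j l)
  have e1 : ∀ y, Ψ (‖x - y‖ ^ 2) • cliffordSymbol (x - y) (fun i => d i y) =
      ∑ A, ∑ j, ∑ l, gammaGamma j l (k (A, j) y • d (A, l) y) := fun y => by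
    simp_rw [cliffordSymbol, Finset.smul_sum, smul_smul, map_smul]
    rfl
  -- The derivatives of `k` are symmetric in `j` and `l`, so the contraction leaves minus their
  -- trace. Summed over `A`, this is minus the divergence in `y` of `Ψ(|x-y|²) (x - y)`, a scalar.
  have e2 : ∀ y, (2 * n * Ψ (‖x - y‖ ^ 2) + 2 * ‖x - y‖ ^ 2 * Ψ' (‖x - y‖ ^ 2)) • f y =
      ∑ A, ∑ j, ∑ l, gammaGamma j l (partialDeriv (A, l) (k (A, j)) y • f y) := fun y => by
    have h1 : ∀ A, ∑ j, ∑ l, gammaGamma j l (partialDeriv (A, l) (k (A, j)) y • f y) =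
        (∑ j, (Ψ' (‖x - y‖ ^ 2) * 2 * (x - y) (A, j) ^ 2 + Ψ (‖x - y‖ ^ 2))) • f y := fun A => by
      simp_rw [gammaGamma_apply]
      rw [sum_gammaMinus_gammaPlus_of_symm fun j l => partialDeriv (A, l) (k (A, j)) y • f y,
        Finset.sum_smul, ← Finset.sum_neg_distrib]
      · refine Finset.sum_congr rfl fun j _ => ?_
        rw [hkd, ← neg_smul, if_pos rfl]
        congr 1
        ring
      · intro j l
        rw [hkd, hkd]
        congr 2
        by_cases h : j = l
        · rw [h]
        · rw [if_neg h, if_neg (Ne.symm h)]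
          ring
    simp_rw [h1]
    rw [← Finset.sum_smul]
    congr 1
    have h2 : ‖x - y‖ ^ 2 = ∑ A, ∑ j, (x - y) (A, j) ^ 2 := by
      rw [← sum_sq_eq_normSq, Fintype.sum_prod_type]
    simp_rw [Finset.sum_add_distrib, ← Finset.mul_sum]
    rw [← h2]
    simp
    ring
  have e3 : ∀ y, Ψ (‖x - y‖ ^ 2) • cliffordSymbol (x - y) (fun i => ν y i • f y) =
      ∑ A, ∑ j, ∑ l, gammaGamma j l (ν y (A, l) • k (A, j) y • f y) := fun y => by
    simp_rw [cliffordSymbol, Finset.smul_sum, smul_smul, map_smul, smul_smul]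
    refine Finset.sum_congr rfl fun A _ => Finset.sum_congr rfl fun j _ =>
      Finset.sum_congr rfl fun l _ => ?_
    congr 1
    rw [hkdef]
    ring
  simp_rw [e1, e2, e3]
  rw [sum_comm_integral _ _ i1, sum_comm_integral _ _ i2, sum_comm_integral _ _ i3]
  simp_rw [← hgreen, map_add, Finset.sum_add_distrib]

end Representation

/-! ### Radial cut-offs of the kernel -/

section Cutoff

variable {n : ℕ} {χ : ℝ → ℝ} {a b : ℝ}

/-- The cut-off power `χ(s) s⁻ⁿ`. -/
noncomputable def cutoffPow (n : ℕ) (χ : ℝ → ℝ) (s : ℝ) : ℝ := χ s * (s ^ n)⁻¹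

theorem contDiff_cutoffPow (hχ : ContDiff ℝ 1 χ) (ha : 0 < a) (h0 : ∀ s ≤ a, χ s = 0) :
    ContDiff ℝ 1 (cutoffPow n χ) := by
  refine contDiff_iff_contDiffAt.2 fun s => ?_
  by_cases hs : s = 0
  · have h1 : cutoffPow n χ =ᶠ[𝓝 s] fun _ => 0 := by
      filter_upwards [eventually_lt_nhds (hs ▸ ha : s < a)] with t ht
      rw [cutoffPow, h0 t ht.le, zero_mul]
    exact contDiffAt_const.congr_of_eventuallyEq h1
  · exact hχ.contDiffAt.mul ((contDiffAt_id.pow n).inv (pow_ne_zero n hs))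

/-- The operator `2n + 2s d/ds` annihilates `s⁻ⁿ`, which says that `z |z|^(-2n)` is divergence free.
Only the derivative of the cut-off survives. -/
theorem cutoffPow_euler (hχ : ContDiff ℝ 1 χ) (ha : 0 < a) (h0 : ∀ s ≤ a, χ s = 0) (s : ℝ) :
    2 * n * cutoffPow n χ s + 2 * s * deriv (cutoffPow n χ) s = 2 * s * deriv χ s * (s ^ n)⁻¹ := by
  by_cases hs : s = 0
  · rw [hs, cutoffPow, h0 0 ha.le]; simp
  · have h1 : HasDerivAt (cutoffPow n χ)
        (deriv χ s * (s ^ n)⁻¹ + χ s * (-(n * s ^ (n - 1)) / (s ^ n) ^ 2)) s :=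
      (hχ.differentiable one_ne_zero s).hasDerivAt.mul
        ((hasDerivAt_pow n s).inv (pow_ne_zero n hs))
    rw [h1.deriv, cutoffPow]
    rcases Nat.eq_zero_or_pos n with rfl | hn
    · simp
    · obtain ⟨m, rfl⟩ : ∃ m, n = m + 1 := ⟨n - 1, by omega⟩
      rw [Nat.add_sub_cancel]
      field_simp
      ring

/-- The averaging kernel that the cut-off produces. -/
noncomputable def cutoffKernel (n : ℕ) (χ : ℝ → ℝ) (z : Space n) : ℝ :=
  (sphereArea n)⁻¹ * (2 * n * cutoffPow n χ (‖z‖ ^ 2) +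
    2 * ‖z‖ ^ 2 * deriv (cutoffPow n χ) (‖z‖ ^ 2))

theorem cutoffKernel_eq (hχ : ContDiff ℝ 1 χ) (ha : 0 < a) (h0 : ∀ s ≤ a, χ s = 0) (z : Space n) :
    cutoffKernel n χ z =
      (sphereArea n)⁻¹ * (2 * ‖z‖ ^ 2 * deriv χ (‖z‖ ^ 2) * ((‖z‖ ^ 2) ^ n)⁻¹) := by
  rw [cutoffKernel, cutoffPow_euler hχ ha h0]

theorem continuous_cutoffKernel (hχ : ContDiff ℝ 1 χ) (ha : 0 < a) (h0 : ∀ s ≤ a, χ s = 0) :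
    Continuous (cutoffKernel n χ) := by
  have h1 := contDiff_cutoffPow (n := n) hχ ha h0
  have h2 := h1.continuous
  have h3 := h1.continuous_deriv le_rfl
  unfold cutoffKernel
  fun_prop

theorem cutoffKernel_nonneg (hχ : ContDiff ℝ 1 χ) (ha : 0 < a) (h0 : ∀ s ≤ a, χ s = 0)
    (hm : Monotone χ) (z : Space n) : 0 ≤ cutoffKernel n χ z := by
  have h1 : 0 ≤ deriv χ (‖z‖ ^ 2) := hm.deriv_nonneg
  have h2 := sphereArea_pos n
  rw [cutoffKernel_eq hχ ha h0]
  positivity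

theorem cutoffKernel_eq_zero (hχ : ContDiff ℝ 1 χ) (ha : 0 < a) (h0 : ∀ s ≤ a, χ s = 0)
    (h1 : ∀ s, b ≤ s → χ s = 1) {z : Space n} (hz : b < ‖z‖ ^ 2) : cutoffKernel n χ z = 0 := by
  have h2 : χ =ᶠ[𝓝 (‖z‖ ^ 2)] fun _ => 1 := by
    filter_upwards [eventually_gt_nhds hz] with t ht using h1 t ht.le
  rw [cutoffKernel_eq hχ ha h0, h2.deriv_eq]
  simp

/-- In polar coordinates the integrand is `d/dr χ(r²)`, so the integral is the total rise of `χ`. -/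
theorem integral_cutoffKernel (hn : 1 ≤ n) (hχ : ContDiff ℝ 1 χ) (ha : 0 < a)
    (h0 : ∀ s ≤ a, χ s = 0) (h1 : ∀ s, b ≤ s → χ s = 1) (hm : Monotone χ) :
    ∫ z : Space n, cutoffKernel n χ z = 1 := by
  simp_rw [cutoffKernel_eq hχ ha h0]
  have hω := sphereArea_pos n
  rw [integral_const_mul, integral_radial hn fun r => 2 * r ^ 2 * deriv χ (r ^ 2) * ((r ^ 2) ^ n)⁻¹,
    ← mul_assoc, inv_mul_cancel₀ hω.ne', one_mul]
  have hd : ∀ r : ℝ, HasDerivAt (fun r => χ (r ^ 2)) (deriv χ (r ^ 2) * (2 * r)) r := fun r => by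
    have h2 : HasDerivAt (fun r : ℝ => r ^ 2) (2 * r) r := by simpa using hasDerivAt_pow 2 r
    exact (hχ.differentiable one_ne_zero (r ^ 2)).hasDerivAt.comp r h2
  have h2 : ∫ r in Ioi (0 : ℝ), r ^ (2 * n - 1) *
      (2 * r ^ 2 * deriv χ (r ^ 2) * ((r ^ 2) ^ n)⁻¹) =
      ∫ r in Ioi (0 : ℝ), deriv χ (r ^ 2) * (2 * r) := by
    refine setIntegral_congr_fun measurableSet_Ioi fun r hr => ?_
    have hr0 : r ≠ 0 := ne_of_gt hr
    obtain ⟨m, rfl⟩ : ∃ m, n = m + 1 := ⟨n - 1, by omega⟩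
    change r ^ (2 * (m + 1) - 1) * _ = _
    rw [show 2 * (m + 1) - 1 = 2 * m + 1 by omega]
    field_simp
    ring
  rw [h2, integral_Ioi_of_hasDerivAt_of_nonneg (hd 0).continuousAt.continuousWithinAt
    (fun r _ => hd r) (fun r hr => mul_nonneg hm.deriv_nonneg (by
      have : (0 : ℝ) < r := hr
      positivity)) (l := 1)]
  · rw [h0 _ (by rw [zero_pow two_ne_zero]; exact ha.le), sub_zero]
  · refine tendsto_const_nhds.congr' ?_
    filter_upwards [(tendsto_pow_atTop (α := ℝ) two_ne_zero).eventually_ge_atTop b] with r hr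
    exact (h1 _ hr).symm

end Cutoff

/-! ### Truncated representation formulas -/

section Formula

variable {n : ℕ} {Ω U : Set (Space n)} {ν : Space n → Space n} {f : Space n → SpinorPlus n}
  {d : Fin 2 × Fin n → Space n → SpinorPlus n}

/-- The smoothly truncated representation formula. -/
theorem norm_setIntegral_cutoff_sub_le (hn : 3 ≤ n) (hΩ : IsOpen Ω) (hb : Bornology.IsBounded Ω)
    (hC : HasC2Boundary Ω) (hν : ∀ y ∈ frontier Ω, IsOuterUnitNormal Ω y (ν y)) (hU : IsOpen U)
    (hΩU : closure Ω ⊆ U) (hfc : ContinuousOn f U) (hf : IsW12 U f d)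
    (hd : ∀ i, IntegrableOn (d i) Ω volume) {χ : ℝ → ℝ} {a b : ℝ} (hχ : ContDiff ℝ 1 χ)
    (ha : 0 < a) (h0 : ∀ s ≤ a, χ s = 0) (h1 : ∀ s, b ≤ s → χ s = 1) (hm : Monotone χ)
    {x : Space n} {r η : ℝ} (hr : 0 ≤ r) (hbr : b ≤ r ^ 2) (hball : Metric.closedBall x r ⊆ Ω)
    (hη : ∀ y ∈ Metric.closedBall x r, ‖f y - f x‖ ≤ η) :
    ‖-(∫ y in frontier Ω, boundaryIntegrand ν f x y ∂μHE[2 * n - 1]) +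
        (∫ y in Ω, χ (‖x - y‖ ^ 2) • volumeIntegrand d x y) - f x‖ ≤ η := by
  have hω := sphereArea_pos n
  have hΨ := contDiff_cutoffPow (n := n) hχ ha h0
  have hgreen := setIntegral_smul_cliffordSymbol_add (by omega) hΩ hb hC hν hU hΩU hfc hf hd hΨ
    (fun s => (hΨ.differentiable one_ne_zero s).hasDerivAt) x
  have hout : ∀ y, y ∉ Metric.closedBall x r → b < ‖x - y‖ ^ 2 := fun y hy => by
    rw [Metric.mem_closedBall, not_le, dist_comm, dist_eq_norm] at hy
    exact hbr.trans_lt (pow_lt_pow_left₀ hy hr two_ne_zero)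
  have hw0 : ∀ y, y ∉ Metric.closedBall x r → cutoffKernel n χ (x - y) = 0 := fun y hy =>
    cutoffKernel_eq_zero hχ ha h0 h1 (hout y hy)
  have hwc : Continuous fun y => cutoffKernel n χ (x - y) :=
    (continuous_cutoffKernel hχ ha h0).comp (continuous_const.sub continuous_id)
  have hwi : Integrable (fun y => cutoffKernel n χ (x - y)) volume :=
    hwc.integrable_of_hasCompactSupport (HasCompactSupport.intro (isCompact_closedBall x r) hw0)
  have hw1 : ∫ y in Ω, cutoffKernel n χ (x - y) = 1 := by
    rw [setIntegral_eq_integral_of_forall_compl_eq_zero fun y hy => hw0 y fun h => hy (hball h),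
      integral_sub_left_eq_self (cutoffKernel n χ) volume x,
      integral_cutoffKernel (by omega) hχ ha h0 h1 hm]
  have hpow : ∀ y, (‖x - y‖ ^ 2) ^ n = ‖x - y‖ ^ (2 * n) := fun y => (pow_mul _ _ _).symm
  have e1 : ∫ y in Ω, χ (‖x - y‖ ^ 2) • volumeIntegrand d x y = (-(sphereArea n)⁻¹) •
      ∫ y in Ω, cutoffPow n χ (‖x - y‖ ^ 2) • cliffordSymbol (x - y) (fun i => d i y) := by
    rw [← integral_smul]
    refine integral_congr_ae ?_
    filter_upwards [ae_ne_restrict (by omega) x Ω] with y hy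
    rw [volumeIntegrand_eq hn d hy, cutoffPow, hpow]
    simp only [smul_smul]
    congr 1
    ring
  -- The boundary lies outside the ball of radius `r`, where `χ = 1`, so the cut-off does not affect
  -- the boundary term.
  have e2 : ∫ y in frontier Ω, boundaryIntegrand ν f x y ∂μHE[2 * n - 1] =
      (-(sphereArea n)⁻¹) • ∫ y in frontier Ω,
        cutoffPow n χ (‖x - y‖ ^ 2) • cliffordSymbol (x - y) (fun i => ν y i • f y)
          ∂μHE[2 * n - 1] := by
    rw [← integral_smul]
    refine setIntegral_congr_fun isClosed_frontier.measurableSet fun y hy => ?_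
    have hyΩ : y ∉ Ω := by rw [hΩ.frontier_eq] at hy; exact hy.2
    have hyb : y ∉ Metric.closedBall x r := fun h => hyΩ (hball h)
    have hyx : y ≠ x := fun h => hyb (h ▸ Metric.mem_closedBall_self hr)
    change boundaryIntegrand ν f x y = _
    rw [boundaryIntegrand_eq_volumeIntegrand, volumeIntegrand_eq hn _ hyx, cutoffPow, hpow,
      h1 _ (hout y hyb).le, one_mul]
  have e3 : ∫ y in Ω, cutoffKernel n χ (x - y) • f y = (sphereArea n)⁻¹ •
      ∫ y in Ω, (2 * n * cutoffPow n χ (‖x - y‖ ^ 2) +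
        2 * ‖x - y‖ ^ 2 * deriv (cutoffPow n χ) (‖x - y‖ ^ 2)) • f y := by
    rw [← integral_smul]
    simp_rw [smul_smul]
    rfl
  -- By Green's formula both kernel integrals together are a weighted mean of `f`. As the weight has
  -- mass one and vanishes off the ball, the distance to `f x` is at most the oscillation bound.
  have e4 : -(∫ y in frontier Ω, boundaryIntegrand ν f x y ∂μHE[2 * n - 1]) +
      (∫ y in Ω, χ (‖x - y‖ ^ 2) • volumeIntegrand d x y) =
      ∫ y in Ω, cutoffKernel n χ (x - y) • f y := by
    rw [e1, e2, e3, ← hgreen, smul_add, neg_smul, neg_smul]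
    abel
  have hcl : IsCompact (closure Ω) := hb.isCompact_closure
  have i1 : IntegrableOn (fun y => cutoffKernel n χ (x - y) • f y) Ω volume :=
    ((hwc.continuousOn.smul (hfc.mono hΩU)).integrableOn_compact hcl).mono_set subset_closure
  have i2 : IntegrableOn (fun y => cutoffKernel n χ (x - y) • f x) Ω volume :=
    hwi.integrableOn.smul_const _
  have e5 : (∫ y in Ω, cutoffKernel n χ (x - y) • f y) - f x =
      ∫ y in Ω, cutoffKernel n χ (x - y) • (f y - f x) := by
    simp_rw [smul_sub]
    rw [integral_sub i1 i2, integral_smul_const, hw1, one_smul]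
  rw [e4, e5]
  have h2 : ∫ y in Ω, cutoffKernel n χ (x - y) * η = η := by
    rw [integral_mul_const, hw1, one_mul]
  rw [← h2]
  refine norm_integral_le_of_norm_le (hwi.integrableOn.mul_const η)
    (Eventually.of_forall fun y => ?_)
  have hwn := cutoffKernel_nonneg (n := n) hχ ha h0 hm (x - y)
  rw [norm_smul, Real.norm_of_nonneg hwn]
  by_cases hy : y ∈ Metric.closedBall x r
  · exact mul_le_mul_of_nonneg_left (hη y hy) hwn
  · rw [hw0 y hy, zero_mul, zero_mul]

/-- The sharply truncated representation formula. -/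
theorem norm_setIntegral_diff_closedBall_sub_le (hn : 3 ≤ n) (hΩ : IsOpen Ω)
    (hb : Bornology.IsBounded Ω) (hC : HasC2Boundary Ω)
    (hν : ∀ y ∈ frontier Ω, IsOuterUnitNormal Ω y (ν y)) (hU : IsOpen U) (hΩU : closure Ω ⊆ U)
    (hfc : ContinuousOn f U) (hf : IsW12 U f d) (hd : ∀ i, IntegrableOn (d i) Ω volume)
    {x : Space n} {ε r η : ℝ} (hε : 0 < ε) (hεr : ε < r) (hball : Metric.closedBall x r ⊆ Ω)
    (hη : ∀ y ∈ Metric.closedBall x r, ‖f y - f x‖ ≤ η) :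
    ‖-(∫ y in frontier Ω, boundaryIntegrand ν f x y ∂μHE[2 * n - 1]) +
        (∫ y in Ω \ Metric.closedBall x ε, volumeIntegrand d x y) - f x‖ ≤ η := by
  -- In the variable `|x-y|²` the cut-offs rise over `[ε², ε² + δ j]`; this choice keeps the rise
  -- inside the ball of radius `r` while its width tends to zero.
  set δ : ℕ → ℝ := fun j => (r ^ 2 - ε ^ 2) / (j + 1) with hδ
  have hgap : 0 < r ^ 2 - ε ^ 2 := sub_pos.2 (pow_lt_pow_left₀ hεr hε.le two_ne_zero)
  have hδ0 : ∀ j, 0 < δ j := fun j => div_pos hgap (by positivity)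
  have hδr : ∀ j, ε ^ 2 + δ j ≤ r ^ 2 := fun j => by
    have : δ j ≤ r ^ 2 - ε ^ 2 := div_le_self hgap.le (by linarith [(Nat.cast_nonneg j : (0:ℝ) ≤ j)])
    linarith
  have hδlim : Tendsto δ atTop (𝓝 0) := by
    have h : Tendsto (fun j : ℕ => (r ^ 2 - ε ^ 2) * (1 / ((j : ℝ) + 1))) atTop
        (𝓝 ((r ^ 2 - ε ^ 2) * 0)) := tendsto_one_div_add_atTop_nhds_zero_nat.const_mul _
    rw [mul_zero] at h
    exact h.congr fun j => mul_one_div _ _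
  set χ : ℕ → ℝ → ℝ := fun j s => Real.smoothTransition ((s - ε ^ 2) / δ j) with hχ
  have hχs : ∀ j, ContDiff ℝ 1 (χ j) := fun j =>
    Real.smoothTransition.contDiff.comp ((contDiff_id.sub contDiff_const).div_const _)
  have hχ0 : ∀ j, ∀ s ≤ ε ^ 2, χ j s = 0 := fun j s hs =>
    Real.smoothTransition.zero_of_nonpos (div_nonpos_of_nonpos_of_nonneg (by linarith) (hδ0 j).le)
  have hχ1 : ∀ j, ∀ s, ε ^ 2 + δ j ≤ s → χ j s = 1 := fun j s hs =>
    Real.smoothTransition.one_of_one_le ((one_le_div (hδ0 j)).2 (by linarith))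
  have hχm : ∀ j, Monotone (χ j) := fun j s t hst =>
    Real.smoothTransition.monotone (div_le_div_of_nonneg_right (by linarith) (hδ0 j).le)
  have hbound := fun j => norm_setIntegral_cutoff_sub_le hn hΩ hb hC hν hU hΩU hfc hf hd (hχs j)
    (by positivity) (hχ0 j) (hχ1 j) (hχm j) (hε.le.trans hεr.le) (hδr j) hball hη
  have hBm : MeasurableSet (Metric.closedBall x ε) := Metric.isClosed_closedBall.measurableSet
  have hint := integrableOn_volumeIntegrand_diff_closedBall hn hΩ.measurableSet hd x hε
  have hlim : Tendsto (fun j => ∫ y in Ω, χ j (‖x - y‖ ^ 2) • volumeIntegrand d x y) atTop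
      (𝓝 (∫ y in Ω \ Metric.closedBall x ε, volumeIntegrand d x y)) := by
    have e1 : ∫ y in Ω \ Metric.closedBall x ε, volumeIntegrand d x y =
        ∫ y in Ω, (Metric.closedBall x ε)ᶜ.indicator (volumeIntegrand d x) y := by
      rw [setIntegral_indicator hBm.compl, Set.sdiff_eq]
    rw [e1]
    refine tendsto_integral_of_dominated_convergence
      (fun y => ‖(Metric.closedBall x ε)ᶜ.indicator (volumeIntegrand d x) y‖) (fun j => ?_) ?_
      (fun j => Eventually.of_forall fun y => ?_) (Eventually.of_forall fun y => ?_)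
    · have hz : Continuous fun y : Space n => x - y := by fun_prop
      exact ((hχs j).continuous.comp (hz.norm.pow 2)).aestronglyMeasurable.smul
        (aestronglyMeasurable_volumeIntegrand hn (fun i => (hd i).aestronglyMeasurable) x)
    · refine Integrable.norm ?_
      rw [integrable_indicator_iff hBm.compl, IntegrableOn, Measure.restrict_restrict hBm.compl,
        inter_comm, ← Set.sdiff_eq]
      exact hint
    · by_cases hy : y ∈ Metric.closedBall x ε
      · rw [hχ0 j _ (by
          rw [Metric.mem_closedBall, dist_comm, dist_eq_norm] at hy
          exact pow_le_pow_left₀ (norm_nonneg _) hy 2), zero_smul, norm_zero]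
        exact norm_nonneg _
      · rw [indicator_of_mem hy, norm_smul,
          Real.norm_of_nonneg (Real.smoothTransition.nonneg _)]
        exact mul_le_of_le_one_left (norm_nonneg _) (Real.smoothTransition.le_one _)
    · by_cases hy : y ∈ Metric.closedBall x ε
      · rw [indicator_of_notMem (notMem_compl_iff.2 hy)]
        refine tendsto_const_nhds.congr fun j => ?_
        rw [hχ0 j _ (by
          rw [Metric.mem_closedBall, dist_comm, dist_eq_norm] at hy
          exact pow_le_pow_left₀ (norm_nonneg _) hy 2), zero_smul]
      · rw [indicator_of_mem hy]
        have h1 : 0 < ‖x - y‖ ^ 2 - ε ^ 2 := by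
          rw [Metric.mem_closedBall, not_le, dist_comm, dist_eq_norm] at hy
          exact sub_pos.2 (pow_lt_pow_left₀ hy hε.le two_ne_zero)
        refine tendsto_const_nhds.congr' ?_
        filter_upwards [hδlim.eventually_lt_const h1] with j hj
        rw [hχ1 j _ (by linarith), one_smul]
  -- The bound `η` does not depend on `j`, so it passes to the sharp truncation.
  exact le_of_tendsto ((tendsto_const_nhds.add hlim).sub tendsto_const_nhds).norm
    (Eventually.of_forall hbound)

end Formula

/-- The integral over the complement of a small ball tends to the integral. -/
theorem tendsto_setIntegral_diff_closedBall {n : ℕ} (hn : 1 ≤ n) {F : Type*} [NormedAddCommGroup F]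
    [NormedSpace ℝ F] {Ω : Set (Space n)} {h : Space n → F}
    (hh : IntegrableOn h Ω volume) (x : Space n) :
    Tendsto (fun ε : ℝ => ∫ y in Ω \ Metric.closedBall x ε, h y) (𝓝[>] 0)
      (𝓝 (∫ y in Ω, h y)) := by
  have e1 : ∀ ε : ℝ, ∫ y in Ω \ Metric.closedBall x ε, h y =
      ∫ y in Ω, (Metric.closedBall x ε)ᶜ.indicator h y := fun ε => by
    rw [setIntegral_indicator Metric.isClosed_closedBall.measurableSet.compl, Set.sdiff_eq]
  simp_rw [e1]
  refine tendsto_integral_filter_of_dominated_convergence (fun y => ‖h y‖)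
    (Eventually.of_forall fun ε => ?_) (Eventually.of_forall fun ε => ?_) hh.norm ?_
  · exact hh.aestronglyMeasurable.indicator Metric.isClosed_closedBall.measurableSet.compl
  · exact Eventually.of_forall fun y => norm_indicator_le_norm_self _ _
  · filter_upwards [ae_ne_restrict hn x Ω] with y hy
    refine tendsto_const_nhds.congr' ?_
    filter_upwards [mem_nhdsWithin_of_mem_nhds (eventually_lt_nhds (dist_pos.2 hy))] with ε hε
    have hm : y ∈ (Metric.closedBall x ε)ᶜ := fun hm => not_lt.2 (Metric.mem_closedBall.1 hm) hε
    exact (indicator_of_mem hm h).symm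

end DiracTwo

theorem theorem3p1 (n : ℕ) (hn : 3 ≤ n) :
    -- `G_0` is a fundamental solution of `Δ²`
    (0 < biharmonicConst n ∧ IsBiharmonicFundamentalSolution (kernelG0 n)) ∧
    -- the explicit form of `H = 𝒟₀^* 𝒟₀ 𝒟₀^* G_1`
    (∀ x : Space n, x ≠ 0 → ∀ v : SpinorPair n,
      kernelH n x v =
        (-8 * ((n : ℝ) - 1) * ((n : ℝ) - 2) * biharmonicConst n) •
          ∑ A, ∑ j, (x (A, j) / ‖x‖ ^ (2 * n)) • gammaMinus n j (v A)) ∧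
    -- the representation formula
    ∀ Ω U : Set (Space n), IsOpen Ω → Bornology.IsBounded Ω → HasC2Boundary Ω →
      IsOpen U → closure Ω ⊆ U →
      ∀ (f : Space n → SpinorPlus n) (d : Fin 2 × Fin n → Space n → SpinorPlus n),
        ContinuousOn f U → IsW12 U f d →
        ∀ ν : Space n → Space n, (∀ y ∈ frontier Ω, IsOuterUnitNormal Ω y (ν y)) →
          -- at every point, with the volume integral as a principal value
          (∀ x ∈ Ω,
            IntegrableOn (boundaryIntegrand ν f x) (frontier Ω) μHE[2 * n - 1] ∧
            (∀ ε > 0, IntegrableOn (volumeIntegrand d x) (Ω \ Metric.closedBall x ε) volume) ∧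
            Tendsto (fun ε : ℝ =>
                -(∫ y in frontier Ω, boundaryIntegrand ν f x y ∂μHE[2 * n - 1]) +
                  ∫ y in Ω \ Metric.closedBall x ε, volumeIntegrand d x y)
              (𝓝[>] 0) (𝓝 (f x))) ∧
          -- at every point where the volume integral converges absolutely
          (∀ x ∈ Ω, IntegrableOn (volumeIntegrand d x) Ω volume →
            f x = -(∫ y in frontier Ω, boundaryIntegrand ν f x y ∂μHE[2 * n - 1]) +
              ∫ y in Ω, volumeIntegrand d x y) ∧
          -- which is the case at almost every point
          (∀ᵐ x ∂(volume.restrict Ω), IntegrableOn (volumeIntegrand d x) Ω volume) := by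
  refine ⟨⟨biharmonicConst_pos hn, isBiharmonicFundamentalSolution_kernelG0 hn⟩,
    fun x hx v => ?_, ?_⟩
  · rw [kernelH_eq_cliffordMul hn hx, cliffordMul_apply]
    simp_rw [Finset.smul_sum, smul_smul, div_eq_inv_mul]
  intro Ω U hΩ hb hC hU hΩU f d hfc hf ν hν
  have hcl : IsCompact (closure Ω) := hb.isCompact_closure
  -- On a bounded set square integrability gives integrability, which is all that the control of the
  -- volume integrals needs.
  have hd : ∀ i, IntegrableOn (d i) Ω volume := fun i => by
    have h1 : MemLp (d i) 2 (volume.restrict Ω) :=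
      (hf.memLp_deriv i).mono_measure (Measure.restrict_mono (subset_closure.trans hΩU) le_rfl)
    have h2 : IsFiniteMeasure ((volume : Measure (Space n)).restrict Ω) :=
      ⟨by
        rw [Measure.restrict_apply_univ]
        exact (measure_mono subset_closure).trans_lt hcl.measure_lt_top⟩
    exact h1.integrable one_le_two
  have hpv : ∀ x ∈ Ω, Tendsto (fun ε : ℝ =>
      -(∫ y in frontier Ω, boundaryIntegrand ν f x y ∂μHE[2 * n - 1]) +
        ∫ y in Ω \ Metric.closedBall x ε, volumeIntegrand d x y) (𝓝[>] 0) (𝓝 (f x)) := by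
    intro x hx
    have hfx : ContinuousAt f x :=
      hfc.continuousAt (hU.mem_nhds (hΩU (subset_closure hx)))
    refine Metric.tendsto_nhds.2 fun η hη => ?_
    have h1 : ∀ᶠ y in 𝓝 x, y ∈ Ω ∧ ‖f y - f x‖ ≤ η / 2 := by
      filter_upwards [hΩ.mem_nhds hx, Metric.tendsto_nhds.1 hfx (η / 2) (half_pos hη)] with y hy hy'
      exact ⟨hy, by rw [← dist_eq_norm]; exact hy'.le⟩
    -- On this ball `f` differs from `f x` by at most `η / 2`, so every truncation with `ε < r` is
    -- within `η / 2` of `f x`.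
    obtain ⟨r, hr, hball⟩ := Metric.nhds_basis_closedBall.mem_iff.1 h1
    filter_upwards [Ioo_mem_nhdsGT hr] with ε hε
    rw [dist_eq_norm]
    exact (norm_setIntegral_diff_closedBall_sub_le hn hΩ hb hC hν hU hΩU hfc hf hd hε.1 hε.2
      (fun y hy => (hball hy).1) fun y hy => (hball hy).2).trans_lt (half_lt_self hη)
  refine ⟨fun x hx => ⟨?_, fun ε hε => ?_, hpv x hx⟩, fun x hx hi => ?_, ?_⟩
  · refine (continuousOn_boundaryIntegrand hn (continuousOn_outerNormal hΩ hC hν)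
      (hfc.mono (frontier_subset_closure.trans hΩU)) fun h => ?_
      ).integrableOn_of_isCompact_of_lt_top (isCompact_frontier hb)
        (measure_frontier_lt_top (by omega) hΩ hb hC hν)
    rw [hΩ.frontier_eq] at h
    exact h.2 hx
  · exact integrableOn_volumeIntegrand_diff_closedBall hn hΩ.measurableSet hd x hε
  · exact tendsto_nhds_unique (hpv x hx)
      ((tendsto_setIntegral_diff_closedBall (by omega) hi x).const_add _)
  · exact ae_integrableOn_volumeIntegrand hn hΩ.measurableSet hb hd
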